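/- **Setting.** A *power-of-two weighted tree* is a finite tree $T$ with edge weights $w_T(e)\in\{2^i : i\in\mathbb Z_{\ge 0}\}$; $d_T$ is its path distance. Fix a root $\rho$ of $T$. For a subtree $U$ of $T$ let $\rho(U)$ be its vertex closest to $\rho$ and $w_U^{\max}$ the maximum weight of an edge of $U$. Every vertex of $T$ is a server that can serve one request; $k=|V(T)|$ requests $\sigma=r_1\dots r_k\in V(T)^k$ arrive one by one and each must be assigned on arrival to a free server. **Subtree-Decomposition** (SD) for a tree $U$ rooted at $\rho_U$ is defined recursively. If $|V(U)|=1$, assign to the only vertex. Otherwise choose arbitrarily a child $\rho^{(2)}$ of $\rho^{(1)}:=\rho_U$; removing the edge $\rho^{(1)}\rho^{(2)}$ leaves subtrees $U^{(1)}\ni\rho^{(1)}$ and $U^{(2)}\ni\rho^{(2)}$. Let $U_0$ be the maximal subtree of $U$ that contains $\rho_0:=\rho_U$ and no edge of maximum weight of $U$, let $\rho_1,\dots,\rho_l$ be the vertices outside $U_0$ whose parent is in $U_0$, and let $U_i$ ($1\le i\le l$) be the subtree of $U$ consisting of $\rho_i$ and its descendants. Let $\mathcal A_i$ and $\mathcal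 A_{(j)}$ be SD algorithms for $U_i$ rooted at $\rho_i$ ($0\le i\le l$) and for $U^{(j)}$ rooted at $\rho^{(j)}$ ($j=1,2$). Given a request $r\in U_i$, $r\in U^{(j)}$, and a nonempty set $F$ of free servers: - if $U_i$ has a free server, assign $r$ according to $\mathcal A_i$ (with free servers $F\cap V(U_i)$); - otherwise, if $U_0$ has a free server, assign according to $\mathcal A_0$ with request $\mathrm{par}(\rho_i)$ and free servers $F\cap V(U_0)$; - otherwise, if $U^{(j)}$ has a free server, assign $r$ according to $\mathcal A_{(j)}$ (with free servers $F\cap V(U^{(j)})$); - otherwise, assign according to $\mathcal A_{(3-j)}$ with request $\rho^{(3-j)}$ and free servers $F\cap V(U^{(3-j)})$. **Hybrid instances.** Let $\mathcal A^*$ be an SD algorithm for $T$ rooted at $\rho$. For an integer $t_d\ge 1$ and a server $a_d$, the hybrid algorithm $\mathcal H=(\mathcal A^*,t_d,a_d)$ assigns the $t_d$-th request to $a_d$ if $a_d$ is then free, and otherwise always assigns according to $\mathcal A^*$. For $\mathcal B\in\{\mathcal A^*,\mathcal H\}$ let $F_t(\mathcal B)$ be the set of free servers just after $\mathcal B$ has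 assigned $r_t$. A *hybrid instance* $H$ consists of $\mathcal H$ and a request sequence $\sigma$ such that $a_d\in F_{t_d}(\mathcal A^*)$. Its coupling time $t_c\ge t_d$ and cavities $h_t,a_t$ ($t_d\le t\le t_c$) are determined by $$F_t(\mathcal H)\setminus F_t(\mathcal A^*)=\{h_t\},\quad F_t(\mathcal A^*)\setminus F_t(\mathcal H)=\{a_t\}\ \ (t_d\le t\le t_c),\qquad F_t(\mathcal A^*)=F_t(\mathcal H)\ \ (t>t_c).$$ The length of the hybrid cycle is $$\mathring d_T(H)=d_T(h_{t_d},a_{t_d})+d_T(h_{t_c},a_{t_c})+\sum_{t=t_d+1}^{t_c}\bigl(d_T(h_{t-1},h_t)+d_T(a_{t-1},a_t)\bigr).$$ Let $T_H$ be the minimal subtree of $T$ containing all cavities $h_t,a_t$ ($t_d\le t\le t_c$), and $\rho_H=\rho(T_H)$. **Statement.** For every power-of-two weighted tree $T$, every root $\rho$, every SD algorithm $\mathcal A^*$ for $T$ rooted at $\rho$ (whatever the arbitrary choices), and every hybrid instance $H$ of $\mathcal A^*$, the coupling time and the cavities exist, and $$\mathring d_T(H)\ \le\ 2\,|E(T_H)|\,w_{T_H}^{\max}-2\,d_T\bigl(\mathrm{lca}(h_{t_d},a_d),\rho_H\bigr),$$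 where $\mathrm{lca}$ is the least common ancestor in $T$ rooted at $\rho$. -/

import Mathlib

open scoped NNReal

/-- A power-of-two weighted tree on the vertex set `V`: every edge weight is `2 ^ i` for some
natural number `i`. (The value of `w` on pairs that are not edges is irrelevant.) -/
structure PowTwoTree (V : Type*) where
  graph : SimpleGraph V
  isTree : graph.IsTree
  w : Sym2 V → ℝ≥0
  pow_two : ∀ e ∈ graph.edgeSet, ∃ i : ℕ, w e = 2 ^ i

/-- An assignment rule: given the current request and the set of free servers, it returns the
server to which the request is assigned. -/
abbrev AssignRule (V : Type*) := V → Finset V → V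

namespace PowTwoTree

noncomputable section

open scoped Classical

variable {V : Type*}

/-! ### Paths, distances, rooted-tree notions -/

/-- The unique simple path `P_T(u, v)`. -/
def path (T : PowTwoTree V) (u v : V) : T.graph.Walk u v :=
  (T.isTree.existsUnique_path u v).choose

/-- The path distance `d_T(u, v)`. -/
def dist (T : PowTwoTree V) (u v : V) : ℝ :=
  ((T.path u v).edges.map fun e => (T.w e : ℝ)).sum

/-- For the tree rooted at `ρ`: `x` is an ancestor of `v` (possibly `x = v`). -/
def IsAncestor (T : PowTwoTree V) (ρ x v : V) : Prop := x ∈ (T.path ρ v).support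

/-- The parent of `v` in the tree rooted at `ρ` (for `v ≠ ρ`). -/
def parent (T : PowTwoTree V) (ρ v : V) : V := (T.path ρ v).penultimate

variable [Fintype V]

theorem commonAncestors_nonempty (T : PowTwoTree V) (ρ u v : V) :
    (Finset.univ.filter fun x => T.IsAncestor ρ x u ∧ T.IsAncestor ρ x v).Nonempty :=
  ⟨ρ, Finset.mem_filter.2 ⟨Finset.mem_univ _, SimpleGraph.Walk.start_mem_support _,
    SimpleGraph.Walk.start_mem_support _⟩⟩

/-- The least common ancestor of `u` and `v` in the tree rooted at `ρ`: the common ancestor that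
is farthest from the root. -/
def lca (T : PowTwoTree V) (ρ u v : V) : V :=
  (Finset.exists_max_image _ (T.dist ρ) (T.commonAncestors_nonempty ρ u v)).choose

/-! Subtrees are represented by their vertex sets: a set `S` of vertices for which the subgraph of
`T` induced by `S` is connected. -/

/-- The edges of the subtree with vertex set `S`. -/
def edgesIn (T : PowTwoTree V) (S : Finset V) : Finset (Sym2 V) :=
  T.graph.edgeFinset.filter fun e => ∀ x ∈ e, x ∈ S

/-- The maximum weight of an edge of the subtree with vertex set `S`. -/
def wmax (T : PowTwoTree V) (S : Finset V) : ℝ := ((T.edgesIn S).sup T.w : ℝ≥0)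

/-- The set `E_max` of the heaviest edges of the subtree with vertex set `S`. -/
def heaviest (T : PowTwoTree V) (S : Finset V) : Finset (Sym2 V) :=
  (T.edgesIn S).filter fun e => ∀ e' ∈ T.edgesIn S, T.w e' ≤ T.w e

/-- The root of the subtree with vertex set `S`: its vertex closest to the root `ρ` of `T`. -/
def rootOf (T : PowTwoTree V) (ρ : V) (S : Finset V) : V :=
  if h : S.Nonempty then (Finset.exists_min_image S (T.dist ρ) h).choose else ρ

/-- The (vertex set of the) minimal subtree containing `C`: the intersection of all subtrees that
contain `C`. -/
def minSubtree (T : PowTwoTree V) (C : Finset V) : Finset V :=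
  Finset.univ.filter fun x => ∀ S : Finset V,
    (T.graph.induce (S : Set V)).Connected → C ⊆ S → x ∈ S

/-! ### Subtree-Decomposition -/

/-- The vertices of `S` below `x` (including `x`), for the subtree `S` rooted at `ρ`. -/
def below (T : PowTwoTree V) (S : Finset V) (ρ x : V) : Finset V :=
  S.filter fun v => T.IsAncestor ρ x v

/-- `T₀`: the maximal subtree of `S` that contains the root `ρ` and no heaviest edge of `S`. -/
def lightPart (T : PowTwoTree V) (S : Finset V) (ρ : V) : Finset V :=
  S.filter fun v => ∀ e ∈ (T.path ρ v).edges, e ∉ T.heaviest S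

/-- The vertices `ρ₁, …, ρ_l`: those outside `T₀` whose parent is in `T₀`. -/
def heavyRoots (T : PowTwoTree V) (S : Finset V) (ρ : V) : Finset V :=
  S.filter fun v => v ∉ T.lightPart S ρ ∧ T.parent ρ v ∈ T.lightPart S ρ

/-- The part of the decomposition with root `x`: `T₀` for `x = ρ`, and `T_i` for `x = ρ_i`. -/
def part (T : PowTwoTree V) (S : Finset V) (ρ x : V) : Finset V :=
  if x = ρ then T.lightPart S ρ else T.below S ρ x

/-- The root `ρ_i` (`0 ≤ i ≤ l`, `ρ₀ = ρ`) of the part `T_i` that contains `r`. -/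
def partRoot (T : PowTwoTree V) (S : Finset V) (ρ r : V) : V :=
  if h : ∃ x ∈ T.heavyRoots S ρ, r ∈ T.below S ρ x then h.choose else ρ

/-- One step of Subtree-Decomposition on the subtree `S` rooted at `ρ`, where `ρ₂` is the chosen
child of `ρ`, `B x` is the algorithm on the part with root `x` (`x = ρ, ρ₁, …, ρ_l`), `A₂` is the
algorithm on `T⁽²⁾` (the part of `S` below `ρ₂`) and `A₁` is the one on `T⁽¹⁾` (the rest of `S`). -/
def sdAssign (T : PowTwoTree V) (S : Finset V) (ρ ρ₂ : V) (B : V → AssignRule V)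
    (A₁ A₂ : AssignRule V) : AssignRule V := fun r F =>
  let T₀ := T.lightPart S ρ
  let x := T.partRoot S ρ r
  let Tx := T.part S ρ x
  let S₂ := T.below S ρ ρ₂
  let S₁ := S \ S₂
  if (F ∩ T₀).Nonempty then
    -- Phase 1
    if (F ∩ Tx).Nonempty then B x r (F ∩ Tx)
    else B ρ (T.parent ρ x) (F ∩ T₀)
  else
    -- Phase 2
    if (F ∩ Tx).Nonempty then B x r (F ∩ Tx)
    else if r ∈ S₁ then
      if (F ∩ S₁).Nonempty then A₁ r (F ∩ S₁) else A₂ ρ₂ (F ∩ S₂)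
    else
      if (F ∩ S₂).Nonempty then A₂ r (F ∩ S₂) else A₁ ρ (F ∩ S₁)

/-- `T.IsSD S ρ A`: the rule `A` is a Subtree-Decomposition algorithm for the subtree `S` rooted
at `ρ`. In every recursive call the child `ρ₂` of the root is chosen arbitrarily. -/
inductive IsSD (T : PowTwoTree V) : Finset V → V → AssignRule V → Prop
  | single (v : V) : IsSD T {v} v (fun _ _ => v)
  | step (S : Finset V) (ρ ρ₂ : V) (B : V → AssignRule V) (A₁ A₂ : AssignRule V)
      (hρ : ρ ∈ S) (hρ₂ : ρ₂ ∈ S) (hadj : T.graph.Adj ρ ρ₂)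
      (hB : ∀ x ∈ insert ρ (T.heavyRoots S ρ), IsSD T (T.part S ρ x) x (B x))
      (hA₁ : IsSD T (S \ T.below S ρ ρ₂) ρ A₁)
      (hA₂ : IsSD T (T.below S ρ ρ₂) ρ₂ A₂) :
      IsSD T S ρ (T.sdAssign S ρ ρ₂ B A₁ A₂)

end

end PowTwoTree

/-! ### Helper facts: a Subtree-Decomposition algorithm exists for every tree and every root -/

namespace PowTwoTree

section

open SimpleGraph

variable {V : Type*} (T : PowTwoTree V)

theorem path_isPath (u v : V) : (T.path u v).IsPath :=
  (T.isTree.existsUnique_path u v).choose_spec.1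

theorem eq_path {u v : V} {p : T.graph.Walk u v} (hp : p.IsPath) : p = T.path u v :=
  (T.isTree.existsUnique_path u v).unique hp (T.path_isPath u v)

open Classical in
theorem path_split {u v x : V} (h : x ∈ (T.path u v).support) :
    T.path u v = (T.path u x).append (T.path x v) := by
  rw [← T.eq_path ((T.path_isPath u v).takeUntil h), ← T.eq_path ((T.path_isPath u v).dropUntil h),
    Walk.take_spec]

theorem anc_of_mem {ρ v x y : V} (h : x ∈ (T.path ρ v).support) (hy : y ∈ (T.path x v).support) :
    x ∈ (T.path ρ y).support ∧ y ∈ (T.path ρ v).support := by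
  have h1 := T.path_split h
  refine ⟨?_, by rw [h1, Walk.mem_support_append_iff]; exact Or.inr hy⟩
  have h2 := T.path_split hy
  have h3 := T.path_isPath ρ v
  rw [h1, h2, Walk.append_assoc] at h3
  rw [← T.eq_path h3.of_append_left, Walk.mem_support_append_iff]
  exact Or.inl (Walk.end_mem_support _)

theorem path_self (u : V) : T.path u u = Walk.nil := (T.eq_path Walk.IsPath.nil).symm

theorem anc_trans {ρ v x y : V} (h : x ∈ (T.path ρ v).support) (hy : y ∈ (T.path ρ x).support) :
    y ∈ (T.path ρ v).support := by
  rw [T.path_split h, Walk.mem_support_append_iff]; exact Or.inl hy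

theorem edges_sub {ρ v x : V} (h : x ∈ (T.path ρ v).support) {e} (hy : e ∈ (T.path ρ x).edges) :
    e ∈ (T.path ρ v).edges := by
  rw [T.path_split h, Walk.edges_append]; simp [hy]

open Classical in
theorem mem_below {S : Finset V} {ρ x v : V} :
    v ∈ T.below S ρ x ↔ v ∈ S ∧ x ∈ (T.path ρ v).support := Finset.mem_filter

/-- `ρ ∈ S`, and `S` contains the path from `ρ` to each of its vertices. -/
def Cl (S : Finset V) (ρ : V) : Prop := ρ ∈ S ∧ ∀ v ∈ S, ∀ x ∈ (T.path ρ v).support, x ∈ S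

theorem cl_below {S : Finset V} {ρ x : V} (h : T.Cl S ρ) (hx : x ∈ S) :
    T.Cl (T.below S ρ x) x := by
  classical
  constructor
  · simp [mem_below, hx]
  · intro v hv y hy
    simp only [mem_below] at hv ⊢
    have := T.anc_of_mem hv.2 hy
    exact ⟨h.2 v hv.1 y this.2, this.1⟩

theorem not_below {S : Finset V} {ρ x : V} (hx : x ≠ ρ) : ρ ∉ T.below S ρ x := by
  simp [mem_below, path_self, hx]

open Classical in
theorem cl_rest {S : Finset V} {ρ x : V} (h : T.Cl S ρ) (hx : x ≠ ρ) :
    T.Cl (S \ T.below S ρ x) ρ := by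
  refine ⟨Finset.mem_sdiff.2 ⟨h.1, T.not_below hx⟩, fun v hv y hy => ?_⟩
  simp only [mem_below, Finset.mem_sdiff, not_and] at hv ⊢
  exact ⟨h.2 v hv.1 y hy, fun _ hxy => hv.2 hv.1 (T.anc_trans hy hxy)⟩

variable [Fintype V]

open Classical in
theorem mem_light {S : Finset V} {ρ v : V} :
    v ∈ T.lightPart S ρ ↔ v ∈ S ∧ ∀ e ∈ (T.path ρ v).edges, e ∉ T.heaviest S := Finset.mem_filter

theorem cl_light {S : Finset V} {ρ : V} (h : T.Cl S ρ) : T.Cl (T.lightPart S ρ) ρ := by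
  classical
  refine ⟨by simp [mem_light, path_self, h.1], fun v hv y hy => ?_⟩
  simp only [mem_light] at hv ⊢
  exact ⟨h.2 v hv.1 y hy, fun e he => hv.2 e (T.edges_sub hy he)⟩

theorem light_lt {S : Finset V} {ρ z : V} (h : T.Cl S ρ) (hz : z ∈ S) (ha : T.graph.Adj ρ z) :
    T.lightPart S ρ ⊂ S := by
  classical
  have hne : (T.edgesIn S).Nonempty := ⟨s(ρ, z), by simp [edgesIn, ha, h.1, hz]⟩
  obtain ⟨e, he, hmax⟩ := Finset.exists_max_image _ T.w hne
  have heh : e ∈ T.heaviest S := Finset.mem_filter.2 ⟨he, hmax⟩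
  refine (Finset.ssubset_iff_of_subset (Finset.filter_subset _ _)).2 ?_
  revert he hmax heh
  refine Sym2.ind (fun a b he hmax heh => ?_) e
  simp only [edgesIn, Finset.mem_filter, mem_edgeFinset, mem_edgeSet, Sym2.mem_iff] at he
  by_cases hb : b ∈ (T.path ρ a).support
  · refine ⟨a, he.2 a (by simp), fun hl => ?_⟩
    refine (Finset.mem_filter.1 hl).2 _ ?_ heh
    have : (Walk.cons he.1.symm Walk.nil).IsPath := by simp [he.1.ne']
    rw [T.path_split hb, ← T.eq_path this]; simp [Sym2.eq_swap]
  · refine ⟨b, he.2 b (by simp), fun hl => ?_⟩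
    refine (Finset.mem_filter.1 hl).2 _ ?_ heh
    rw [← T.eq_path ((T.path_isPath ρ a).concat hb he.1)]; simp

theorem exists_isSD_aux : ∀ (n : ℕ) (S : Finset V) (ρ : V), S.card = n → T.Cl S ρ →
    ∃ A, T.IsSD S ρ A := by
  classical
  intro n
  induction n using Nat.strong_induction_on with
  | _ n ih =>
    intro S ρ hn h
    have ih' : ∀ S' ρ', S' ⊂ S → T.Cl S' ρ' → ∃ A, T.IsSD S' ρ' A := fun S' ρ' hs hc =>
      ih _ (hn ▸ Finset.card_lt_card hs) S' ρ' rfl hc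
    by_cases h1 : ∃ v ∈ S, v ≠ ρ
    · obtain ⟨v, hv, hvρ⟩ := h1
      have hch : ∃ z ∈ S, T.graph.Adj ρ z := by
        have hcl := h.2 v hv
        revert hcl
        cases T.path ρ v with
        | nil => exact absurd rfl hvρ
        | cons hadj p => exact fun hcl => ⟨_, hcl _ (by simp), hadj⟩
      obtain ⟨z, hz, hadj⟩ := hch
      have hbelow : ∀ x, x ≠ ρ → T.below S ρ x ⊂ S := fun x hx =>
        (Finset.ssubset_iff_of_subset (Finset.filter_subset _ _)).2 ⟨ρ, h.1, T.not_below hx⟩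
      have hB : ∀ x, ∃ A, x ∈ insert ρ (T.heavyRoots S ρ) → T.IsSD (T.part S ρ x) x A := by
        intro x
        by_cases hx : x ∈ insert ρ (T.heavyRoots S ρ)
        · by_cases hxρ : x = ρ
          · obtain ⟨A, hA⟩ := ih' _ _ (T.light_lt h hz hadj) (T.cl_light h)
            subst hxρ
            exact ⟨A, fun _ => by simpa [part] using hA⟩
          · have hxS : x ∈ S := by
              rcases Finset.mem_insert.1 hx with h' | h'
              · exact absurd h' hxρ
              · exact (Finset.mem_filter.1 h').1
            obtain ⟨A, hA⟩ := ih' _ _ (hbelow x hxρ) (T.cl_below h hxS)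
            exact ⟨A, fun _ => by simpa [part, hxρ] using hA⟩
        · exact ⟨fun v _ => v, fun h => absurd h hx⟩
      choose B hB using hB
      have hzρ : z ≠ ρ := hadj.ne'
      obtain ⟨A₂, hA₂⟩ := ih' _ _ (hbelow z hzρ) (T.cl_below h hz)
      have hlt : S \ T.below S ρ z ⊂ S :=
        (Finset.ssubset_iff_of_subset Finset.sdiff_subset).2
          ⟨z, hz, fun hh => (Finset.mem_sdiff.1 hh).2 (T.cl_below h hz).1⟩
      obtain ⟨A₁, hA₁⟩ := ih' _ _ hlt (T.cl_rest h hzρ)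
      refine ⟨_, IsSD.step S ρ z B A₁ A₂ h.1 hz hadj (fun x hx => hB x (by convert hx)) ?_ hA₂⟩
      convert hA₁
    · have : S = {ρ} := by
        push Not at h1
        exact Finset.eq_singleton_iff_unique_mem.2 ⟨h.1, h1⟩
      subst this
      exact ⟨_, IsSD.single ρ⟩

/-- For every root there is a Subtree-Decomposition algorithm. -/
theorem exists_isSD (ρ : V) : ∃ A, T.IsSD Finset.univ ρ A :=
  T.exists_isSD_aux _ _ _ rfl ⟨Finset.mem_univ _, fun _ _ _ _ => Finset.mem_univ _⟩

end

end PowTwoTree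

/-! ### Hybrid algorithms, hybrid instances, cavities -/

noncomputable section

open scoped Classical

variable {V : Type*} [Fintype V]

/-- The set `F_t` of servers that are free just after the `t`-th request has been assigned, for an
online algorithm that sees the time, the current request and the set of free servers. All vertices
are servers; the `t`-th request is `σ t` for `1 ≤ t ≤ |V|` (no server is left afterwards, and the
other values of `σ` play no role). -/
def freeSet (alg : ℕ → AssignRule V) (σ : ℕ → V) : ℕ → Finset V
  | 0 => Finset.univ
  | t + 1 => (freeSet alg σ t).erase (alg (t + 1) (σ (t + 1)) (freeSet alg σ t))

/-- The hybrid algorithm `(A, t_d, a_d)`: the `t_d`-th request is assigned to `a_d` if `a_d` is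
free at that time; all other requests are assigned according to `A`. -/
def hybridAlg (A : AssignRule V) (td : ℕ) (ad : V) : ℕ → AssignRule V :=
  fun t r F => if t = td ∧ ad ∈ F then ad else A r F

/-- A hybrid instance of `A`: a decoupling time `t_d ≥ 1`, a decoupling server `a_d` and a request
sequence such that `a_d` is still free for `A` just after time `t_d`. -/
structure HybridInstance (A : AssignRule V) where
  td : ℕ
  ad : V
  σ : ℕ → V
  one_le_td : 1 ≤ td
  valid : ad ∈ freeSet (fun _ => A) σ td

namespace HybridInstance

variable {A : AssignRule V}

/-- `F_t(A, I)`. -/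
def freeA (H : HybridInstance A) (t : ℕ) : Finset V := freeSet (fun _ => A) H.σ t

/-- `F_t(H, I)` for the hybrid algorithm. -/
def freeH (H : HybridInstance A) (t : ℕ) : Finset V := freeSet (hybridAlg A H.td H.ad) H.σ t

/-- `tc` is the coupling time of `H`, and `h t`, `a t` are the cavities of the hybrid algorithm and
of `A` at the times `t_d ≤ t ≤ tc`. -/
structure IsCavities (H : HybridInstance A) (tc : ℕ) (h a : ℕ → V) : Prop where
  td_le : H.td ≤ tc
  hCavity : ∀ t, H.td ≤ t → t ≤ tc → H.freeH t \ H.freeA t = {h t}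
  aCavity : ∀ t, H.td ≤ t → t ≤ tc → H.freeA t \ H.freeH t = {a t}
  coupled : ∀ t, tc < t → H.freeA t = H.freeH t

/-- The set `Cav(H)` of all cavities. -/
def cavSet (H : HybridInstance A) (tc : ℕ) (h a : ℕ → V) : Finset V :=
  (Finset.Icc H.td tc).image h ∪ (Finset.Icc H.td tc).image a

/-- The length of the hybrid cycle
`h_{td} → ⋯ → h_{tc} → a_{tc} → ⋯ → a_{td} → h_{td}` with respect to the distance `d`. -/
def cycleLength (H : HybridInstance A) (d : V → V → ℝ) (tc : ℕ) (h a : ℕ → V) : ℝ :=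
  d (h H.td) (a H.td) + d (h tc) (a tc) +
    ∑ t ∈ Finset.Icc (H.td + 1) tc, (d (h (t - 1)) (h t) + d (a (t - 1)) (a t))

end HybridInstance

end

/-! The length of the cycle is a sum over edges of weight times number of crossings. Replacing the
step between `h_{t_d}` and `a_d` by the way up to `ρ_H` and down again lengthens the cycle by `2
d(lca, ρ_H)`, so it suffices to bound the resulting closed walk by `2 (|S| - 1) W` in a subtree `S`
whose edges weigh at most `W` (`cycleLength_add_le`, `walkLength_le`).

Each request induces a consistent ranking of the servers and takes the first free one. If a request
moves a cavity from `h` to `h'`, it ranks `h` before `h'`, and `h'` before all other servers free in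
both runs and before the other cavity (`cavity_step`). Call `X` a block if, whenever one element of
`X` ranks before a given vertex outside, all elements of `X` do. A cavity can leave a block only
when nothing in it is free and the other cavity is not there; afterwards no cavity can enter. Hence
the boundary of a block is crossed at most twice (`crossings_le_two`).

The bound on the walk follows by strong induction on `|S|`. Let `W` be the maximum weight and cut
`S` at its first heavy edges. The parts below these edges are blocks: the cavities restricted to
such a part are again a possible course, which bounds the inner edges by induction, and the heavy
edge above the part is crossed at most twice. In the light part all weights are at most `W / 2`, so
there is room for two closed walks. Positions outside it are projected to the upper ends (gates) of
the heavy edges. If both cavities visit the light part, the walk is cut just before the second one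
enters, into a closed walk of one cavity and one of both. If only one visits, its stay is one closed
walk, and the rest crosses each light edge at most twice, because the non-light vertices below a
light vertex form a block among all non-light vertices.

The rankings have these properties by the design of the algorithm: the part of the request comes
first, then the light part as seen from the gate, and then the recursion along child edges, which
prefers the side of the request at every removed edge (`IsSD.served`). Recursion into the parts
transfers this to all subtrees and all weights (`IsSD.modular`, `IsSD.goodOrder`). -/

/-! ### Rooted trees, light parts and compatible orders -/

/-- A finite rooted weighted tree, given by its ancestor relation: `wt v` is the weight of the edge
from `v` to its parent. -/
structure AncTree (V : Type*) where
  anc : V → V → Prop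
  par : V → V
  root : V
  wt : V → ℝ
  refl : ∀ v, anc v v
  trans : ∀ {x y z}, anc x y → anc y z → anc x z
  antisymm : ∀ {x y}, anc x y → anc y x → x = y
  chain : ∀ {x y v}, anc x v → anc y v → anc x y ∨ anc y x
  root_anc : ∀ v, anc root v
  par_anc : ∀ {v}, v ≠ root → anc (par v) v
  anc_par : ∀ {x v}, anc x v → x ≠ v → anc x (par v)
  par_ne : ∀ {v}, v ≠ root → par v ≠ v
  wt_nonneg : ∀ v, 0 ≤ wt v
  double : ∀ {u v}, u ≠ root → v ≠ root → wt u < wt v → 2 * wt u ≤ wt v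

namespace AncTree

variable {V : Type*} (R : AncTree V)

/-- All edges on the path from `c` down to `v` weigh less than `W`. -/
def light (c : V) (W : ℝ) (v : V) : Prop :=
  ∀ x, R.anc c x → x ≠ c → R.anc x v → R.wt x < W

/-- The edge above `y` is the first edge of weight at least `W` on the path from `c` to `y`. -/
def heavy (c : V) (W : ℝ) (y : V) : Prop :=
  R.anc c y ∧ y ≠ c ∧ W ≤ R.wt y ∧ R.light c W (R.par y)

/-- `S` is the vertex set of a subtree with top vertex `c`. -/
def Sub (S : Finset V) (c : V) : Prop :=
  c ∈ S ∧ ∀ v ∈ S, R.anc c v ∧ ∀ y, R.anc c y → R.anc y v → y ∈ S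

variable {R}

theorem ne_root_of_anc {c v : V} (h : R.anc c v) (hn : v ≠ c) : v ≠ R.root := by
  rintro rfl
  exact hn (R.antisymm (R.root_anc c) h)

theorem anc_par_of_anc {c v : V} (h : R.anc c v) (hn : v ≠ c) : R.anc c (R.par v) :=
  R.anc_par h hn.symm

theorem par_anc_of_anc {c v : V} (h : R.anc c v) (hn : v ≠ c) : R.anc (R.par v) v :=
  R.par_anc (ne_root_of_anc h hn)

theorem light_of_anc {c x v : V} {W : ℝ} (h : R.light c W v) (hx : R.anc x v) : R.light c W x :=
  fun y h1 h2 h3 => h y h1 h2 (R.trans h3 hx)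

theorem light_self (c : V) (W : ℝ) : R.light c W c :=
  fun _ h1 h2 h3 => absurd (R.antisymm h3 h1) h2

theorem heavy.not_light {c y v : V} {W : ℝ} (h : R.heavy c W y) (hv : R.anc y v) :
    ¬ R.light c W v :=
  fun hl => absurd (hl y h.1 h.2.1 hv) (not_lt.2 h.2.2.1)

theorem heavy.par_anc {c y : V} {W : ℝ} (h : R.heavy c W y) : R.anc (R.par y) y :=
  par_anc_of_anc h.1 h.2.1

theorem exists_heavy [Finite V] {c v : V} {W : ℝ} (h : ¬ R.light c W v) :
    ∃ y, R.heavy c W y ∧ R.anc y v := by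
  classical
  have := Fintype.ofFinite V
  -- The topmost heavy edge is wanted; the number of ancestors serves as depth.
  let D : Finset V := Finset.univ.filter fun x => R.anc c x ∧ x ≠ c ∧ R.anc x v ∧ W ≤ R.wt x
  have hD : D.Nonempty := by
    unfold light at h
    push Not at h
    obtain ⟨x, h1, h2, h3, h4⟩ := h
    exact ⟨x, by simp [D, h1, h2, h3, h4]⟩
  obtain ⟨y, hy, hmin⟩ := Finset.exists_min_image D
    (fun x => (Finset.univ.filter fun z => R.anc z x).card) hD
  simp only [D, Finset.mem_filter, Finset.mem_univ, true_and] at hy hmin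
  refine ⟨y, ⟨hy.1, hy.2.1, hy.2.2.2, fun x h1 h2 h3 => ?_⟩, hy.2.2.1⟩
  by_contra hw
  have hpa := par_anc_of_anc hy.1 hy.2.1
  have hxy := R.trans h3 hpa
  have := hmin x ⟨h1, h2, R.trans hxy hy.2.2.1, not_lt.1 hw⟩
  refine absurd this (not_le.2 (Finset.card_lt_card ?_))
  refine (Finset.ssubset_iff_of_subset fun z hz => ?_).2 ⟨y, by simp [R.refl], fun hyx => ?_⟩
  · simp only [Finset.mem_filter, Finset.mem_univ, true_and] at hz ⊢
    exact R.trans hz hxy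
  · simp only [Finset.mem_filter, Finset.mem_univ, true_and] at hyx
    exact R.par_ne (ne_root_of_anc hy.1 hy.2.1) (R.antisymm hpa (R.trans hyx h3))

/-- Both are ancestors of `v`, hence comparable; the upper one would lie on the light path to the
parent of the lower one. -/
theorem heavy.unique {c x y v : V} {W : ℝ} (hx : R.heavy c W x) (hy : R.heavy c W y)
    (hxv : R.anc x v) (hyv : R.anc y v) : x = y := by
  by_contra hne
  rcases R.chain hxv hyv with h | h
  · exact hx.not_light (R.anc_par h hne) hy.2.2.2
  · exact hy.not_light (R.anc_par h (Ne.symm hne)) hx.2.2.2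

/-- A light vertex is an ancestor of a vertex below a heavy edge iff it is one of the upper end
of that edge. -/
theorem heavy.anc_iff {c x y v : V} {W : ℝ} (hy : R.heavy c W y) (hyv : R.anc y v)
    (hx : R.light c W x) : R.anc x v ↔ R.anc x (R.par y) := by
  constructor
  · intro h
    rcases R.chain h hyv with h1 | h1
    · exact R.anc_par h1 fun h2 => hy.not_light (R.refl y) (h2 ▸ hx)
    · exact absurd hx (hy.not_light h1)
  · intro h
    exact R.trans (R.trans h hy.par_anc) hyv

theorem Sub.anc {S : Finset V} {c v : V} (h : R.Sub S c) (hv : v ∈ S) : R.anc c v := (h.2 v hv).1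

theorem Sub.mem_of_anc {S : Finset V} {c v x : V} (h : R.Sub S c) (hv : v ∈ S) (h1 : R.anc c x)
    (h2 : R.anc x v) : x ∈ S := (h.2 v hv).2 x h1 h2

open Classical in
theorem Sub.light {S : Finset V} {c : V} (h : R.Sub S c) (W : ℝ) :
    R.Sub (S.filter fun v => R.light c W v) c := by
  refine ⟨by simp [h.1, light_self], fun v hv => ?_⟩
  rw [Finset.mem_filter] at hv
  refine ⟨h.anc hv.1, fun y h1 h2 => ?_⟩
  rw [Finset.mem_filter]
  exact ⟨h.mem_of_anc hv.1 h1 h2, light_of_anc hv.2 h2⟩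

open Classical in
theorem Sub.below {S : Finset V} {c x : V} (h : R.Sub S c) (hx : x ∈ S) :
    R.Sub (S.filter fun v => R.anc x v) x := by
  refine ⟨by simp [hx, R.refl], fun v hv => ?_⟩
  rw [Finset.mem_filter] at hv
  refine ⟨hv.2, fun y h1 h2 => ?_⟩
  rw [Finset.mem_filter]
  exact ⟨h.mem_of_anc hv.1 (R.trans (h.anc hx) h1) h2, h1⟩

variable (R) in
/-- The compatibility of a preference order `lt` with the decomposition of the subtree `S`
(with top `c`) at weight `W`. -/
structure Modular (lt : V → V → Prop) (S : Finset V) (c : V) (W : ℝ) : Prop where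
  light_module : ∀ u ∈ S, ∀ u' ∈ S, ∀ v ∈ S, R.light c W u → R.light c W u' → ¬ R.light c W v →
    lt u v → lt u' v
  part_module : ∀ y, R.heavy c W y → ∀ u ∈ S, ∀ u' ∈ S, ∀ v ∈ S, R.anc y u → R.anc y u' →
    ¬ R.anc y v → lt u v → lt u' v
  below_module : ∀ x, R.anc c x → x ≠ c → R.light c W x → ∀ u ∈ S, ∀ u' ∈ S, ∀ v ∈ S,
    R.anc x u → R.anc x u' → ¬ R.anc x v → ¬ R.light c W u → ¬ R.light c W u' → ¬ R.light c W v →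
    lt u v → lt u' v
  -- A vertex below a heavy edge beats a light one only if the request is in its part, and then it
  -- beats everything outside that part.
  first : ∀ y, R.heavy c W y → ∀ v ∈ S, ∀ f ∈ S, ∀ u ∈ S, R.anc y v → R.light c W f →
    ¬ R.anc y u → lt v f → lt v u
  -- A request below the heavy edge above `y` reaches the light part as a request at `par y`, which
  -- then ranks first there.
  port : ∀ y, R.heavy c W y → ∀ u ∈ S, ∀ s ∈ S, R.anc y u → R.light c W s → s ≠ R.par y →
    lt u s → lt (R.par y) s

variable (R) in
/-- A preference order that is compatible with all decompositions of all subtrees. -/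
structure GoodOrder (lt : V → V → Prop) : Prop where
  asymm : ∀ u v, lt u v → ¬ lt v u
  -- `W` may exceed all weights in `S`; then `S` is entirely light and the conditions are void.
  modular : ∀ (S : Finset V) (c : V) (W : ℝ), R.Sub S c → (∀ x ∈ S, x ≠ c → R.wt x ≤ W) →
    R.Modular lt S c W

end AncTree

/-! ### Crossing numbers -/

section Crossing

open Classical in
/-- `0` if the propositions are equivalent and `1` otherwise. -/
noncomputable def xr (p q : Prop) : ℝ := if p ↔ q then 0 else 1

theorem xr_nonneg (p q : Prop) : 0 ≤ xr p q := by unfold xr; split_ifs <;> norm_num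

theorem xr_self (p : Prop) : xr p p = 0 := by simp [xr]

theorem xr_comm (p q : Prop) : xr p q = xr q p := by
  unfold xr; by_cases p <;> by_cases q <;> simp_all

theorem xr_triangle (p q r : Prop) : xr p r ≤ xr p q + xr q r := by
  unfold xr; by_cases p <;> by_cases q <;> by_cases r <;> simp_all

/-- The number of changes of `α` between the times `s` and `t`. -/
noncomputable def changes (α : ℕ → Prop) (s t : ℕ) : ℝ := ∑ i ∈ Finset.Ico s t, xr (α i) (α (i + 1))

theorem changes_self (α : ℕ → Prop) (s : ℕ) : changes α s s = 0 := by simp [changes]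

theorem changes_succ (α : ℕ → Prop) {s t : ℕ} (h : s ≤ t) :
    changes α s (t + 1) = changes α s t + xr (α t) (α (t + 1)) := by
  simp [changes, Finset.sum_Ico_succ_top h]

theorem changes_add (α : ℕ → Prop) {s t u : ℕ} (h : s ≤ t) (h' : t ≤ u) :
    changes α s u = changes α s t + changes α t u := by
  simp [changes, Finset.sum_Ico_consecutive _ h h']

theorem changes_congr {α β : ℕ → Prop} {s t : ℕ} (h : ∀ i, s ≤ i → i ≤ t → (α i ↔ β i)) :
    changes α s t = changes β s t := by
  refine Finset.sum_congr rfl fun i hi => ?_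
  rw [Finset.mem_Ico] at hi
  rw [propext (h i hi.1 hi.2.le), propext (h (i + 1) (by omega) (by omega))]

/-- If `α` never changes after it has become true, then it has changed as often as it has to. -/
theorem xr_add_changes {α : ℕ → Prop} {s t : ℕ} (hst : s ≤ t)
    (h : ∀ i, s ≤ i → i < t → ¬ α i ∨ (α i ↔ α (i + 1))) :
    xr (α s) False + changes α s t = xr (α t) False := by
  induction t, hst using Nat.le_induction with
  | base => simp [changes_self]
  | succ n hn ih =>
    rw [changes_succ _ hn, ← add_assoc, ih fun i h1 h2 => h i h1 (by omega)]
    rcases h n hn (by omega) with h' | h'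
    · rw [xr_comm (α n) (α (n + 1)), propext (iff_false_intro h'), xr_self, zero_add]
    · rw [propext h', xr_self, add_zero]

/-- The number of crossings of the closed walk that comes in to the initial positions of both
cavities from outside, and joins their final positions. -/
noncomputable def crossings (α β : ℕ → Prop) (s t : ℕ) : ℝ :=
  xr (α s) False + xr (β s) False + changes α s t + changes β s t + xr (α t) (β t)

theorem crossings_comm (α β : ℕ → Prop) (s t : ℕ) : crossings α β s t = crossings β α s t := by
  unfold crossings
  rw [xr_comm (α t)]
  ring

theorem crossings_congr {α β α' β' : ℕ → Prop} {s t : ℕ} (hst : s ≤ t)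
    (h : ∀ i, s ≤ i → i ≤ t → (α i ↔ α' i)) (h' : ∀ i, s ≤ i → i ≤ t → (β i ↔ β' i)) :
    crossings α β s t = crossings α' β' s t := by
  unfold crossings
  rw [changes_congr h, changes_congr h', propext (h s le_rfl hst), propext (h' s le_rfl hst),
    propext (h t hst le_rfl), propext (h' t hst le_rfl)]

/-- The invariant in the count of crossings: `p`, `q` tell whether the cavities are inside, `d`
whether nothing inside is free, and `K` is the number of crossings so far. -/
def CrossInv (p q d : Prop) (K : ℝ) : Prop :=
  (p → q → K = 2) ∧ (p → ¬ q → K = 1) ∧ (¬ p → q → K = 1) ∧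
    (¬ p → ¬ q → K = 0 ∨ (d ∧ K = 2))

/-- Two cavities inside hold each other there. A single one may leave only when nothing inside is
free, which raises the count to two and excludes any later entry. -/
theorem CrossInv.step {p q d p' q' d' : Prop} {K : ℝ} (h : CrossInv p q d K) (hd : d → d')
    (hp : p → ¬ p' → d ∧ ¬ q) (hq : q → ¬ q' → d ∧ ¬ p) (hp' : ¬ p → p' → ¬ d)
    (hq' : ¬ q → q' → ¬ d) : CrossInv p' q' d' (K + xr p p' + xr q q') := by
  unfold CrossInv xr at *
  by_cases p <;> by_cases q <;> by_cases d <;> simp_all <;>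
    by_cases p' <;> by_cases q' <;> simp_all <;> norm_num

/-- `D` says that nothing inside is free. By `CrossInv` the count before closing the walk is two
with both or neither inside, or zero with neither, so that closing is free, or it is one with
exactly one inside, so that closing costs one. -/
theorem crossings_le_two {α β D : ℕ → Prop} {s t : ℕ} (hst : s ≤ t)
    (hD : ∀ i, s ≤ i → i < t → D i → D (i + 1))
    (hα : ∀ i, s ≤ i → i < t → α i → ¬ α (i + 1) → D i ∧ ¬ β i)
    (hβ : ∀ i, s ≤ i → i < t → β i → ¬ β (i + 1) → D i ∧ ¬ α i)
    (hα' : ∀ i, s ≤ i → i < t → ¬ α i → α (i + 1) → ¬ D i)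
    (hβ' : ∀ i, s ≤ i → i < t → ¬ β i → β (i + 1) → ¬ D i) :
    crossings α β s t ≤ 2 := by
  have key : CrossInv (α t) (β t) (D t)
      (xr (α s) False + xr (β s) False + changes α s t + changes β s t) := by
    induction t, hst using Nat.le_induction with
    | base =>
      simp only [changes_self, xr, CrossInv]
      by_cases α s <;> by_cases β s <;> simp_all <;> norm_num
    | succ n hn ih =>
      have ih := ih (fun i h1 h2 => hD i h1 (by omega)) (fun i h1 h2 => hα i h1 (by omega))
        (fun i h1 h2 => hβ i h1 (by omega)) (fun i h1 h2 => hα' i h1 (by omega))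
        (fun i h1 h2 => hβ' i h1 (by omega))
      convert ih.step (hD n hn (by omega)) (hα n hn (by omega)) (hβ n hn (by omega))
        (hα' n hn (by omega)) (hβ' n hn (by omega)) using 1
      rw [changes_succ _ hn, changes_succ _ hn]
      ring
  unfold crossings
  unfold CrossInv at key
  generalize xr (α s) False + xr (β s) False + changes α s t + changes β s t = K at *
  unfold xr
  by_cases α t <;> by_cases β t <;> simp_all <;> grind

end Crossing

/-! ### Courses of two cavities -/

namespace AncTree

/-- The position `o` is a vertex with the property `X`. -/
def At {V : Type*} (X : V → Prop) (o : Option V) : Prop := ∃ v, o = some v ∧ X v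

theorem at_some {V : Type*} {X : V → Prop} {v : V} : At X (some v) ↔ X v := by simp [At]

theorem not_at_none {V : Type*} {X : V → Prop} : ¬ At X none := by simp [At]

open Classical in
/-- The position `o` if it has the property `X`, and no position otherwise. -/
noncomputable def restr {V : Type*} (X : V → Prop) (o : Option V) : Option V :=
  o.bind fun v => if X v then some v else none

theorem restr_eq_some {V : Type*} {X : V → Prop} {o : Option V} {v : V} :
    restr X o = some v ↔ o = some v ∧ X v := by
  unfold restr
  rcases o with _ | u
  · simp
  · by_cases hu : X u
    · simp [hu]; rintro rfl; exact hu
    · simp [hu]; rintro rfl; exact hu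

theorem restr_eq_none {V : Type*} {X : V → Prop} {o : Option V} :
    restr X o = none ↔ ¬ At X o := by
  rw [Option.eq_none_iff_forall_not_mem]
  simp [Option.mem_def, restr_eq_some, At]

variable {V : Type*} (R : AncTree V)

/-- A cavity at `h` moves to `h'`, while the other one is at `a` and the vertices in `F` are free.
The position `none` stands for a cavity that has not appeared yet, or has disappeared. -/
def Move (F : Finset V) (h a h' : Option V) : Prop :=
  h' = h ∨
  -- For `h = none` no order is required: a cavity may appear at any free vertex.
  (∃ s ∈ F, h' = some s ∧ ∀ x, h = some x → ∃ lt : V → V → Prop, R.GoodOrder lt ∧ lt x s ∧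
    (∀ f ∈ F, f ≠ s → lt s f) ∧ ∀ y, a = some y → lt s y) ∨
  -- This is what leaving a block looks like from inside the block.
  (h' = none ∧ F = ∅ ∧ a = none)

/-- A possible course of the two cavities `h`, `a` in the subtree `S` between the times `s`
and `t`. -/
structure Trace (S : Finset V) (F : ℕ → Finset V) (h a : ℕ → Option V) (s t : ℕ) : Prop where
  anti : ∀ i, s ≤ i → i < t → F (i + 1) ⊆ F i
  moveh : ∀ i, s ≤ i → i < t → R.Move (F i) (h i) (a i) (h (i + 1))
  movea : ∀ i, s ≤ i → i < t → R.Move (F i) (a i) (h i) (a (i + 1))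
  one : ∀ i, s ≤ i → i < t → h (i + 1) = h i ∨ a (i + 1) = a i
  memh : ∀ i, s ≤ i → i ≤ t → ∀ v, h i = some v → v ∈ S
  mema : ∀ i, s ≤ i → i ≤ t → ∀ v, a i = some v → v ∈ S

variable {R}

/-- The order puts the old position, hence all of `X`, before the new position `s`; but `s` comes
before every other free vertex and before the other cavity, so neither can be in `X`. -/
theorem Move.leave {F S : Finset V} {h a h' : Option V} (m : R.Move F h a h') {X : V → Prop}
    (ha : ∀ y, a = some y → y ∈ S)
    (hX : ∀ lt, R.GoodOrder lt → ∀ u s, h = some u → h' = some s → X u → ¬ X s →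
      ∀ u' ∈ S, X u' → lt u s → lt u' s)
    (h1 : At X h) (h2 : ¬ At X h') : (∀ f ∈ F, f ∈ S → ¬ X f) ∧ ¬ At X a := by
  obtain ⟨u, rfl, hu⟩ := h1
  rcases m with rfl | ⟨s, hs, rfl, hm⟩ | ⟨rfl, rfl, rfl⟩
  · exact absurd (at_some.2 hu) h2
  · obtain ⟨lt, hlt, hus, hsf, hsy⟩ := hm u rfl
    have hXs : ¬ X s := fun h => h2 (at_some.2 h)
    have := hX lt hlt u s rfl rfl hu hXs
    refine ⟨fun f hf hfS hXf => ?_, ?_⟩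
    · exact hlt.asymm _ _ (this f hfS hXf hus) (hsf f hf fun h => hXs (h ▸ hXf))
    · rintro ⟨y, rfl, hy⟩
      exact hlt.asymm _ _ (this y (ha y rfl) hy hus) (hsy y rfl)
  · simp [not_at_none]

theorem Move.enter {F : Finset V} {h a h' : Option V} (m : R.Move F h a h') {X : V → Prop}
    (h1 : ¬ At X h) (h2 : At X h') : ∃ s ∈ F, h' = some s ∧ X s := by
  obtain ⟨u, rfl, hu⟩ := h2
  rcases m with rfl | ⟨s, hs, h3, -⟩ | ⟨h3, -⟩
  · exact absurd (at_some.2 hu) h1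
  · obtain rfl := Option.some.inj h3
    exact ⟨u, hs, rfl, hu⟩
  · cases h3

theorem Trace.swap {S : Finset V} {F : ℕ → Finset V} {h a : ℕ → Option V} {s t : ℕ}
    (tr : R.Trace S F h a s t) : R.Trace S F a h s t :=
  ⟨tr.anti, tr.movea, tr.moveh, fun i h1 h2 => (tr.one i h1 h2).symm, tr.mema, tr.memh⟩

theorem Trace.anti_le {S : Finset V} {F : ℕ → Finset V} {h a : ℕ → Option V} {s t : ℕ}
    (tr : R.Trace S F h a s t) {i j : ℕ} (hi : s ≤ i) (hij : i ≤ j) (hj : j ≤ t) : F j ⊆ F i := by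
  induction j, hij using Nat.le_induction with
  | base => exact subset_rfl
  | succ n hn ih => exact (tr.anti n (by omega) (by omega)).trans (ih (by omega))

/-- `X` is a block of `S` for all compatible orders. -/
def IsBlock (R : AncTree V) (S : Finset V) (X : V → Prop) : Prop :=
  ∀ lt, R.GoodOrder lt → ∀ u ∈ S, ∀ u' ∈ S, ∀ v ∈ S, X u → X u' → ¬ X v → lt u v → lt u' v

section Block

variable {S : Finset V} {F : ℕ → Finset V} {h a : ℕ → Option V} {s t : ℕ} {X : V → Prop}

theorem Trace.leave (tr : R.Trace S F h a s t) (hX : R.IsBlock S X) {i : ℕ} (hi : s ≤ i)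
    (hit : i < t) (h1 : At X (h i)) (h2 : ¬ At X (h (i + 1))) :
    (∀ f ∈ F i, f ∈ S → ¬ X f) ∧ ¬ At X (a i) :=
  (tr.moveh i hi hit).leave (tr.mema i hi hit.le)
    (fun lt hlt u v hu hv hXu hXv u' hu' hXu' =>
      hX lt hlt u (tr.memh i hi hit.le u hu) u' hu' v (tr.memh _ (by omega) (by omega) v hv)
        hXu hXu' hXv) h1 h2

theorem Trace.crossings_le_two (tr : R.Trace S F h a s t) (hst : s ≤ t) (hX : R.IsBlock S X) :
    crossings (fun i => At X (h i)) (fun i => At X (a i)) s t ≤ 2 := by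
  refine _root_.crossings_le_two (D := fun i => ∀ f ∈ F i, f ∈ S → ¬ X f) hst
    (fun i h1 h2 hD f hf => hD f (tr.anti i h1 h2 hf))
    (fun i h1 h2 => tr.leave hX h1 h2) (fun i h1 h2 => tr.swap.leave hX h1 h2) ?_ ?_
  · intro i h1 h2 h3 h4 hD
    obtain ⟨v, hv, hv', hXv⟩ := (tr.moveh i h1 h2).enter h3 h4
    exact hD v hv (tr.memh _ (by omega) (by omega) v hv') hXv
  · intro i h1 h2 h3 h4 hD
    obtain ⟨v, hv, hv', hXv⟩ := (tr.movea i h1 h2).enter h3 h4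
    exact hD v hv (tr.mema _ (by omega) (by omega) v hv') hXv

open Classical in
theorem Move.restrict {F : Finset V} {h a h' : Option V} (m : R.Move F h a h')
    (hS : ∀ v, h' = some v → v ∈ S)
    (hl : At X h → ¬ At X h' → (∀ f ∈ F, f ∈ S → ¬ X f) ∧ ¬ At X a) :
    R.Move (F ∩ S.filter X) (restr X h) (restr X a) (restr X h') := by
  by_cases h2 : At X h'
  · obtain ⟨v, rfl, hv⟩ := h2
    have hv' : restr X (some v) = some v := by simp [restr_eq_some, hv]
    rcases m with h3 | ⟨w, hw, h3, hm⟩ | ⟨h3, -⟩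
    · left; rw [h3]
    · obtain rfl := Option.some.inj h3
      refine Or.inr (Or.inl ⟨v, by simp [hw, hS v rfl, hv], hv', fun x hx => ?_⟩)
      obtain ⟨lt, g, h4, h5, h6⟩ := hm x (restr_eq_some.1 hx).1
      exact ⟨lt, g, h4, fun f hf => h5 f (Finset.mem_inter.1 hf).1,
        fun y hy => h6 y (restr_eq_some.1 hy).1⟩
    · cases h3
  · by_cases h1 : At X h
    · obtain ⟨h3, h4⟩ := hl h1 h2
      refine Or.inr (Or.inr ⟨restr_eq_none.2 h2, ?_, restr_eq_none.2 h4⟩)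
      ext f
      simp only [Finset.mem_inter, Finset.mem_filter, Finset.notMem_empty, iff_false]
      exact fun h => h3 f h.1 h.2.1 h.2.2
    · left; rw [restr_eq_none.2 h2, restr_eq_none.2 h1]

open Classical in
-- Forgetting all positions outside a block yields a course again: entries become appearances, and
-- `Trace.leave` makes each exit a legitimate disappearance. This lets the induction pass to the
-- parts below heavy edges.
theorem Trace.restrict (tr : R.Trace S F h a s t) (hX : R.IsBlock S X) :
    R.Trace (S.filter X) (fun i => F i ∩ S.filter X) (fun i => restr X (h i))
      (fun i => restr X (a i)) s t where
  anti i h1 h2 := Finset.inter_subset_inter_right (tr.anti i h1 h2)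
  moveh i h1 h2 := (tr.moveh i h1 h2).restrict (tr.memh _ (by omega) (by omega)) (tr.leave hX h1 h2)
  movea i h1 h2 :=
    (tr.movea i h1 h2).restrict (tr.mema _ (by omega) (by omega)) (tr.swap.leave hX h1 h2)
  one i h1 h2 := (tr.one i h1 h2).imp (fun h => by rw [h]) (fun h => by rw [h])
  memh i h1 h2 v hv := by
    rw [restr_eq_some] at hv
    exact Finset.mem_filter.2 ⟨tr.memh i h1 h2 v hv.1, hv.2⟩
  mema i h1 h2 v hv := by
    rw [restr_eq_some] at hv
    exact Finset.mem_filter.2 ⟨tr.mema i h1 h2 v hv.1, hv.2⟩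

end Block

/-! ### The light part -/

open Classical in
/-- The upper end of the heavy edge above `v`, or `v` itself if `v` is in the light part. -/
noncomputable def gate (R : AncTree V) (c : V) (W : ℝ) (v : V) : V :=
  if h : ∃ y, R.heavy c W y ∧ R.anc y v then R.par h.choose else v

theorem gate_of_heavy {c y v : V} {W : ℝ} (hy : R.heavy c W y) (hv : R.anc y v) :
    R.gate c W v = R.par y := by
  have h : ∃ y, R.heavy c W y ∧ R.anc y v := ⟨y, hy, hv⟩
  rw [gate, dif_pos h, h.choose_spec.1.unique hy h.choose_spec.2 hv]

theorem gate_of_light {c v : V} {W : ℝ} (hv : R.light c W v) : R.gate c W v = v := by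
  rw [gate, dif_neg]
  rintro ⟨y, hy, hyv⟩
  exact hy.not_light hyv hv

section Light

variable {S : Finset V} {c : V} {W : ℝ}

theorem map_gate_of_light {o : Option V} (h : At (R.light c W) o) : o.map (R.gate c W) = o := by
  obtain ⟨v, rfl, hv⟩ := h
  simp [gate_of_light hv]

theorem light_isBlock (hS : R.Sub S c) (hW : ∀ x ∈ S, x ≠ c → R.wt x ≤ W) :
    R.IsBlock S (R.light c W) := fun _ hlt u hu u' hu' v hv h1 h2 h3 =>
  (hlt.modular S c W hS hW).light_module u hu u' hu' v hv h1 h2 h3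

theorem part_isBlock (hS : R.Sub S c) (hW : ∀ x ∈ S, x ≠ c → R.wt x ≤ W) {y : V}
    (hy : R.heavy c W y) : R.IsBlock S (R.anc y) := fun _ hlt u hu u' hu' v hv h1 h2 h3 =>
  (hlt.modular S c W hS hW).part_module y hy u hu u' hu' v hv h1 h2 h3

variable [Finite V]

theorem light_gate (v : V) : R.light c W (R.gate c W v) := by
  by_cases h : R.light c W v
  · rwa [gate_of_light h]
  · obtain ⟨y, hy, hyv⟩ := exists_heavy h
    rw [gate_of_heavy hy hyv]
    exact hy.2.2.2

theorem anc_gate {x v : V} (hx : R.light c W x) : R.anc x (R.gate c W v) ↔ R.anc x v := by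
  by_cases h : R.light c W v
  · rw [gate_of_light h]
  · obtain ⟨y, hy, hyv⟩ := exists_heavy h
    rw [gate_of_heavy hy hyv, hy.anc_iff hyv hx]

theorem gate_mem (hS : R.Sub S c) {v : V} (hv : v ∈ S) : R.gate c W v ∈ S := by
  by_cases h : R.light c W v
  · rwa [gate_of_light h]
  · obtain ⟨y, hy, hyv⟩ := exists_heavy h
    rw [gate_of_heavy hy hyv]
    exact hS.mem_of_anc hv (anc_par_of_anc hy.1 hy.2.1) (R.trans hy.par_anc hyv)

theorem at_gate {x : V} {o : Option V} (hx : R.light c W x) :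
    At (R.anc x) (o.map (R.gate c W)) ↔ At (R.anc x) o := by
  rcases o with _ | v
  · simp [not_at_none]
  · simp [at_some, anc_gate hx]

open Classical in
-- A move into the light part from below a heavy edge projects to a move from the gate, by `port`
-- for the same order. The other cavity is only used as a constraint, so `a'` may also be `none`.
theorem Move.gate {F : Finset V} {h a h' a' : Option V} (m : R.Move F h a h')
    (hS : R.Sub S c) (hW : ∀ x ∈ S, x ≠ c → R.wt x ≤ W)
    (hh : ∀ v, h = some v → v ∈ S) (hh' : ∀ v, h' = some v → v ∈ S)
    (hl : At (R.light c W) h') (ha : ∀ y, a' = some y → a = some y) :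
    R.Move (F ∩ S.filter fun v => R.light c W v) (h.map (R.gate c W)) a'
      (h'.map (R.gate c W)) := by
  rw [map_gate_of_light hl]
  obtain ⟨v, rfl, hv⟩ := hl
  rcases m with h3 | ⟨w, hw, h3, hm⟩ | ⟨h3, -⟩
  · left; rw [← h3]; simp [gate_of_light hv]
  · obtain rfl := Option.some.inj h3
    -- The cavity may enter exactly at its gate; then its projection does not move.
    by_cases he : some v = h.map (R.gate c W)
    · exact Or.inl he
    refine Or.inr (Or.inl ⟨v, by simp [hw, hv, hh' v rfl], rfl, fun x hx => ?_⟩)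
    obtain ⟨u, rfl, rfl⟩ := Option.map_eq_some_iff.1 hx
    obtain ⟨lt, g, h4, h5, h6⟩ := hm u rfl
    refine ⟨lt, g, ?_, fun f hf => h5 f (Finset.mem_inter.1 hf).1, fun y hy => h6 y (ha y hy)⟩
    by_cases hu : R.light c W u
    · rwa [gate_of_light hu]
    · obtain ⟨y, hy, hyu⟩ := exists_heavy hu
      rw [Option.map_some, gate_of_heavy hy hyu] at he
      rw [gate_of_heavy hy hyu]
      exact (g.modular S c W hS hW).port y hy u (hh u rfl) v (hh' v rfl) hyu hv
        (fun h => he (by rw [h])) h4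
  · cases h3

end Light

end AncTree

/-! ### Cutting the walk at visits to the light part -/

namespace AncTree

variable {V : Type*} {R : AncTree V}

/-- At time `n` the first cavity is led out and back in, which only adds crossings. The hypotheses
say that everything up to `m`, respectively `n`, amounts to coming in directly to the position held
then. -/
theorem crossings_both {α β : ℕ → Prop} {s t m n : ℕ} (hsm : s ≤ m) (hmn : m ≤ n) (hnt : n ≤ t)
    (hα : xr (α s) False + changes α s m = xr (α m) False)
    (hβ : xr (β s) False + changes β s n = xr (β n) False) :
    crossings α β s t ≤ crossings α (fun _ => False) m n + crossings α β n t := by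
  unfold crossings
  rw [changes_add α hsm (hmn.trans hnt), changes_add α hmn hnt, changes_add β (hsm.trans hmn) hnt]
  have h1 := xr_nonneg (α n) False
  have h2 : changes (fun _ => False) m n = 0 := by simp [changes, xr_self]
  rw [h2, xr_self]
  linarith

/-- The first cavity goes out after time `g` and comes in again at its position at `g + 1`; the
triangle inequality through the outside pays for this, or for the closing step if `g = t`. -/
theorem crossings_one {α β : ℕ → Prop} {s t m g : ℕ} (hsm : s ≤ m) (hmg : m ≤ g) (hgt : g ≤ t)
    (hα : xr (α s) False + changes α s m = xr (α m) False) :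
    crossings α β s t ≤ crossings α (fun _ => False) m g +
      crossings (fun i => g < i ∧ α i) β s t := by
  unfold crossings
  have h2 : changes (fun _ => False) m g = 0 := by simp [changes, xr_self]
  have h3 : changes (fun i => g < i ∧ α i) s g = 0 := by
    refine (changes_congr (β := fun _ => False) fun i h1 h2 => ?_).trans (by simp [changes, xr_self])
    simp [h2]
  have h4 : xr (g < s ∧ α s) False = 0 := by
    have : ¬ (g < s ∧ α s) := fun h => by omega
    rw [propext (iff_false_intro this), xr_self]
  rw [h2, xr_self, changes_add α hsm (hmg.trans hgt), changes_add α hmg hgt,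
    changes_add (fun i => g < i ∧ α i) (hsm.trans hmg) hgt, h3, h4]
  rcases hgt.eq_or_lt with rfl | hlt
  · have h5 : ¬ (g < g ∧ α g) := by simp
    beta_reduce
    rw [propext (iff_false_intro h5), changes_self, changes_self]
    have := xr_triangle (α g) False (β g)
    linarith
  · have h5 : ∀ γ : ℕ → Prop, changes γ g t = xr (γ g) (γ (g + 1)) + changes γ (g + 1) t := by
      intro γ
      rw [changes_add γ (Nat.le_succ g) hlt, changes_succ _ le_rfl, changes_self, zero_add]
    have h6 : changes (fun i => g < i ∧ α i) (g + 1) t = changes α (g + 1) t := by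
      refine changes_congr fun i h1 h2 => ?_
      simp only [and_iff_right_iff_imp]
      omega
    rw [h5, h5 fun i => g < i ∧ α i, h6]
    have h7 : (g < t ∧ α t) = α t := by simp [hlt]
    have h8 : (g < g ∧ α g) = False := by simp
    have h9 : (g < g + 1 ∧ α (g + 1)) = α (g + 1) := by simp
    beta_reduce
    rw [h7, h8, h9]
    have := xr_triangle (α g) False (α (g + 1))
    linarith

/-- `e ≥ s` is the first time at which `h` is in `X`, and `m` is the time just before (or `s`). -/
structure FirstAt (X : V → Prop) (h : ℕ → Option V) (s e m : ℕ) : Prop where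
  le_m : s ≤ m
  m_le : m ≤ e
  le_succ : e ≤ m + 1
  lt_or : m < e ∨ m = s
  before : ∀ i, s ≤ i → i < e → ¬ At X (h i)
  at_e : At X (h e)

open Classical in
theorem exists_firstAt {X : V → Prop} {h : ℕ → Option V} {s t : ℕ}
    (hex : ∃ i, s ≤ i ∧ i ≤ t ∧ At X (h i)) : ∃ e m, e ≤ t ∧ FirstAt X h s e m := by
  have hex' : ∃ i, s ≤ i ∧ At X (h i) := hex.imp fun i h => ⟨h.1, h.2.2⟩
  obtain ⟨i, h1, h2, h3⟩ := hex
  have hs := Nat.find_spec hex'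
  refine ⟨Nat.find hex', max s (Nat.find hex' - 1), (Nat.find_min' hex' ⟨h1, h3⟩).trans h2,
    by omega, by omega, by omega, by omega, fun j hj hj' h => ?_, hs.2⟩
  exact Nat.find_min hex' hj' ⟨hj, h⟩

section

variable {S : Finset V} {F : ℕ → Finset V} {h a : ℕ → Option V} {s t : ℕ}

/-- The vertex at which the cavity enters at time `e` was free all the time before, since free sets
only shrink. -/
theorem FirstAt.exists_free {X : V → Prop} (tr : R.Trace S F h a s t) {e m : ℕ}
    (he : FirstAt X h s e m) (het : e ≤ t) {i : ℕ} (hi : s ≤ i) (hie : i < e) :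
    ∃ f ∈ F i, f ∈ S ∧ X f := by
  have h0 := he.le_succ
  have h5 := he.m_le
  have hme : m < e := by rcases he.lt_or with h | h <;> omega
  obtain rfl : e = m + 1 := by omega
  obtain ⟨v, h1, h2, h3⟩ :=
    (tr.moveh m he.le_m (by omega)).enter (he.before m he.le_m hme) he.at_e
  exact ⟨v, tr.anti_le hi (by omega) (by omega) h1, tr.memh _ (by omega) (by omega) v h2, h3⟩

theorem Trace.stay {X : V → Prop} (tr : R.Trace S F h a s t) (hX : R.IsBlock S X) {i j : ℕ}
    (hi : s ≤ i) (hij : i ≤ j) (hj : j ≤ t) (h1 : At X (h i))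
    (h2 : ∀ k, i ≤ k → k < j → ∃ f ∈ F k, f ∈ S ∧ X f) : At X (h j) := by
  induction j, hij using Nat.le_induction with
  | base => exact h1
  | succ n hn ih =>
    by_contra hc
    obtain ⟨f, h3, h4, h5⟩ := h2 n hn (by omega)
    exact (tr.leave hX (by omega) (by omega) (ih (by omega) fun k h1 h3 => h2 k h1 (by omega))
      hc).1 f h3 h4 h5

theorem Trace.stay_both {X : V → Prop} (tr : R.Trace S F h a s t) (hX : R.IsBlock S X) {i j : ℕ}
    (hi : s ≤ i) (hij : i ≤ j) (hj : j ≤ t) (h1 : At X (h i)) (h2 : At X (a i)) :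
    At X (h j) ∧ At X (a j) := by
  induction j, hij using Nat.le_induction with
  | base => exact ⟨h1, h2⟩
  | succ n hn ih =>
    have ih := ih (by omega)
    constructor
    · by_contra hc
      exact (tr.leave hX (by omega) (by omega) ih.1 hc).2 ih.2
    · by_contra hc
      exact (tr.swap.leave hX (by omega) (by omega) ih.2 hc).2 ih.1

variable {c : V} {W : ℝ}

/-- The part of the course of a cavity outside the light part crosses the edge above a light vertex
at most twice, together with a cavity that never visits the light part. -/
theorem Trace.outer_crossings_le_two (tr : R.Trace S F h a s t) (hst : s ≤ t) (hS : R.Sub S c)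
    (hW : ∀ x ∈ S, x ≠ c → R.wt x ≤ W) (b : ℕ → Prop) (hb : ∀ i, b i → b (i + 1))
    (hb' : ∀ i, s ≤ i → i < t → ¬ b i → b (i + 1) → At (R.light c W) (h i))
    (hh : ∀ i, s ≤ i → i ≤ t → b i → ¬ At (R.light c W) (h i))
    (ha : ∀ i, s ≤ i → i ≤ t → ¬ At (R.light c W) (a i))
    {x : V} (hx : R.light c W x) (hcx : R.anc c x) (hxc : x ≠ c) :
    crossings (fun i => b i ∧ At (R.anc x) (h i)) (fun i => At (R.anc x) (a i)) s t ≤ 2 := by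
  -- This is a block only among the non-light vertices, so each use needs the target of the move to
  -- be non-light as well.
  let X : V → Prop := fun v => R.anc x v ∧ ¬ R.light c W v
  have hX : ∀ o : Option V, ¬ At (R.light c W) o → (At (R.anc x) o ↔ At X o) := by
    rintro (_ | v) ho
    · simp [not_at_none]
    · rw [at_some] at ho
      simp [at_some, X, ho]
  have hmod : ∀ h a : Option V, ∀ lt, R.GoodOrder lt → ∀ o : Option V, ¬ At (R.light c W) o →
      (∀ v, h = some v → v ∈ S) → (∀ v, o = some v → v ∈ S) →
      ∀ u s, h = some u → o = some s → X u → ¬ X s → ∀ u' ∈ S, X u' → lt u s → lt u' s := by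
    intro h a lt hlt o ho hhS hoS u s hu hs hXu hXs u' hu' hXu' hus
    rw [hs, at_some] at ho
    exact (hlt.modular S c W hS hW).below_module x hcx hxc hx u (hhS u hu) u' hu' s (hoS s hs)
      hXu.1 hXu'.1 (fun h => hXs ⟨h, ho⟩) hXu.2 hXu'.2 ho hus
  rw [crossings_congr (α' := fun i => b i ∧ At X (h i)) (β' := fun i => At X (a i)) hst
    (fun i h1 h2 => and_congr_right fun h3 => hX _ (hh i h1 h2 h3))
    (fun i h1 h2 => hX _ (ha i h1 h2))]
  refine _root_.crossings_le_two (D := fun i => ∀ f ∈ F i, f ∈ S → ¬ X f) hst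
    (fun i h1 h2 hD f hf => hD f (tr.anti i h1 h2 hf)) ?_ ?_ ?_ ?_
  · intro i h1 h2 h3 h4
    have hbi := hb i h3.1
    exact (tr.moveh i h1 h2).leave (tr.mema i h1 h2.le) (fun lt g => hmod _ (a i) lt g _
      (hh (i + 1) (by omega) (by omega) hbi) (tr.memh _ h1 h2.le)
      (tr.memh _ (by omega) (by omega))) h3.2 fun h => h4 ⟨hbi, h⟩
  · intro i h1 h2 h3 h4
    have := (tr.movea i h1 h2).leave (tr.memh i h1 h2.le) (fun lt g => hmod _ (a i) lt g _
      (ha (i + 1) (by omega) (by omega)) (tr.mema _ h1 h2.le)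
      (tr.mema _ (by omega) (by omega))) h3 h4
    exact ⟨this.1, fun h => this.2 h.2⟩
  · intro i h1 h2 h3 h4 hD
    have h5 : ¬ At X (h i) := by
      intro h6
      -- If the counting starts just now, the cavity is still in the light part by `hb'`, hence not
      -- in `X`.
      by_cases hbi : b i
      · exact h3 ⟨hbi, h6⟩
      · obtain ⟨v, hv, hvl⟩ := hb' i h1 h2 hbi h4.1
        rw [hv, at_some] at h6
        exact h6.2 hvl
    obtain ⟨v, hv, hv', hXv⟩ := (tr.moveh i h1 h2).enter h5 h4.2
    exact hD v hv (tr.memh _ (by omega) (by omega) v hv') hXv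
  · intro i h1 h2 h3 h4 hD
    obtain ⟨v, hv, hv', hXv⟩ := (tr.movea i h1 h2).enter h3 h4
    exact hD v hv (tr.mema _ (by omega) (by omega) v hv') hXv

variable [Finite V]

/-- Before a cavity enters the light part, it appears and waits in one place, as far as the light
part is concerned. -/
theorem Trace.prefix_changes (tr : R.Trace S F h a s t) (hS : R.Sub S c)
    (hW : ∀ x ∈ S, x ≠ c → R.wt x ≤ W) {e m : ℕ} (he : FirstAt (R.light c W) h s e m)
    (het : e ≤ t) {x : V} (hx : R.light c W x) :
    xr (At (R.anc x) (h s)) False + changes (fun i => At (R.anc x) (h i)) s m =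
      xr (At (R.anc x) (h m)) False := by
  have h0 := he.le_succ
  have h5 := he.m_le
  refine xr_add_changes (α := fun i => At (R.anc x) (h i)) he.le_m fun i hi him => ?_
  obtain ⟨f, hf, hfS, hfl⟩ := he.exists_free tr het hi (by omega)
  have hn1 := he.before i hi (by omega)
  have hn2 := he.before (i + 1) (by omega)
    (by rcases he.lt_or with h | h <;> omega)
  have hm := tr.memh i hi (by omega)
  have hm' := tr.memh (i + 1) (by omega) (by omega)
  have hmove := tr.moveh i hi (by omega)
  rcases hmove with h1 | ⟨v, hv, h1, h2⟩ | ⟨-, h1, -⟩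
  · right; rw [h1]
  · rcases hhi : h i with _ | u
    · left; exact not_at_none
    · right
      rw [hhi, at_some] at hn1
      rw [h1, at_some] at hn2
      rw [h1, at_some, at_some]
      obtain ⟨y, hy, hyu⟩ := exists_heavy hn1
      obtain ⟨z, hz, hzv⟩ := exists_heavy hn2
      obtain ⟨lt, g, h3, h4, -⟩ := h2 u hhi
      -- The free light vertex `f` loses to `v`; if `u` were outside the part of `v`, then `first`
      -- would rank `v` before `u` too. So the move stays in one part and keeps its gate.
      have hyz : R.anc z u := by
        by_contra hzu
        exact g.asymm _ _ h3 ((g.modular S c W hS hW).first z hz v (hm' v h1) f hfS u (hm u hhi)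
          hzv hfl hzu (h4 f hf fun h => hn2 (h ▸ hfl)))
      rw [hz.anc_iff hyz hx, hz.anc_iff hzv hx]
  · rw [h1] at hf; simp at hf

open Classical in
-- The course starts at `m`, so that an entry into the light part is included as a move from the
-- gate. Dropping the other cavity only removes constraints.
theorem Trace.single (tr : R.Trace S F h a s t) (hS : R.Sub S c)
    (hW : ∀ x ∈ S, x ≠ c → R.wt x ≤ W) {e m u : ℕ} (he : FirstAt (R.light c W) h s e m)
    (hut : u ≤ t) (hl : ∀ i, e ≤ i → i ≤ u → At (R.light c W) (h i)) :
    R.Trace (S.filter fun v => R.light c W v) (fun i => F i ∩ S.filter fun v => R.light c W v)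
      (fun i => (h i).map (R.gate c W)) (fun _ => none) m u where
  anti i h1 h2 := Finset.inter_subset_inter_right
    (tr.anti i (he.le_m.trans h1) (by omega))
  moveh i h1 h2 := by
    have h0 := he.le_succ
    have h3 := he.le_m
    exact (tr.moveh i (by omega) (by omega)).gate hS hW (tr.memh _ (by omega) (by omega))
      (tr.memh _ (by omega) (by omega)) (hl _ (by omega) (by omega)) (fun y hy => by cases hy)
  movea i h1 h2 := Or.inl rfl
  one i h1 h2 := Or.inr rfl
  memh i h1 h2 v hv := by
    obtain ⟨u', h4, rfl⟩ := Option.map_eq_some_iff.1 hv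
    have h3 := he.le_m
    exact Finset.mem_filter.2 ⟨gate_mem hS (tr.memh i (by omega) (by omega) u' h4), light_gate _⟩
  mema i h1 h2 v hv := by cases hv

open Classical in
theorem Trace.pair (tr : R.Trace S F h a s t) (hS : R.Sub S c)
    (hW : ∀ x ∈ S, x ≠ c → R.wt x ≤ W) {e m : ℕ} (he : FirstAt (R.light c W) a s e m)
    (hl : ∀ i, m ≤ i → i ≤ t → At (R.light c W) (h i))
    (hl' : ∀ i, e ≤ i → i ≤ t → At (R.light c W) (a i)) :
    R.Trace (S.filter fun v => R.light c W v) (fun i => F i ∩ S.filter fun v => R.light c W v)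
      (fun i => (h i).map (R.gate c W)) (fun i => (a i).map (R.gate c W)) m t where
  anti i h1 h2 := Finset.inter_subset_inter_right
    (tr.anti i (he.le_m.trans h1) (by omega))
  moveh i h1 h2 := by
    have h0 := he.le_succ
    have h3 := he.le_m
    by_cases hai : At (R.light c W) (a i)
    · exact (tr.moveh i (by omega) (by omega)).gate hS hW (tr.memh _ (by omega) (by omega))
        (tr.memh _ (by omega) (by omega)) (hl _ (by omega) (by omega))
        (fun y hy => by rwa [map_gate_of_light hai] at hy)
    -- Here `a` enters the light part in this very step, and only one cavity moves at a time.
    · left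
      rcases tr.one i (by omega) (by omega) with h4 | h4
      · rw [h4]
      · exact absurd (h4 ▸ hl' (i + 1) (by omega) (by omega)) hai
  movea i h1 h2 := by
    have h0 := he.le_succ
    have h3 := he.le_m
    exact (tr.movea i (by omega) (by omega)).gate hS hW (tr.mema _ (by omega) (by omega))
      (tr.mema _ (by omega) (by omega)) (hl' _ (by omega) (by omega))
      (fun y hy => by rwa [map_gate_of_light (hl _ (by omega) (by omega))] at hy)
  one i h1 h2 := (tr.one i (he.le_m.trans h1) (by omega)).imp
    (fun h => by rw [h]) (fun h => by rw [h])
  memh i h1 h2 v hv := by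
    obtain ⟨u', h4, rfl⟩ := Option.map_eq_some_iff.1 hv
    have h3 := he.le_m
    exact Finset.mem_filter.2 ⟨gate_mem hS (tr.memh i (by omega) (by omega) u' h4), light_gate _⟩
  mema i h1 h2 v hv := by
    obtain ⟨u', h4, rfl⟩ := Option.map_eq_some_iff.1 hv
    have h3 := he.le_m
    exact Finset.mem_filter.2 ⟨gate_mem hS (tr.mema i (by omega) (by omega) u' h4), light_gate _⟩

end

/-! ### The bound for all subtrees -/

section

variable {S : Finset V} {F : ℕ → Finset V} {h a : ℕ → Option V} {s t : ℕ}

open Classical in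
/-- The length of the closed walk of the two cavities in the subtree `S` with top `c`. -/
noncomputable def walkLength (R : AncTree V) (S : Finset V) (c : V) (h a : ℕ → Option V)
    (s t : ℕ) : ℝ :=
  ∑ x ∈ S.erase c, R.wt x * crossings (fun i => At (R.anc x) (h i)) (fun i => At (R.anc x) (a i)) s t

theorem walkLength_comm (S : Finset V) (c : V) (h a : ℕ → Option V) (s t : ℕ) :
    R.walkLength S c h a s t = R.walkLength S c a h s t := by
  unfold walkLength
  exact Finset.sum_congr rfl fun x _ => by rw [crossings_comm]

variable [Finite V] {c : V} {W : ℝ}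

open Classical in
-- Light weights are at most `W / 2`, so `ih` bounds one closed walk by half of the budget, and two
-- crossings of every light edge also cost at most half. Either way the walk splits into two halves.
theorem light_walkLength_of_first (hS : R.Sub S c) (hW : ∀ x ∈ S, x ≠ c → R.wt x ≤ W)
    (hd : ∀ x ∈ S, x ≠ c → R.wt x < W → 2 * R.wt x ≤ W)
    (ih : ∀ F h a s t, s ≤ t → R.Trace (S.filter fun v => R.light c W v) F h a s t →
      R.walkLength (S.filter fun v => R.light c W v) c h a s t ≤
        ((S.filter fun v => R.light c W v).card - 1) * W)
    (tr : R.Trace S F h a s t) {e m : ℕ} (het : e ≤ t) (he : FirstAt (R.light c W) h s e m)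
    (hfirst : ∀ i, s ≤ i → i < e → ¬ At (R.light c W) (a i)) :
    R.walkLength (S.filter fun v => R.light c W v) c h a s t ≤
        2 * ((S.filter fun v => R.light c W v).card - 1) * W := by
  set S₀ := S.filter fun v => R.light c W v with hS₀
  have hst : s ≤ t := he.le_m.trans (he.m_le.trans het)
  have hmem : ∀ x ∈ S₀.erase c, x ∈ S ∧ x ≠ c ∧ R.anc c x ∧ R.light c W x := by
    intro x hx
    rw [Finset.mem_erase, hS₀, Finset.mem_filter] at hx
    exact ⟨hx.2.1, hx.1, hS.anc hx.2.1, hx.2.2⟩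
  have hcard : ((S₀.erase c).card : ℝ) = S₀.card - 1 := by
    have : c ∈ S₀ := by simp [hS₀, hS.1, light_self]
    rw [Finset.card_erase_of_mem this, Nat.cast_sub (Finset.card_pos.2 ⟨c, this⟩)]
    simp
  have two : ∀ N : V → ℝ, (∀ x ∈ S₀.erase c, N x ≤ 2) →
      ∑ x ∈ S₀.erase c, R.wt x * N x ≤ (S₀.card - 1) * W := by
    intro N hN
    rw [← hcard, ← nsmul_eq_mul]
    refine Finset.sum_le_card_nsmul _ _ _ fun x hx => ?_
    obtain ⟨h1, h2, h3, h4⟩ := hmem x hx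
    have h5 := hd x h1 h2 (h4 x h3 h2 (R.refl x))
    have h6 := mul_le_mul_of_nonneg_left (hN x hx) (R.wt_nonneg x)
    linarith
  have hL := light_isBlock hS hW
  by_cases hex : ∃ i, s ≤ i ∧ i ≤ t ∧ At (R.light c W) (a i)
  · obtain ⟨e', m', het', he'⟩ := exists_firstAt hex
    have hee : e ≤ e' := by
      by_contra hlt
      exact hfirst e' (he'.le_m.trans he'.m_le) (by omega) he'.at_e
    have e1 := he.le_succ
    have e2 := he'.le_succ
    have e3 := he.m_le
    have e4 := he'.m_le
    have e5 := he.le_m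
    have e6 := he'.le_m
    have hmm : m ≤ m' := by
      rcases he.lt_or with h | h <;> rcases he'.lt_or with h' | h' <;> omega
    -- Two first entries cannot happen in the same step, because only one cavity moves.
    have hem : e ≤ m' := by
      by_contra hlt
      have hm' : m' = m := by omega
      have h1 : e = m + 1 := by omega
      have h2 : e' = m + 1 := by omega
      have n1 := he.before m he.le_m (by omega)
      have n2 := he'.before m he.le_m (by omega)
      have n3 := he.at_e
      have n4 := he'.at_e
      rw [h1] at n3
      rw [h2] at n4
      rcases tr.one m he.le_m (by omega) with h3 | h3
      · exact n1 (h3 ▸ n3)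
      · exact n2 (h3 ▸ n4)
    -- Until the second cavity enters, the vertex where it will enter is free and keeps the first
    -- cavity in the light part; afterwards the two cavities keep each other there.
    have stay1 : ∀ i, e ≤ i → i ≤ e' → At (R.light c W) (h i) := fun i h1 h2 =>
      tr.stay hL (by omega) h1 (by omega) he.at_e fun k h3 h4 =>
        he'.exists_free tr.swap het' (by omega) (by omega)
    have stay2 : ∀ i, e' ≤ i → i ≤ t → At (R.light c W) (h i) ∧ At (R.light c W) (a i) :=
      fun i h1 h2 => tr.stay_both hL (by omega) h1 h2 (stay1 e' hee le_rfl) he'.at_e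
    have stay3 : ∀ i, e ≤ i → i ≤ t → At (R.light c W) (h i) := fun i h1 h2 => by
      rcases le_total i e' with h3 | h3
      · exact stay1 i h1 h3
      · exact (stay2 i h3 h2).1
    have b1 := ih _ _ _ _ _ hmm (tr.single hS hW he (by omega : m' ≤ t)
      fun i h1 h2 => stay3 i h1 (by omega))
    have b2 := ih _ _ _ _ _ (by omega : m' ≤ t) (tr.pair hS hW he'
      (fun i h1 h2 => stay3 i (by omega) h2) (fun i h1 h2 => (stay2 i h1 h2).2))
    have : R.walkLength S₀ c h a s t ≤
        R.walkLength S₀ c (fun i => (h i).map (R.gate c W)) (fun _ => none) m m' +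
        R.walkLength S₀ c (fun i => (h i).map (R.gate c W)) (fun i => (a i).map (R.gate c W))
          m' t := by
      unfold walkLength
      rw [← Finset.sum_add_distrib]
      refine Finset.sum_le_sum fun x hx => ?_
      obtain ⟨h1, h2, h3, h4⟩ := hmem x hx
      rw [← mul_add]
      refine mul_le_mul_of_nonneg_left ?_ (R.wt_nonneg x)
      simp only [at_gate h4, not_at_none]
      exact crossings_both he.le_m hmm (by omega) (tr.prefix_changes hS hW he het h4)
        (tr.swap.prefix_changes hS hW he' het' h4)
    linarith
  · push Not at hex
    -- The last time in the light part. When the cavity leaves, no light vertex is free, so it never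
    -- returns.
    obtain ⟨g, hg1, hg2, hg3, hg4⟩ : ∃ g, e ≤ g ∧ g ≤ t ∧
        (∀ i, e ≤ i → i ≤ g → At (R.light c W) (h i)) ∧
        ∀ i, g < i → i ≤ t → ¬ At (R.light c W) (h i) := by
      by_cases hout : ∃ i, e ≤ i ∧ i < t ∧ ¬ At (R.light c W) (h (i + 1))
      · have hs := Nat.find_spec hout
        set g := Nat.find hout with hg
        have stay : ∀ i, e ≤ i → i ≤ g → At (R.light c W) (h i) := by
          intro i hi hig
          rcases hi.eq_or_lt with rfl | hlt
          · exact he.at_e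
          · have := Nat.find_min hout (show i - 1 < g by omega)
            obtain ⟨j, rfl⟩ : ∃ j, i = j + 1 := ⟨i - 1, by omega⟩
            by_contra hc
            exact this ⟨by simp; omega, by simp; omega, by simpa using hc⟩
        refine ⟨g, hs.1, hs.2.1.le, stay, fun i hi => ?_⟩
        have e1 := he.m_le
        have e2 := he.le_m
        have hleave := tr.leave hL (by omega) hs.2.1 (stay g hs.1 le_rfl) hs.2.2
        induction i, hi using Nat.le_induction with
        | base => exact fun _ => hs.2.2
        | succ n hn ih =>
          intro hnt hc
          have hn' : g + 1 ≤ n := hn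
          obtain ⟨v, h1, h2, h3⟩ := (tr.moveh n (by omega) (by omega)).enter (ih (by omega)) hc
          exact hleave.1 v (tr.anti_le (by omega) (by omega) (by omega) h1)
            (tr.memh _ (by omega) hnt v h2) h3
      · push Not at hout
        refine ⟨t, het, le_rfl, fun i h1 h2 => ?_, fun i h1 h2 => by omega⟩
        rcases h1.eq_or_lt with rfl | hlt
        · exact he.at_e
        · have := hout (i - 1) (by omega) (by omega)
          rwa [Nat.sub_add_cancel (by omega)] at this
    have b1 := ih _ _ _ _ _ (he.m_le.trans hg1) (tr.single hS hW he hg2 hg3)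
    have b2 := two (fun x => crossings (fun i => g < i ∧ At (R.anc x) (h i))
      (fun i => At (R.anc x) (a i)) s t) fun x hx => by
        obtain ⟨h1, h2, h3, h4⟩ := hmem x hx
        refine tr.outer_crossings_le_two hst hS hW (fun i => g < i) (fun i hi => by omega)
          (fun i i1 i2 i3 i4 => ?_) (fun i i1 i2 i3 => hg4 i i3 i2) hex h4 h3 h2
        obtain rfl : i = g := by omega
        exact hg3 i hg1 le_rfl
    have : R.walkLength S₀ c h a s t ≤
        R.walkLength S₀ c (fun i => (h i).map (R.gate c W)) (fun _ => none) m g +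
        ∑ x ∈ S₀.erase c, R.wt x * crossings (fun i => g < i ∧ At (R.anc x) (h i))
          (fun i => At (R.anc x) (a i)) s t := by
      unfold walkLength
      rw [← Finset.sum_add_distrib]
      refine Finset.sum_le_sum fun x hx => ?_
      obtain ⟨h1, h2, h3, h4⟩ := hmem x hx
      rw [← mul_add]
      refine mul_le_mul_of_nonneg_left ?_ (R.wt_nonneg x)
      simp only [at_gate h4, not_at_none]
      exact crossings_one he.le_m (he.m_le.trans hg1) hg2 (tr.prefix_changes hS hW he het h4)
    linarith

open Classical in
-- The cavities are interchangeable, so the first visitor may be called `h`. If there is no visitor,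
-- two crossings per edge fit the budget even without halving the weights.
theorem light_walkLength (hS : R.Sub S c) (hW : ∀ x ∈ S, x ≠ c → R.wt x ≤ W)
    (hd : ∀ x ∈ S, x ≠ c → R.wt x < W → 2 * R.wt x ≤ W)
    (ih : ∀ F h a s t, s ≤ t → R.Trace (S.filter fun v => R.light c W v) F h a s t →
      R.walkLength (S.filter fun v => R.light c W v) c h a s t ≤
        ((S.filter fun v => R.light c W v).card - 1) * W)
    (tr : R.Trace S F h a s t) (hst : s ≤ t) :
    R.walkLength (S.filter fun v => R.light c W v) c h a s t ≤
        2 * ((S.filter fun v => R.light c W v).card - 1) * W := by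
  by_cases h1 : ∃ i, s ≤ i ∧ i ≤ t ∧ At (R.light c W) (h i)
  · obtain ⟨e, m, het, he⟩ := exists_firstAt h1
    by_cases h2 : ∃ i, s ≤ i ∧ i ≤ t ∧ At (R.light c W) (a i)
    · obtain ⟨e', m', het', he'⟩ := exists_firstAt h2
      rcases le_total e e' with hee | hee
      · exact light_walkLength_of_first hS hW hd ih tr het he
          fun i h3 h4 => he'.before i h3 (by omega)
      · rw [walkLength_comm]
        exact light_walkLength_of_first hS hW hd ih tr.swap het' he'
          fun i h3 h4 => he.before i h3 (by omega)
    · push Not at h2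
      exact light_walkLength_of_first hS hW hd ih tr het he fun i h3 h4 => h2 i h3 (by omega)
  · push Not at h1
    by_cases h2 : ∃ i, s ≤ i ∧ i ≤ t ∧ At (R.light c W) (a i)
    · obtain ⟨e', m', het', he'⟩ := exists_firstAt h2
      rw [walkLength_comm]
      exact light_walkLength_of_first hS hW hd ih tr.swap het' he'
        fun i h3 h4 => h1 i h3 (by omega)
    · push Not at h2
      have hc : c ∈ S.filter fun v => R.light c W v := by simp [hS.1, light_self]
      have hcard : (((S.filter fun v => R.light c W v).erase c).card : ℝ) =
          (S.filter fun v => R.light c W v).card - 1 := by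
        rw [Finset.card_erase_of_mem hc, Nat.cast_sub (Finset.card_pos.2 ⟨c, hc⟩)]
        simp
      unfold walkLength
      rw [mul_assoc, mul_left_comm, ← hcard, ← nsmul_eq_mul]
      refine Finset.sum_le_card_nsmul _ _ _ fun x hx => ?_
      simp only [Finset.mem_erase, Finset.mem_filter] at hx
      have h3 := tr.outer_crossings_le_two hst hS hW (fun _ => True) (fun i _ => trivial)
          (fun i _ _ h _ => absurd trivial h) (fun i i1 i2 _ => h1 i i1 i2) h2 hx.2.2
          (hS.anc hx.2.1) hx.1
      simp only [true_and] at h3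
      have h4 := hW x hx.2.1 hx.1
      have h5 := mul_le_mul_of_nonneg_left h3 (R.wt_nonneg x)
      linarith

open Classical in
/-- The bound on the length of the closed walk of the cavities. -/
theorem walkLength_le (n : ℕ) : ∀ (S : Finset V) (c : V) (W : ℝ) (F : ℕ → Finset V)
    (h a : ℕ → Option V) (s t : ℕ), S.card = n → R.Sub S c →
    (∀ x ∈ S, x ≠ c → R.wt x ≤ W) → s ≤ t → R.Trace S F h a s t →
    R.walkLength S c h a s t ≤ 2 * (S.card - 1) * W := by
  induction n using Nat.strong_induction_on with
  | _ n ih =>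
    intro S c W' F h a s t hn hS hW' hst tr
    by_cases hne : (S.erase c).Nonempty
    swap
    · rw [Finset.not_nonempty_iff_eq_empty] at hne
      have h1 : S.card = 1 := by
        have := Finset.card_erase_of_mem hS.1
        have h2 := Finset.card_pos.2 ⟨c, hS.1⟩
        rw [hne, Finset.card_empty] at this
        omega
      simp [walkLength, hne, h1]
    obtain ⟨z, hz, hmax⟩ := Finset.exists_max_image _ R.wt hne
    have hz' := Finset.mem_erase.1 hz
    -- Passing from the given bound to the true maximum makes the edge above `z` heavy, so the light
    -- part is strictly smaller than `S`.
    set W := R.wt z with hWdef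
    have hW : ∀ x ∈ S, x ≠ c → R.wt x ≤ W := fun x h1 h2 =>
      hmax x (Finset.mem_erase.2 ⟨h2, h1⟩)
    have hpos : (0 : ℝ) ≤ S.card - 1 := by
      have : 1 ≤ S.card := Finset.card_pos.2 ⟨c, hS.1⟩
      rify at this
      linarith
    suffices hmain : R.walkLength S c h a s t ≤ 2 * (S.card - 1) * W from
      hmain.trans (mul_le_mul_of_nonneg_left (hW' z hz'.2 hz'.1) (by linarith))
    set S₀ := S.filter fun v => R.light c W v with hS₀
    have hlt : S₀.card < n := by
      rw [← hn]
      refine Finset.card_lt_card ((Finset.ssubset_iff_of_subset (Finset.filter_subset _ _)).2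
        ⟨z, hz'.2, fun h => ?_⟩)
      have := (Finset.mem_filter.1 h).2 z (hS.anc hz'.2) hz'.1 (R.refl z)
      exact lt_irrefl _ this
    have hroot : ∀ x ∈ S, x ≠ c → x ≠ R.root := fun x h1 h2 => ne_root_of_anc (hS.anc h1) h2
    have hd : ∀ x ∈ S, x ≠ c → R.wt x < W → 2 * R.wt x ≤ W := fun x h1 h2 h3 =>
      R.double (hroot x h1 h2) (hroot z hz'.2 hz'.1) h3
    -- The halving: light edges satisfy the bound `W / 2` in the induction hypothesis.
    have hlight := light_walkLength hS hW hd (fun F h a s t hst tr => by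
      have := ih _ hlt S₀ c (W / 2) F h a s t rfl (hS.light W) (fun x hx hxc => by
        rw [hS₀, Finset.mem_filter] at hx
        have := hd x hx.1 hxc (hx.2 x (hS.anc hx.1) hxc (R.refl x))
        linarith) hst tr
      linarith) tr hst
    rw [← hS₀] at hlight
    let H : Finset V := S.filter fun y => R.heavy c W y
    let N : V → ℝ := fun x => R.wt x *
      crossings (fun i => At (R.anc x) (h i)) (fun i => At (R.anc x) (a i)) s t
    -- Including the heavy edge above `y`, a part has as many edges as vertices; thus the parts and
    -- the light part together use up `2 (|S| - 1) W`.
    have hpart : ∀ y ∈ H, ∑ x ∈ S.filter (fun v => R.anc y v), N x ≤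
        (S.filter fun v => R.anc y v).card * (2 * W) := by
      intro y hy
      obtain ⟨hyS, hyh⟩ := Finset.mem_filter.1 hy
      have hblock := part_isBlock hS hW hyh
      have hymem : y ∈ S.filter fun v => R.anc y v := by simp [hyS, R.refl]
      have hlt : (S.filter fun v => R.anc y v).card < n := by
        rw [← hn]
        refine Finset.card_lt_card ((Finset.ssubset_iff_of_subset (Finset.filter_subset _ _)).2
          ⟨c, hS.1, fun h => hyh.2.1 (R.antisymm (Finset.mem_filter.1 h).2 hyh.1)⟩)
      have h1 := ih _ hlt _ y W _ _ _ s t rfl (hS.below hyS) (fun x hx hxy => by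
        rw [Finset.mem_filter] at hx
        exact hW x hx.1 fun h => hyh.2.1 (R.antisymm (h ▸ hx.2) hyh.1)) hst (tr.restrict hblock)
      have h2 : R.walkLength (S.filter fun v => R.anc y v) y (fun i => restr (R.anc y) (h i))
          (fun i => restr (R.anc y) (a i)) s t = ∑ x ∈ (S.filter fun v => R.anc y v).erase y, N x := by
        refine Finset.sum_congr rfl fun x hx => ?_
        simp only [Finset.mem_erase, Finset.mem_filter] at hx
        have h3 : ∀ o : Option V, At (R.anc x) (restr (R.anc y) o) ↔ At (R.anc x) o := by
          intro o
          constructor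
          · rintro ⟨v, h4, h5⟩
            exact ⟨v, (restr_eq_some.1 h4).1, h5⟩
          · rintro ⟨v, h4, h5⟩
            exact ⟨v, restr_eq_some.2 ⟨h4, R.trans hx.2.2 h5⟩, h5⟩
        simp only [h3, N]
      rw [← Finset.add_sum_erase _ _ hymem, ← h2]
      have h3 : N y ≤ 2 * W := by
        have h4 := mul_le_mul_of_nonneg_left (tr.crossings_le_two hst hblock) (R.wt_nonneg y)
        have h5 := hW y hyS hyh.2.1
        simp only [N]
        linarith
      linarith
    have hfiber : S.erase c = S₀.erase c ∪ H.biUnion fun y => S.filter fun v => R.anc y v := by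
      ext v
      simp only [Finset.mem_erase, Finset.mem_union, Finset.mem_biUnion, Finset.mem_filter, hS₀, H]
      constructor
      · rintro ⟨h1, h2⟩
        by_cases hl : R.light c W v
        · exact Or.inl ⟨h1, h2, hl⟩
        · obtain ⟨y, hy, hyv⟩ := exists_heavy hl
          exact Or.inr ⟨y, ⟨hS.mem_of_anc h2 hy.1 hyv, hy⟩, h2, hyv⟩
      · rintro (⟨h1, h2, h3⟩ | ⟨y, ⟨h1, h2⟩, h3, h4⟩)
        · exact ⟨h1, h2⟩
        · exact ⟨fun h => h2.not_light h4 (h ▸ light_self _ _), h3⟩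
    have hdisj : Disjoint (S₀.erase c) (H.biUnion fun y => S.filter fun v => R.anc y v) := by
      rw [Finset.disjoint_left]
      intro v hv hv'
      simp only [Finset.mem_erase, Finset.mem_biUnion, Finset.mem_filter, hS₀, H] at hv hv'
      obtain ⟨y, ⟨h1, h2⟩, h3, h4⟩ := hv'
      exact h2.not_light h4 hv.2.2
    have hdisj' : (H : Set V).PairwiseDisjoint fun y => S.filter fun v => R.anc y v := by
      intro y hy z hz hyz
      simp only [Finset.mem_coe, H, Finset.mem_filter] at hy hz
      rw [Function.onFun, Finset.disjoint_left]
      intro v hv hv'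
      simp only [Finset.mem_filter] at hv hv'
      exact hyz (hy.2.unique hz.2 hv.2 hv'.2)
    have hc₀ : c ∈ S₀ := by simp [hS₀, hS.1, light_self]
    have hcard : S.card + 0 = S₀.card + ∑ y ∈ H, (S.filter fun v => R.anc y v).card := by
      have h1 := congrArg Finset.card hfiber
      rw [Finset.card_union_of_disjoint hdisj, Finset.card_biUnion hdisj',
        Finset.card_erase_of_mem hS.1, Finset.card_erase_of_mem hc₀] at h1
      have := Finset.card_pos.2 ⟨c, hS.1⟩
      have := Finset.card_pos.2 ⟨c, hc₀⟩
      omega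
    have hsum : R.walkLength S c h a s t = R.walkLength S₀ c h a s t +
        ∑ y ∈ H, ∑ x ∈ S.filter (fun v => R.anc y v), N x := by
      unfold walkLength
      rw [hfiber, Finset.sum_union hdisj, Finset.sum_biUnion hdisj']
    have hle := Finset.sum_le_sum hpart
    rw [← Finset.sum_mul] at hle
    rify at hcard
    rw [hsum]
    have : (S.card : ℝ) - 1 = (S₀.card - 1) + ∑ y ∈ H, ((S.filter fun v => R.anc y v).card : ℝ) := by
      linarith
    rw [this]
    linarith

end

end AncTree

/-! ### The rooted tree of a weighted tree -/

namespace PowTwoTree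

open SimpleGraph

variable {V : Type*} (T : PowTwoTree V) (ρ : V)

theorem anc_antisymm {x y : V} (h : T.IsAncestor ρ x y) (h' : T.IsAncestor ρ y x) : x = y := by
  have h1 := congrArg Walk.length (T.path_split h)
  have h2 := congrArg Walk.length (T.path_split h')
  rw [Walk.length_append] at h1 h2
  exact Walk.eq_of_length_eq_zero (p := T.path x y) (by omega)

theorem path_eq_concat {v : V} (hv : v ≠ ρ) :
    ∃ h : T.graph.Adj (T.parent ρ v) v, T.path ρ v = (T.path ρ (T.parent ρ v)).concat h := by
  have hn : ¬ (T.path ρ v).Nil := Walk.not_nil_of_ne hv.symm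
  refine ⟨Walk.adj_penultimate hn, ?_⟩
  have h1 := Walk.concat_dropLast (p := T.path ρ v) (Walk.adj_penultimate hn)
  have h2 : (T.path ρ v).dropLast.IsPath := by
    have := T.path_isPath ρ v
    rw [← h1, Walk.concat_eq_append] at this
    exact this.of_append_left
  conv_lhs => rw [← h1]
  rw [T.eq_path h2]
  rfl

theorem mem_path_iff {c v x : V} (hc : T.IsAncestor ρ c v) :
    x ∈ (T.path c v).support ↔ T.IsAncestor ρ c x ∧ T.IsAncestor ρ x v := by
  refine ⟨fun h => T.anc_of_mem hc h, fun h => ?_⟩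
  have h1 := h.2
  unfold IsAncestor at h1
  rw [T.path_split hc, Walk.mem_support_append_iff] at h1
  rcases h1 with h1 | h1
  · obtain rfl := T.anc_antisymm ρ h1 h.1
    exact Walk.start_mem_support _
  · exact h1

theorem parent_eq_of_adj {u v : V} (h : T.graph.Adj u v) :
    (v ≠ ρ ∧ T.parent ρ v = u) ∨ (u ≠ ρ ∧ T.parent ρ u = v) := by
  have key : ∀ {u v : V} (h : T.graph.Adj u v), v ∉ (T.path ρ u).support →
      v ≠ ρ ∧ T.parent ρ v = u := by
    intro u v h hv
    refine ⟨fun hr => hv (hr ▸ Walk.start_mem_support _), ?_⟩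
    rw [parent, ← T.eq_path ((T.path_isPath ρ u).concat hv h)]
    simp
  by_cases hv : v ∈ (T.path ρ u).support
  · exact Or.inr (key h.symm fun hu => h.ne (T.anc_antisymm ρ hu hv))
  · exact Or.inl (key h hv)

/-- The rooted tree `(T, ρ)`, given by its ancestor relation. -/
noncomputable def ancTree : AncTree V where
  anc x v := T.IsAncestor ρ x v
  par v := T.parent ρ v
  root := ρ
  wt v := T.w s(T.parent ρ v, v)
  refl v := Walk.end_mem_support _
  trans h1 h2 := T.anc_trans h2 h1
  antisymm h1 h2 := T.anc_antisymm ρ h1 h2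
  chain {x y v} h1 h2 := by
    have h3 := h2
    unfold IsAncestor at h3
    rw [T.path_split h1, Walk.mem_support_append_iff] at h3
    rcases h3 with h3 | h3
    · exact Or.inr h3
    · exact Or.inl (T.anc_of_mem h1 h3).1
  root_anc v := Walk.start_mem_support _
  par_anc {v} hv := by
    obtain ⟨h, h1⟩ := T.path_eq_concat ρ hv
    unfold IsAncestor
    rw [h1, Walk.support_concat]
    simp
  anc_par {x v} h hne := by
    by_cases hv : v = ρ
    · subst hv
      unfold IsAncestor at h
      rw [T.path_self] at h
      simp at h
      exact absurd h hne
    · obtain ⟨h2, h1⟩ := T.path_eq_concat ρ hv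
      unfold IsAncestor at h
      rw [h1, Walk.support_concat] at h
      unfold IsAncestor
      simpa [hne] using h
  par_ne {v} hv := (T.path_eq_concat ρ hv).choose.ne
  wt_nonneg v := NNReal.coe_nonneg _
  -- Distinct powers of two differ by a factor of at least two; beyond positivity of the weights
  -- this is all that is needed from `pow_two`.
  double {u v} hu hv h := by
    obtain ⟨i, hi⟩ := T.pow_two s(T.parent ρ u, u) (T.path_eq_concat ρ hu).choose
    obtain ⟨j, hj⟩ := T.pow_two s(T.parent ρ v, v) (T.path_eq_concat ρ hv).choose
    change (T.w s(T.parent ρ u, u) : ℝ) < T.w s(T.parent ρ v, v) at h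
    rw [hi, hj] at h ⊢
    push_cast at h ⊢
    have hij : i < j := (pow_lt_pow_iff_right₀ (by norm_num : (1 : ℝ) < 2)).1 h
    rw [← pow_succ']
    exact pow_le_pow_right₀ (by norm_num) hij

theorem ancTree_anc {x v : V} : (T.ancTree ρ).anc x v ↔ T.IsAncestor ρ x v := Iff.rfl

theorem adj_parent {v : V} (hv : v ≠ ρ) : T.graph.Adj (T.parent ρ v) v :=
  (T.path_eq_concat ρ hv).choose

/-! ### Distances -/

theorem dist_split {u v m : V} (h : m ∈ (T.path u v).support) :
    T.dist u v = T.dist u m + T.dist m v := by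
  unfold dist
  rw [T.path_split h, Walk.edges_append, List.map_append, List.sum_append]

theorem dist_comm (u v : V) : T.dist u v = T.dist v u := by
  unfold dist
  rw [← T.eq_path (T.path_isPath u v).reverse, Walk.edges_reverse, List.map_reverse,
    List.sum_reverse]

theorem dist_self (v : V) : T.dist v v = 0 := by simp [dist, path_self]

theorem dist_pos {u v : V} (h : u ≠ v) : 0 < T.dist u v := by
  unfold dist
  refine List.sum_pos _ (fun x hx => ?_) ?_
  · obtain ⟨e, he, rfl⟩ := List.mem_map.1 hx
    obtain ⟨i, hi⟩ := T.pow_two e (Walk.edges_subset_edgeSet _ he)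
    rw [hi]
    positivity
  · intro h1
    rw [List.map_eq_nil_iff, Walk.edges_eq_nil] at h1
    exact h h1.eq

/-- On the way from `u` to `v` there is a common ancestor. -/
theorem exists_mem_path_anc {u v : V} (p : T.graph.Walk u v) :
    ∃ m ∈ p.support, T.IsAncestor ρ m u ∧ T.IsAncestor ρ m v := by
  induction p with
  | nil => exact ⟨_, by simp, Walk.end_mem_support _, Walk.end_mem_support _⟩
  | @cons u w v h q ih =>
    obtain ⟨m, h1, h2, h3⟩ := ih
    rcases T.parent_eq_of_adj ρ h with ⟨h4, h5⟩ | ⟨h4, h5⟩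
    · by_cases hm : m = w
      · subst hm
        refine ⟨u, by simp, Walk.end_mem_support _, (T.ancTree ρ).trans ?_ h3⟩
        rw [← h5]
        exact (T.ancTree ρ).par_anc h4
      · refine ⟨m, by simp [h1], ?_, h3⟩
        rw [← h5]
        exact (T.ancTree ρ).anc_par h2 hm
    · refine ⟨m, by simp [h1], (T.ancTree ρ).trans h2 ?_, h3⟩
      rw [← h5]
      exact (T.ancTree ρ).par_anc h4

/-- A path inside the induced subgraph is a path of the tree, and the latter is unique. -/
theorem path_subset_of_connected {S : Finset V} (h : (T.graph.induce (S : Set V)).Connected)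
    {x y : V} (hx : x ∈ S) (hy : y ∈ S) : ∀ z ∈ (T.path x y).support, z ∈ S := by
  classical
  obtain ⟨p, hp⟩ := (h.preconnected ⟨x, hx⟩ ⟨y, hy⟩).exists_isPath
  have h1 : (p.map (Embedding.induce (G := T.graph) (S : Set V)).toHom).IsPath :=
    Walk.IsPath.map (Embedding.induce (G := T.graph) (S : Set V)).injective hp
  intro z hz
  have h2 : z ∈ (p.map (Embedding.induce (G := T.graph) (S : Set V)).toHom).support :=
    (congrArg (fun q => z ∈ q.support) (T.eq_path h1)).mpr hz
  rw [Walk.support_map] at h2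
  obtain ⟨⟨w, hw⟩, -, rfl⟩ := List.mem_map.1 h2
  exact hw

variable [Fintype V]

open Classical in
theorem dist_root (v : V) : T.dist ρ v =
    ∑ x ∈ Finset.univ.filter (fun x => x ≠ ρ ∧ T.IsAncestor ρ x v), (T.ancTree ρ).wt x := by
  induction hn : (T.path ρ v).length using Nat.strong_induction_on generalizing v with
  | _ n ih =>
    by_cases hv : v = ρ
    · subst hv
      rw [dist_self, eq_comm]
      refine Finset.sum_eq_zero fun x hx => ?_
      simp only [Finset.mem_filter, Finset.mem_univ, true_and] at hx
      exact absurd (T.anc_antisymm _ hx.2 (Walk.start_mem_support _)) hx.1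
    · obtain ⟨h, h1⟩ := T.path_eq_concat ρ hv
      have h2 : T.dist ρ v = T.dist ρ (T.parent ρ v) + (T.ancTree ρ).wt v := by
        rw [dist, h1, Walk.edges_concat]
        simp [dist, ancTree]
      rw [h2, ih (T.path ρ (T.parent ρ v)).length (by rw [← hn, h1]; simp) _ rfl, add_comm]
      have h3 : v ∉ Finset.univ.filter fun x => x ≠ ρ ∧ T.IsAncestor ρ x (T.parent ρ v) := by
        simp only [Finset.mem_filter, Finset.mem_univ, true_and, not_and]
        exact fun _ h4 => h.ne (T.anc_antisymm ρ ((T.ancTree ρ).par_anc hv) h4)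
      rw [← Finset.sum_insert h3]
      congr 1
      ext x
      simp only [Finset.mem_insert, Finset.mem_filter, Finset.mem_univ, true_and]
      constructor
      · rintro (rfl | h4)
        · exact ⟨hv, Walk.end_mem_support _⟩
        · exact ⟨h4.1, (T.ancTree ρ).trans h4.2 ((T.ancTree ρ).par_anc hv)⟩
      · rintro ⟨h4, h5⟩
        by_cases hx : x = v
        · exact Or.inl hx
        · exact Or.inr ⟨h4, (T.ancTree ρ).anc_par h5 hx⟩

open Classical in
theorem dist_of_anc {m v : V} (h : T.IsAncestor ρ m v) : T.dist m v =
    ∑ x ∈ Finset.univ.filter (fun x => T.IsAncestor ρ x v ∧ ¬ T.IsAncestor ρ x m),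
      (T.ancTree ρ).wt x := by
  have h1 := T.dist_split h
  rw [dist_root, dist_root] at h1
  have h2 := Finset.sum_filter_add_sum_filter_not
    (Finset.univ.filter fun x => x ≠ ρ ∧ T.IsAncestor ρ x v) (fun x => T.IsAncestor ρ x m)
    (T.ancTree ρ).wt
  have h3 : ((Finset.univ.filter fun x => x ≠ ρ ∧ T.IsAncestor ρ x v).filter fun x =>
      T.IsAncestor ρ x m) = Finset.univ.filter fun x => x ≠ ρ ∧ T.IsAncestor ρ x m := by
    ext x
    simp only [Finset.mem_filter, Finset.mem_univ, true_and]
    exact ⟨fun h4 => ⟨h4.1.1, h4.2⟩, fun h4 => ⟨⟨h4.1, (T.ancTree ρ).trans h4.2 h⟩, h4.2⟩⟩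
  have h4 : ((Finset.univ.filter fun x => x ≠ ρ ∧ T.IsAncestor ρ x v).filter fun x =>
      ¬ T.IsAncestor ρ x m) =
      Finset.univ.filter fun x => T.IsAncestor ρ x v ∧ ¬ T.IsAncestor ρ x m := by
    ext x
    simp only [Finset.mem_filter, Finset.mem_univ, true_and]
    refine ⟨fun h4 => ⟨h4.1.2, h4.2⟩, fun h4 => ⟨⟨?_, h4.1⟩, h4.2⟩⟩
    rintro rfl
    exact h4.2 (Walk.start_mem_support _)
  rw [h3, h4] at h2
  linarith

/-- The distance is a sum over all edges that separate `u` and `v`. -/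
theorem dist_le (u v : V) : T.dist u v ≤
    ∑ x, (T.ancTree ρ).wt x * xr (T.IsAncestor ρ x u) (T.IsAncestor ρ x v) := by
  classical
  obtain ⟨m, hm, hmu, hmv⟩ := T.exists_mem_path_anc ρ (T.path u v)
  rw [T.dist_split hm, T.dist_comm u m, T.dist_of_anc ρ hmu, T.dist_of_anc ρ hmv,
    Finset.sum_filter, Finset.sum_filter, ← Finset.sum_add_distrib]
  refine Finset.sum_le_sum fun x _ => ?_
  have hw := (T.ancTree ρ).wt_nonneg x
  -- A common ancestor strictly below `m` would be visited both before and after `m` by a simple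
  -- path.
  have key : T.IsAncestor ρ x u → T.IsAncestor ρ x v → T.IsAncestor ρ x m := by
    intro h1 h2
    rcases (T.ancTree ρ).chain h1 hmu with h3 | h3
    · exact h3
    · have h4 : x ∈ (T.path u m).support := by
        rw [← T.eq_path (T.path_isPath m u).reverse, Walk.support_reverse, List.mem_reverse]
        exact (T.mem_path_iff ρ hmu).2 ⟨h3, h1⟩
      have h5 : x ∈ (T.path m v).support := (T.mem_path_iff ρ hmv).2 ⟨h3, h2⟩
      have h6 := (T.path_isPath u v).support_nodup
      rw [T.path_split hm, Walk.support_append] at h6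
      rw [← Walk.cons_tail_support, List.mem_cons] at h5
      rcases h5 with rfl | h5
      · exact Walk.end_mem_support _
      · exact absurd h5 (List.disjoint_of_nodup_append h6 h4)
  unfold xr
  by_cases h1 : T.IsAncestor ρ x u <;> by_cases h2 : T.IsAncestor ρ x v <;>
    by_cases h3 : T.IsAncestor ρ x m <;> simp_all

open Classical in
-- An ancestor of a vertex of `S` that is not in `S.erase c` is an ancestor of `c`, hence of all of
-- `S`, and separates nothing.
theorem dist_le_of_sub {S : Finset V} {c u v : V} (hS : (T.ancTree ρ).Sub S c) (hu : u ∈ S)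
    (hv : v ∈ S) : T.dist u v ≤
    ∑ x ∈ S.erase c, (T.ancTree ρ).wt x * xr (T.IsAncestor ρ x u) (T.IsAncestor ρ x v) := by
  refine (T.dist_le ρ u v).trans (le_of_eq ?_)
  symm
  refine Finset.sum_subset (Finset.subset_univ _) fun x _ hx => ?_
  have key : ∀ {u v : V}, u ∈ S → v ∈ S → T.IsAncestor ρ x u → T.IsAncestor ρ x v := by
    intro u v hu hv h
    have hxc : (T.ancTree ρ).anc x c := by
      rcases (T.ancTree ρ).chain h (hS.anc hu) with h1 | h1
      · exact h1
      · by_cases hxc : x = c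
        · rw [hxc]; exact (T.ancTree ρ).refl c
        · exact absurd (Finset.mem_erase.2 ⟨hxc, hS.mem_of_anc hu h1 h⟩) hx
    exact (T.ancTree ρ).trans hxc (hS.anc hv)
  rw [show T.IsAncestor ρ x u = T.IsAncestor ρ x v from propext ⟨key hu hv, key hv hu⟩, xr_self,
    mul_zero]

/-! ### Subtrees -/

theorem subset_minSubtree (C : Finset V) : C ⊆ T.minSubtree C := fun x hx => by
  simp only [minSubtree, Finset.mem_filter, Finset.mem_univ, true_and]
  exact fun S _ h => h hx

/-- An intersection of subtrees contains the path between any two of its vertices. On the path from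
the vertex closest to the root to `v` there is a common ancestor of both, and minimality of the
distance forces it to be that vertex. -/
theorem minSubtree_sub {C : Finset V} (hC : C.Nonempty) :
    (T.ancTree ρ).Sub (T.minSubtree C) (T.rootOf ρ (T.minSubtree C)) := by
  have hpath : ∀ x ∈ T.minSubtree C, ∀ y ∈ T.minSubtree C, ∀ z ∈ (T.path x y).support,
      z ∈ T.minSubtree C := by
    intro x hx y hy z hz
    simp only [minSubtree, Finset.mem_filter, Finset.mem_univ, true_and] at hx hy ⊢
    exact fun S h h' => T.path_subset_of_connected h (hx S h h') (hy S h h') z hz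
  have hne := hC.mono (T.subset_minSubtree C)
  generalize T.minSubtree C = S at hpath hne
  have hc : T.rootOf ρ S ∈ S ∧ ∀ x ∈ S, T.dist ρ (T.rootOf ρ S) ≤ T.dist ρ x := by
    rw [rootOf, dif_pos hne]
    exact (Finset.exists_min_image S (T.dist ρ) hne).choose_spec
  generalize T.rootOf ρ S = c at hc
  have hanc : ∀ v ∈ S, T.IsAncestor ρ c v := by
    intro v hv
    obtain ⟨m, h1, h2, h3⟩ := T.exists_mem_path_anc ρ (T.path c v)
    have h4 := hc.2 m (hpath c hc.1 v hv m h1)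
    rw [T.dist_split h2] at h4
    by_cases hmc : m = c
    · rwa [← hmc]
    · linarith [T.dist_pos hmc]
  refine ⟨hc.1, fun v hv => ⟨hanc v hv, fun y h1 h2 => ?_⟩⟩
  exact hpath c hc.1 v hv y ((T.mem_path_iff ρ (hanc v hv)).2 ⟨h1, h2⟩)

open Classical in
theorem mem_edgesIn {S : Finset V} {c x : V} (hS : (T.ancTree ρ).Sub S c) (hx : x ∈ S)
    (hxc : x ≠ c) : s(T.parent ρ x, x) ∈ T.edgesIn S := by
  have hr : x ≠ ρ := AncTree.ne_root_of_anc (R := T.ancTree ρ) (hS.anc hx) hxc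
  simp only [edgesIn, Finset.mem_filter, mem_edgeFinset, mem_edgeSet]
  refine ⟨T.adj_parent ρ hr, fun y hy => ?_⟩
  rcases Sym2.mem_iff.1 hy with rfl | rfl
  · exact hS.mem_of_anc hx (AncTree.anc_par_of_anc (R := T.ancTree ρ) (hS.anc hx) hxc)
      ((T.ancTree ρ).par_anc hr)
  · exact hx

theorem exists_of_mem_edgesIn {S : Finset V} {c : V} (hS : (T.ancTree ρ).Sub S c) {e : Sym2 V}
    (he : e ∈ T.edgesIn S) : ∃ x ∈ S, x ≠ c ∧ T.parent ρ x ∈ S ∧ e = s(T.parent ρ x, x) := by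
  classical
  revert he
  refine Sym2.ind (fun u v he => ?_) e
  simp only [edgesIn, Finset.mem_filter, mem_edgeFinset, mem_edgeSet] at he
  have hu := he.2 u (by simp)
  have hv := he.2 v (by simp)
  have key : ∀ {u v : V}, u ∈ S → v ∈ S → v ≠ ρ → T.parent ρ v = u → v ≠ c := by
    rintro u v hu hv h1 rfl rfl
    exact (T.ancTree ρ).par_ne h1
      ((T.ancTree ρ).antisymm ((T.ancTree ρ).par_anc h1) (hS.anc hu))
  rcases T.parent_eq_of_adj ρ he.1 with ⟨h1, h2⟩ | ⟨h1, h2⟩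
  · exact ⟨v, hv, key hu hv h1 h2, h2 ▸ hu, by rw [h2]⟩
  · exact ⟨u, hu, key hv hu h1 h2, h2 ▸ hv, by rw [h2, Sym2.eq_swap]⟩

theorem wt_le_wmax {S : Finset V} {c x : V} (hS : (T.ancTree ρ).Sub S c) (hx : x ∈ S)
    (hxc : x ≠ c) : (T.ancTree ρ).wt x ≤ T.wmax S :=
  NNReal.coe_le_coe.2 (Finset.le_sup (f := T.w) (T.mem_edgesIn ρ hS hx hxc))

theorem card_le_card_edgesIn {S : Finset V} {c : V} (hS : (T.ancTree ρ).Sub S c) :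
    (S.card : ℝ) - 1 ≤ (T.edgesIn S).card := by
  classical
  have h1 : (S.erase c).card ≤ (T.edgesIn S).card := by
    refine Finset.card_le_card_of_injOn (fun x => s(T.parent ρ x, x)) (fun x hx => ?_) ?_
    · rw [Finset.mem_coe, Finset.mem_erase] at hx
      exact T.mem_edgesIn ρ hS hx.2 hx.1
    · intro x hx y hy hxy
      rw [Finset.mem_coe, Finset.mem_erase] at hx hy
      have hx' : x ≠ ρ := AncTree.ne_root_of_anc (R := T.ancTree ρ) (hS.anc hx.2) hx.1
      have hy' : y ≠ ρ := AncTree.ne_root_of_anc (R := T.ancTree ρ) (hS.anc hy.2) hy.1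
      rcases Sym2.eq_iff.1 hxy with h | h
      · exact h.2
      · have h3 := (T.ancTree ρ).par_anc hx'
        have h4 := (T.ancTree ρ).par_anc hy'
        change (T.ancTree ρ).anc (T.parent ρ x) x at h3
        change (T.ancTree ρ).anc (T.parent ρ y) y at h4
        rw [h.1] at h3
        rw [← h.2] at h4
        exact (T.ancTree ρ).antisymm h4 h3
  rw [Finset.card_erase_of_mem hS.1] at h1
  have : S.card ≤ (T.edgesIn S).card + 1 := by omega
  rify at this
  linarith

end PowTwoTree

/-! ### Choice functions and their preference orders -/

section Choice

variable {V : Type*}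

/-- `f` chooses from every nonempty subset of `S` one of its elements, consistently. -/
def IsChoice (S : Finset V) (f : Finset V → V) : Prop :=
  ∀ F ⊆ S, F.Nonempty → f F ∈ F ∧ ∀ G ⊆ F, f F ∈ G → f G = f F

open Classical in
/-- `f` prefers `u` to `v`. -/
def Before (f : Finset V → V) (u v : V) : Prop := u ≠ v ∧ f {u, v} = u

open Classical in
/-- Choose by `g` from `X` if possible, and by `k` otherwise. -/
noncomputable def seqChoice (X : Finset V) (g k : Finset V → V) (F : Finset V) : V :=
  if (F ∩ X).Nonempty then g (F ∩ X) else k F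

theorem Before.asymm {f : Finset V → V} {u v : V} (h : Before f u v) : ¬ Before f v u := by
  classical
  intro h'
  have h1 := h.2
  rw [Finset.pair_comm, h'.2] at h1
  exact h.1 h1.symm

theorem IsChoice.before {S F : Finset V} {f : Finset V → V} (hf : IsChoice S f) (hF : F ⊆ S)
    {v : V} (hv : v ∈ F) (hne : v ≠ f F) : Before f (f F) v := by
  classical
  obtain ⟨h1, h2⟩ := hf F hF ⟨v, hv⟩
  refine ⟨hne.symm, h2 _ (fun x hx => ?_) (by simp)⟩
  rcases Finset.mem_insert.1 hx with rfl | hx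
  · exact h1
  · rwa [Finset.mem_singleton.1 hx]

theorem IsChoice.singleton {S : Finset V} {f : Finset V → V} (hf : IsChoice S f) {v : V}
    (hv : v ∈ S) : f {v} = v := by
  have := (hf {v} (by simpa using hv) (by simp)).1
  simpa using this

open Classical in
theorem IsChoice.seqChoice {S X : Finset V} {g k : Finset V → V} (hg : IsChoice X g)
    (hk : IsChoice (S \ X) k) : IsChoice S (seqChoice X g k) := by
  intro F hF hne
  unfold _root_.seqChoice
  by_cases h : (F ∩ X).Nonempty
  · rw [if_pos h]
    obtain ⟨h1, h2⟩ := hg (F ∩ X) Finset.inter_subset_right h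
    refine ⟨(Finset.mem_inter.1 h1).1, fun G hG hGm => ?_⟩
    have h3 : g (F ∩ X) ∈ G ∩ X := Finset.mem_inter.2 ⟨hGm, (Finset.mem_inter.1 h1).2⟩
    rw [if_pos ⟨_, h3⟩]
    exact h2 _ (Finset.inter_subset_inter_right hG) h3
  · rw [if_neg h]
    have hFX : ∀ x ∈ F, x ∉ X := fun x hx hxX => h ⟨x, Finset.mem_inter.2 ⟨hx, hxX⟩⟩
    obtain ⟨h1, h2⟩ := hk F (fun x hx => Finset.mem_sdiff.2 ⟨hF hx, hFX x hx⟩) hne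
    refine ⟨h1, fun G hG hGm => ?_⟩
    rw [if_neg]
    · exact h2 G hG hGm
    · rintro ⟨x, hx⟩
      exact hFX x (hG (Finset.mem_inter.1 hx).1) (Finset.mem_inter.1 hx).2

theorem before_seqChoice_first {X : Finset V} {g k : Finset V → V} (hg : IsChoice X g) {u v : V}
    (hu : u ∈ X) (hv : v ∉ X) : Before (seqChoice X g k) u v := by
  classical
  refine ⟨fun h => hv (h ▸ hu), ?_⟩
  have h1 : ({u, v} : Finset V) ∩ X = {u} := by ext x; simp; grind
  rw [seqChoice, h1, if_pos (by simp), hg.singleton hu]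

theorem before_seqChoice_in {X : Finset V} {g k : Finset V → V} {u v : V}
    (hu : u ∈ X) (hv : v ∈ X) : Before (seqChoice X g k) u v ↔ Before g u v := by
  classical
  have h1 : ({u, v} : Finset V) ∩ X = {u, v} := by ext x; simp; grind
  rw [Before, Before, seqChoice, h1, if_pos (by simp)]

theorem before_seqChoice_out {X : Finset V} {g k : Finset V → V} {u v : V}
    (hu : u ∉ X) (hv : v ∉ X) : Before (seqChoice X g k) u v ↔ Before k u v := by
  classical
  have h1 : ({u, v} : Finset V) ∩ X = ∅ := by ext x; simp; grind
  rw [Before, Before, seqChoice, h1, if_neg (by simp)]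

end Choice

/-! ### Orders with a request -/

namespace AncTree

variable {V : Type*} {R : AncTree V}

theorem light_of_forall_lt {S : Finset V} {c : V} {W : ℝ} (hS : R.Sub S c)
    (h : ∀ x ∈ S, x ≠ c → R.wt x < W) {v : V} (hv : v ∈ S) : R.light c W v :=
  fun x h1 h2 h3 => h x (hS.mem_of_anc hv h1 h3) h2

theorem modular_of_forall_light {S : Finset V} {c : V} {W : ℝ} {lt : V → V → Prop}
    (h : ∀ v ∈ S, R.light c W v) : R.Modular lt S c W where
  light_module _ _ _ _ v hv _ _ hv' := absurd (h v hv) hv'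
  part_module _ hy u hu _ _ _ _ hyu := absurd (h u hu) (hy.not_light hyu)
  below_module _ _ _ _ u hu _ _ _ _ _ _ _ hu' := absurd (h u hu) hu'
  first _ hy v hv _ _ _ _ hyv := absurd (h v hv) (hy.not_light hyv)
  port _ hy u hu _ _ hyu := absurd (h u hu) (hy.not_light hyu)

theorem Modular.congr {S : Finset V} {c : V} {W : ℝ} {lt lt' : V → V → Prop} (hS : R.Sub S c)
    (hm : R.Modular lt S c W) (h : ∀ u ∈ S, ∀ v ∈ S, (lt' u v ↔ lt u v)) :
    R.Modular lt' S c W where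
  light_module u hu u' hu' v hv h1 h2 h3 h4 :=
    (h u' hu' v hv).2 (hm.light_module u hu u' hu' v hv h1 h2 h3 ((h u hu v hv).1 h4))
  part_module y hy u hu u' hu' v hv h1 h2 h3 h4 :=
    (h u' hu' v hv).2 (hm.part_module y hy u hu u' hu' v hv h1 h2 h3 ((h u hu v hv).1 h4))
  below_module x hcx hxc hx u hu u' hu' v hv h1 h2 h3 h4 h5 h6 h7 :=
    (h u' hu' v hv).2 (hm.below_module x hcx hxc hx u hu u' hu' v hv h1 h2 h3 h4 h5 h6
      ((h u hu v hv).1 h7))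
  first y hy v hv f hf u hu h1 h2 h3 h4 :=
    (h v hv u hu).2 (hm.first y hy v hv f hf u hu h1 h2 h3 ((h v hv f hf).1 h4))
  port y hy u hu s hs h1 h2 h3 h4 :=
    (h _ (hS.mem_of_anc hu (anc_par_of_anc hy.1 hy.2.1) (R.trans hy.par_anc h1)) s hs).2
      (hm.port y hy u hu s hs h1 h2 h3 ((h u hu s hs).1 h4))

variable (R) in
/-- The compatibility of the preference order `lt` of the request `r` with the decomposition of the
subtree `S` (with top `c`) at weight `W`. -/
structure Served (lt : V → V → Prop) (S : Finset V) (c r : V) (W : ℝ) : Prop where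
  light_lt : ∀ y, R.heavy c W y → ∀ u ∈ S, ∀ v ∈ S, R.light c W u → R.anc y v → ¬ R.anc y r →
    lt u v
  part_lt : ∀ y, R.heavy c W y → ∀ u ∈ S, ∀ v ∈ S, R.anc y u → R.anc y r → ¬ R.anc y v → lt u v
  -- Phase two prefers the side of the request at each removed edge, so it exhausts the subtrees
  -- around the request from inside out.
  below_lt : ∀ x, R.anc c x → x ≠ c → R.light c W x → ∀ u ∈ S, ∀ v ∈ S, R.anc x r → R.anc x u →
    ¬ R.anc x v → ¬ R.light c W u → ¬ R.light c W v → lt u v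
  -- Only the parent of `x` has to be light: `x` may be the lower end of a heavy edge, and then this
  -- makes whole parts blocks.
  below_module : ∀ x, R.anc c x → x ≠ c → R.light c W (R.par x) → ∀ u ∈ S, ∀ u' ∈ S, ∀ v ∈ S,
    ¬ R.anc x r → R.anc x u → R.anc x u' → ¬ R.anc x v → ¬ R.light c W u → ¬ R.light c W u' →
    ¬ R.light c W v → lt u v → lt u' v

theorem served_of_forall_light {S : Finset V} {c r : V} {W : ℝ} {lt : V → V → Prop}
    (h : ∀ v ∈ S, R.light c W v) : R.Served lt S c r W where
  light_lt _ hy _ _ v hv _ hyv := absurd (h v hv) (hy.not_light hyv)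
  part_lt _ hy u hu _ _ hyu := absurd (h u hu) (hy.not_light hyu)
  below_lt _ _ _ _ u hu _ _ _ _ _ hu' := absurd (h u hu) hu'
  below_module _ _ _ _ u hu _ _ _ _ _ _ _ _ hu' := absurd (h u hu) hu'

/-- `Modular` does not mention the request. Whether `y` lies above it is recovered from the given
comparison: in the wrong case `Served` yields the opposite one, against asymmetry. -/
theorem Served.modular [Finite V] {S : Finset V} {c r : V} {W : ℝ} {lt : V → V → Prop}
    (h : R.Served lt S c r W) (ha : ∀ u v, lt u v → ¬ lt v u)
    (hp : ∀ y, R.heavy c W y → R.anc y r → ∀ s ∈ S, R.light c W s → s ≠ R.par y →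
      lt (R.par y) s) : R.Modular lt S c W where
  light_module u hu u' hu' v hv h1 h2 h3 h4 := by
    obtain ⟨y, hy, hyv⟩ := exists_heavy h3
    by_cases hyr : R.anc y r
    · exact absurd (h.part_lt y hy v hv u hu hyv hyr fun h5 => hy.not_light h5 h1) (ha _ _ h4)
    · exact h.light_lt y hy u' hu' v hv h2 hyv hyr
  part_module y hy u hu u' hu' v hv h1 h2 h3 h4 := by
    by_cases hyr : R.anc y r
    · exact h.part_lt y hy u' hu' v hv h2 hyr h3
    · by_cases hv' : R.light c W v
      · exact absurd (h.light_lt y hy v hv u hu hv' h1 hyr) (ha _ _ h4)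
      · exact h.below_module y hy.1 hy.2.1 hy.2.2.2 u hu u' hu' v hv hyr h1 h2 h3 (hy.not_light h1)
          (hy.not_light h2) hv' h4
  below_module x hcx hxc hx u hu u' hu' v hv h1 h2 h3 h4 h5 h6 h7 := by
    by_cases hxr : R.anc x r
    · exact h.below_lt x hcx hxc hx u' hu' v hv hxr h2 h3 h5 h6
    · exact h.below_module x hcx hxc (light_of_anc hx (par_anc_of_anc hcx hxc)) u hu u' hu' v hv
        hxr h1 h2 h3 h4 h5 h6 h7
  first y hy v hv f hf u hu h1 h2 h3 h4 := by
    by_cases hyr : R.anc y r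
    · exact h.part_lt y hy v hv u hu h1 hyr h3
    · exact absurd (h.light_lt y hy f hf v hv h2 h1 hyr) (ha _ _ h4)
  port y hy u hu s hs h1 h2 h3 h4 := by
    by_cases hyr : R.anc y r
    · exact hp y hy hyr s hs h2 h3
    · exact absurd (h.light_lt y hy s hs u hu h2 h1 hyr) (ha _ _ h4)

theorem light_iff_of_light {c₀ c v : V} {W : ℝ} (hc : R.anc c₀ c) (hl : R.light c₀ W c)
    (hv : R.anc c v) : R.light c W v ↔ R.light c₀ W v := by
  constructor
  · intro h x h1 h2 h3
    rcases R.chain h3 hv with h4 | h4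
    · exact hl x h1 h2 h4
    · by_cases hxc : x = c
      · exact hl x h1 h2 (hxc ▸ R.refl x)
      · exact h x h4 hxc h3
  · intro h x h1 h2 h3
    refine h x (R.trans hc h1) (fun h4 => h2 ?_) h3
    rw [h4] at h1 ⊢
    exact R.antisymm hc h1

theorem heavy.of_light {c₀ c y : V} {W : ℝ} (hc : R.anc c₀ c) (hl : R.light c₀ W c)
    (hy : R.heavy c W y) : R.heavy c₀ W y := by
  refine ⟨R.trans hc hy.1, fun h => hy.2.1 ?_, hy.2.2.1,
    (light_iff_of_light hc hl (anc_par_of_anc hy.1 hy.2.1)).1 hy.2.2.2⟩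
  have := hy.1
  rw [h] at this ⊢
  exact R.antisymm hc this

/-- Compatibility passes to subtrees that reach up to the light part. -/
theorem Modular.mono {S₀ S : Finset V} {c₀ c : V} {W : ℝ} {lt : V → V → Prop}
    (hm : R.Modular lt S₀ c₀ W) (hsub : S ⊆ S₀) (hS : R.Sub S c) (hc : R.anc c₀ c)
    (hl : R.light c₀ W c) : R.Modular lt S c W := by
  have L : ∀ v ∈ S, (R.light c W v ↔ R.light c₀ W v) := fun v hv =>
    light_iff_of_light hc hl (hS.anc hv)
  have H : ∀ y, R.heavy c W y → R.heavy c₀ W y := fun y hy => hy.of_light hc hl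
  refine ⟨?_, ?_, ?_, ?_, ?_⟩
  · intro u hu u' hu' v hv h1 h2 h3
    rw [L u hu] at h1
    rw [L u' hu'] at h2
    rw [L v hv] at h3
    exact hm.light_module u (hsub hu) u' (hsub hu') v (hsub hv) h1 h2 h3
  · exact fun y hy u hu u' hu' v hv =>
      hm.part_module y (H y hy) u (hsub hu) u' (hsub hu') v (hsub hv)
  · intro x hcx hxc hx u hu u' hu' v hv h1 h2 h3 h4 h5 h6
    rw [L u hu] at h4
    rw [L u' hu'] at h5
    rw [L v hv] at h6
    refine hm.below_module x (R.trans hc hcx) (fun h => hxc ?_)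
      ((light_iff_of_light hc hl hcx).1 hx) u (hsub hu) u' (hsub hu') v (hsub hv) h1 h2 h3 h4 h5 h6
    rw [h] at hcx ⊢
    exact R.antisymm hc hcx
  · intro y hy v hv f hf u hu h1 h2 h3
    rw [L f hf] at h2
    exact hm.first y (H y hy) v (hsub hv) f (hsub hf) u (hsub hu) h1 h2 h3
  · intro y hy u hu s hs h1 h2 h3
    rw [L s hs] at h2
    exact hm.port y (H y hy) u (hsub hu) s (hsub hs) h1 h2 h3

/-- A vertex between `c` and `c₂` is one of both. -/
theorem not_anc_child {c c₂ x : V} (hpar : R.par c₂ = c) (hcx : R.anc c x) (hxc : x ≠ c)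
    (hx : ¬ R.anc c₂ x) {v : V} (hv : R.anc x v) : ¬ R.anc c₂ v := by
  intro h
  rcases R.chain h hv with h1 | h1
  · exact hx h1
  · by_cases hxe : x = c₂
    · exact hx (hxe ▸ R.refl x)
    · have := R.anc_par h1 hxe
      rw [hpar] at this
      exact hxc (R.antisymm this hcx)

variable (R) in
open Classical in
/-- The preferences of one step of Subtree-Decomposition on the subtree `S` with top `c`, in terms
of those of the algorithms for its parts. -/
structure StepOrder (S : Finset V) (c c₂ : V) (W : ℝ) (B : V → V → Finset V → V)
    (A₁ A₂ A : V → Finset V → V) : Prop where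
  child : c₂ ∈ S ∧ c₂ ≠ c ∧ R.par c₂ = c
  part_lt : ∀ r ∈ S, ∀ y, R.heavy c W y → R.anc y r → ∀ u ∈ S, ∀ v ∈ S, R.anc y u → ¬ R.anc y v →
    Before (A r) u v
  part_iff : ∀ r ∈ S, ∀ y, R.heavy c W y → R.anc y r → ∀ u ∈ S, ∀ v ∈ S, R.anc y u → R.anc y v →
    (Before (A r) u v ↔ Before (B y r) u v)
  light_lt : ∀ r ∈ S, ∀ y, R.heavy c W y → ¬ R.anc y r → ∀ u ∈ S, ∀ v ∈ S, R.light c W u →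
    R.anc y v → Before (A r) u v
  light_iff : ∀ r ∈ S, ∀ u ∈ S, ∀ v ∈ S, R.light c W u → R.light c W v →
    (Before (A r) u v ↔ Before (B c (R.gate c W r)) u v)
  -- Non-light vertices outside the part of the request are ranked by phase two alone. A request
  -- from the other side of the edge `c c₂` is replaced by the endpoint of the edge on this side.
  child_lt : ∀ r ∈ S, ∀ u ∈ S, ∀ v ∈ S, ¬ R.light c W u → ¬ R.light c W v →
    (∀ y, R.heavy c W y → R.anc y r → ¬ R.anc y u ∧ ¬ R.anc y v) →
    (R.anc c₂ r ↔ R.anc c₂ u) → ¬ (R.anc c₂ r ↔ R.anc c₂ v) → Before (A r) u v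
  child_iff : ∀ r ∈ S, ∀ u ∈ S, ∀ v ∈ S, ¬ R.light c W u → ¬ R.light c W v →
    (∀ y, R.heavy c W y → R.anc y r → ¬ R.anc y u ∧ ¬ R.anc y v) → R.anc c₂ u → R.anc c₂ v →
    (Before (A r) u v ↔ Before (A₂ (if R.anc c₂ r then r else c₂)) u v)
  rest_iff : ∀ r ∈ S, ∀ u ∈ S, ∀ v ∈ S, ¬ R.light c W u → ¬ R.light c W v →
    (∀ y, R.heavy c W y → R.anc y r → ¬ R.anc y u ∧ ¬ R.anc y v) → ¬ R.anc c₂ u → ¬ R.anc c₂ v →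
    (Before (A r) u v ↔ Before (A₁ (if R.anc c₂ r then c else r)) u v)

section StepOrder

variable {S : Finset V} {c c₂ : V} {W : ℝ} {B : V → V → Finset V → V}
  {A₁ A₂ A : V → Finset V → V}

theorem StepOrder.first [Finite V] (h : R.StepOrder S c c₂ W B A₁ A₂ A)
    (hB₀ : ∀ r ∈ S, R.light c W r → ∀ s ∈ S, R.light c W s → r ≠ s → Before (B c r) r s)
    (hB : ∀ y, R.heavy c W y → ∀ r ∈ S, ∀ s ∈ S, R.anc y r → R.anc y s → r ≠ s →
      Before (B y r) r s) :
    ∀ r ∈ S, ∀ s ∈ S, r ≠ s → Before (A r) r s := by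
  intro r hr s hs hne
  by_cases hl : R.light c W r
  · by_cases hls : R.light c W s
    · rw [h.light_iff r hr r hr s hs hl hls, gate_of_light hl]
      exact hB₀ r hr hl s hs hls hne
    · obtain ⟨y, hy, hys⟩ := exists_heavy hls
      exact h.light_lt r hr y hy (fun h5 => hy.not_light h5 hl) r hr s hs hl hys
  · obtain ⟨y, hy, hyr⟩ := exists_heavy hl
    by_cases hys : R.anc y s
    · rw [h.part_iff r hr y hy hyr r hr s hs hyr hys]
      exact hB y hy r hr s hs hyr hys hne
    · exact h.part_lt r hr y hy hyr r hr s hs hyr hys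

open Classical in
-- Phase two settles comparisons across the edge `c c₂`; on either side they come from `A₁` or `A₂`.
-- A request handed over to the other side arrives at `c` or `c₂`, which is not below the `x` in
-- question, so `below_module` still applies.
theorem StepOrder.served (h : R.StepOrder S c c₂ W B A₁ A₂ A) (hS : R.Sub S c)
    (hA₁ : ∀ r ∈ S, ¬ R.anc c₂ r →
      R.Served (Before (A₁ r)) (S.filter fun v => ¬ R.anc c₂ v) c r W)
    (hA₂ : ∀ r ∈ S, R.anc c₂ r → R.Served (Before (A₂ r)) (S.filter fun v => R.anc c₂ v) c₂ r W)
    {r : V} (hr : r ∈ S) : R.Served (Before (A r)) S c r W := by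
  obtain ⟨hc₂S, hc₂c, hpar⟩ := h.child
  have hcc₂ : R.anc c c₂ := hS.anc hc₂S
  have hc₂n : ¬ R.anc c₂ c := fun h1 => hc₂c (R.antisymm h1 hcc₂)
  -- descent of the light relation to the subtree below `c₂`
  have L₂ : ∀ v, R.anc c₂ v → R.light c W v → R.light c₂ W v := fun v _ h1 x h2 h3 h4 =>
    h1 x (R.trans hcc₂ h2) (fun h5 => hc₂n (h5 ▸ h2)) h4
  have N₂ : R.light c W c₂ → ∀ v, R.anc c₂ v → ¬ R.light c W v → ¬ R.light c₂ W v :=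
    fun hl v hv h1 h2 => h1 ((light_iff_of_light hcc₂ hl hv).1 h2)
  refine ⟨fun y hy u hu v hv h1 h2 h3 => h.light_lt r hr y hy h3 u hu v hv h1 h2,
    fun y hy u hu v hv h1 h2 h3 => h.part_lt r hr y hy h2 u hu v hv h1 h3, ?_, ?_⟩
  · intro x hcx hxc hx u hu v hv hxr hxu hxv hlu hlv
    by_cases hsame : ∃ y, R.heavy c W y ∧ R.anc y r ∧ R.anc y u
    · obtain ⟨y, hy, hyr, hyu⟩ := hsame
      refine h.part_lt r hr y hy hyr u hu v hv hyu fun hyv => hxv ?_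
      rw [hy.anc_iff hyr hx] at hxr
      exact (hy.anc_iff hyv hx).2 hxr
    have hout : ∀ y, R.heavy c W y → R.anc y r → ¬ R.anc y u ∧ ¬ R.anc y v := by
      refine fun y hy hyr => ⟨fun hyu => hsame ⟨y, hy, hyr, hyu⟩, fun hyv => hxv ?_⟩
      rw [hy.anc_iff hyr hx] at hxr
      exact (hy.anc_iff hyv hx).2 hxr
    by_cases hx2 : R.anc c₂ x
    · have hr2 := R.trans hx2 hxr
      have hu2 := R.trans hx2 hxu
      by_cases hv2 : R.anc c₂ v
      · rw [h.child_iff r hr u hu v hv hlu hlv hout hu2 hv2, if_pos hr2]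
        have hlc₂ := light_of_anc hx hx2
        exact (hA₂ r hr hr2).below_lt x hx2 (fun h5 => hxv (h5 ▸ hv2)) (L₂ x hx2 hx) u
          (Finset.mem_filter.2 ⟨hu, hu2⟩) v (Finset.mem_filter.2 ⟨hv, hv2⟩) hxr hxu hxv
          (N₂ hlc₂ u hu2 hlu) (N₂ hlc₂ v hv2 hlv)
      · exact h.child_lt r hr u hu v hv hlu hlv hout (by simp [hr2, hu2]) (by simp [hr2, hv2])
    · have hr2 := not_anc_child hpar hcx hxc hx2 hxr
      have hu2 := not_anc_child hpar hcx hxc hx2 hxu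
      by_cases hv2 : R.anc c₂ v
      · exact h.child_lt r hr u hu v hv hlu hlv hout (by simp [hr2, hu2]) (by simp [hr2, hv2])
      · rw [h.rest_iff r hr u hu v hv hlu hlv hout hu2 hv2, if_neg hr2]
        exact (hA₁ r hr hr2).below_lt x hcx hxc hx u (Finset.mem_filter.2 ⟨hu, hu2⟩) v
          (Finset.mem_filter.2 ⟨hv, hv2⟩) hxr hxu hxv hlu hlv
  · intro x hcx hxc hx u hu u' hu' v hv hxr hxu hxu' hxv hlu hlu' hlv huv
    -- Such a `y` would be comparable with `x`: below `x` it puts the request below `x`, and above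
    -- `x` it contradicts that the parent of `x` is light.
    have hxy : ∀ y, R.heavy c W y → R.anc y r → ∀ w, R.anc x w → ¬ R.anc y w := by
      intro y hy hyr w hxw hyw
      rcases R.chain hxw hyw with h1 | h1
      · exact hxr (R.trans h1 hyr)
      · by_cases hyx : y = x
        · exact hxr (hyx ▸ hyr)
        · exact hy.not_light (R.anc_par h1 hyx) hx
    have hvy : ∀ y, R.heavy c W y → R.anc y r → ¬ R.anc y v := fun y hy hyr hyv =>
      huv.asymm (h.part_lt r hr y hy hyr v hv u hu hyv (hxy y hy hyr u hxu))
    have hout : ∀ y, R.heavy c W y → R.anc y r → ¬ R.anc y u ∧ ¬ R.anc y v := fun y hy hyr =>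
      ⟨hxy y hy hyr u hxu, hvy y hy hyr⟩
    have hout' : ∀ y, R.heavy c W y → R.anc y r → ¬ R.anc y u' ∧ ¬ R.anc y v := fun y hy hyr =>
      ⟨hxy y hy hyr u' hxu', hvy y hy hyr⟩
    have hout2 : ∀ y, R.heavy c W y → R.anc y r → ¬ R.anc y v ∧ ¬ R.anc y u := fun y hy hyr =>
      (hout y hy hyr).symm
    by_cases hx2 : R.anc c₂ x
    · have hu2 := R.trans hx2 hxu
      have hu2' := R.trans hx2 hxu'
      by_cases hv2 : R.anc c₂ v
      · have hne : x ≠ c₂ := fun h5 => hxv (h5 ▸ hv2)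
        have hx2' : R.anc c₂ (R.par x) := R.anc_par hx2 hne.symm
        have hlc₂ := light_of_anc hx hx2'
        rw [h.child_iff r hr u hu v hv hlu hlv hout hu2 hv2] at huv
        rw [h.child_iff r hr u' hu' v hv hlu' hlv hout' hu2' hv2]
        have hreq : ∀ q ∈ S, R.anc c₂ q → ¬ R.anc x q → Before (A₂ q) u v → Before (A₂ q) u' v :=
          fun q hq hq2 hxq => (hA₂ q hq hq2).below_module x hx2 hne (L₂ _ hx2' hx) u
            (Finset.mem_filter.2 ⟨hu, hu2⟩) u' (Finset.mem_filter.2 ⟨hu', hu2'⟩) v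
            (Finset.mem_filter.2 ⟨hv, hv2⟩) hxq hxu hxu' hxv (N₂ hlc₂ u hu2 hlu)
            (N₂ hlc₂ u' hu2' hlu') (N₂ hlc₂ v hv2 hlv)
        by_cases hr2 : R.anc c₂ r
        · rw [if_pos hr2] at huv ⊢
          exact hreq r hr hr2 hxr huv
        · rw [if_neg hr2] at huv ⊢
          exact hreq c₂ hc₂S (R.refl _) (fun h5 => hne (R.antisymm h5 hx2)) huv
      · by_cases hr2 : R.anc c₂ r
        · exact h.child_lt r hr u' hu' v hv hlu' hlv hout' (by simp [hr2, hu2'])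
            (by simp [hr2, hv2])
        · exact absurd (h.child_lt r hr v hv u hu hlv hlu hout2 (by simp [hr2, hv2])
            (by simp [hr2, hu2])) huv.asymm
    · have hu2 := not_anc_child hpar hcx hxc hx2 hxu
      have hu2' := not_anc_child hpar hcx hxc hx2 hxu'
      by_cases hv2 : R.anc c₂ v
      · by_cases hr2 : R.anc c₂ r
        · exact absurd (h.child_lt r hr v hv u hu hlv hlu hout2 (by simp [hr2, hv2])
            (by simp [hr2, hu2])) huv.asymm
        · exact h.child_lt r hr u' hu' v hv hlu' hlv hout' (by simp [hr2, hu2'])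
            (by simp [hr2, hv2])
      · rw [h.rest_iff r hr u hu v hv hlu hlv hout hu2 hv2] at huv
        rw [h.rest_iff r hr u' hu' v hv hlu' hlv hout' hu2' hv2]
        have hreq : ∀ q ∈ S, ¬ R.anc c₂ q → ¬ R.anc x q → Before (A₁ q) u v →
            Before (A₁ q) u' v :=
          fun q hq hq2 hxq => (hA₁ q hq hq2).below_module x hcx hxc hx u
            (Finset.mem_filter.2 ⟨hu, hu2⟩) u' (Finset.mem_filter.2 ⟨hu', hu2'⟩) v
            (Finset.mem_filter.2 ⟨hv, hv2⟩) hxq hxu hxu' hxv hlu hlu' hlv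
        by_cases hr2 : R.anc c₂ r
        · rw [if_pos hr2] at huv ⊢
          exact hreq c hS.1 hc₂n (fun h5 => hxc (R.antisymm h5 hcx)) huv
        · rw [if_neg hr2] at huv ⊢
          exact hreq r hr hr2 hxr huv

open Classical in
-- The position of `c'` decides. If `S'` is light, `B c` ranks it. If `S'` lies below a heavy edge,
-- it is ranked by the algorithm of that part when the request is there, and by `A₁` or `A₂`
-- otherwise. Only if `S'` reaches from the light part across a heavy edge is the present step
-- itself relevant.
theorem StepOrder.modular [Finite V] (h : R.StepOrder S c c₂ W B A₁ A₂ A) (hS : R.Sub S c)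
    (hmax : ∀ x ∈ S, x ≠ c → R.wt x ≤ W)
    (hserved : ∀ r ∈ S, R.Served (Before (A r)) S c r W)
    (hfirst : ∀ r ∈ S, R.light c W r → ∀ s ∈ S, R.light c W s → r ≠ s → Before (B c r) r s)
    (hB₀ : ∀ r ∈ S, R.light c W r → ∀ S' ⊆ S, (∀ v ∈ S', R.light c W v) → ∀ c' W', R.Sub S' c' →
      (∀ x ∈ S', x ≠ c' → R.wt x ≤ W') → R.Modular (Before (B c r)) S' c' W')
    (hB : ∀ y, R.heavy c W y → ∀ r ∈ S, R.anc y r → ∀ S' ⊆ S, (∀ v ∈ S', R.anc y v) → ∀ c' W',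
      R.Sub S' c' → (∀ x ∈ S', x ≠ c' → R.wt x ≤ W') → R.Modular (Before (B y r)) S' c' W')
    (hA₁ : ∀ r ∈ S, ¬ R.anc c₂ r → ∀ S' ⊆ S, (∀ v ∈ S', ¬ R.anc c₂ v) → ∀ c' W',
      R.Sub S' c' → (∀ x ∈ S', x ≠ c' → R.wt x ≤ W') → R.Modular (Before (A₁ r)) S' c' W')
    (hA₂ : ∀ r ∈ S, R.anc c₂ r → ∀ S' ⊆ S, (∀ v ∈ S', R.anc c₂ v) → ∀ c' W',
      R.Sub S' c' → (∀ x ∈ S', x ≠ c' → R.wt x ≤ W') → R.Modular (Before (A₂ r)) S' c' W')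
    {r : V} (hr : r ∈ S) {S' : Finset V} (hS'S : S' ⊆ S) {c' : V} {W' : ℝ} (hS' : R.Sub S' c')
    (hW' : ∀ x ∈ S', x ≠ c' → R.wt x ≤ W') : R.Modular (Before (A r)) S' c' W' := by
  obtain ⟨hc₂S, hc₂c, hpar⟩ := h.child
  have hcc₂ : R.anc c c₂ := hS.anc hc₂S
  have hc₂n : ¬ R.anc c₂ c := fun h1 => hc₂c (R.antisymm h1 hcc₂)
  by_cases hl : R.light c W c'
  · by_cases hall : ∀ v ∈ S', R.light c W v
    · exact (hB₀ _ (gate_mem hS hr) (light_gate r) S' hS'S hall c' W' hS' hW').congr hS'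
        fun u hu v hv => h.light_iff r hr u (hS'S hu) v (hS'S hv) (hall u hu) (hall v hv)
    · push Not at hall
      obtain ⟨z, hz, hzl⟩ := hall
      have hcc' := hS.anc (hS'S hS'.1)
      obtain ⟨y, hy, hyz⟩ := exists_heavy hzl
      have hc'y : R.anc c' y := by
        rcases R.chain hyz (hS'.anc hz) with h1 | h1
        · exact absurd hl (hy.not_light h1)
        · exact h1
      have hWW' : W ≤ W' := hy.2.2.1.trans (hW' y (hS'.mem_of_anc hz hc'y hyz)
        fun h1 => hy.not_light (R.refl y) (h1 ▸ hl))
      -- For equal weights the decomposition of `S'` is the trace of that of `S`; for `W < W'` all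
      -- of `S'` is light and there is nothing to show.
      rcases hWW'.eq_or_lt with rfl | hlt
      · refine ((hserved r hr).modular (fun u v h1 => h1.asymm) ?_).mono hS'S hS' hcc' hl
        intro y hy hyr s hs hsl hne
        have hpS : R.par y ∈ S :=
          hS.mem_of_anc hr (anc_par_of_anc hy.1 hy.2.1) (R.trans hy.par_anc hyr)
        rw [h.light_iff r hr _ hpS s hs hy.2.2.2 hsl, gate_of_heavy hy hyr]
        exact hfirst _ hpS hy.2.2.2 s hs hsl hne.symm
      · refine modular_of_forall_light fun v hv => light_of_forall_lt hS' (fun x hx hxc => ?_) hv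
        refine (hmax x (hS'S hx) fun h1 => hxc ?_).trans_lt hlt
        have := hS'.anc hx
        rw [h1] at this ⊢
        exact R.antisymm hcc' this
  · obtain ⟨y, hy, hyc'⟩ := exists_heavy hl
    have hyS : ∀ v ∈ S', R.anc y v := fun v hv => R.trans hyc' (hS'.anc hv)
    by_cases hyr : R.anc y r
    · exact (hB y hy r hr hyr S' hS'S hyS c' W' hS' hW').congr hS' fun u hu v hv =>
        h.part_iff r hr y hy hyr u (hS'S hu) v (hS'S hv) (hyS u hu) (hyS v hv)
    · have hout : ∀ u ∈ S', ∀ v ∈ S', ∀ y, R.heavy c W y → R.anc y r →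
          ¬ R.anc y u ∧ ¬ R.anc y v := by
        intro u hu v hv z hz hzr
        exact ⟨fun h1 => hyr (hz.unique hy h1 (hyS u hu) ▸ hzr),
          fun h1 => hyr (hz.unique hy h1 (hyS v hv) ▸ hzr)⟩
      by_cases hy2 : R.anc c₂ y
      · have hS2 : ∀ v ∈ S', R.anc c₂ v := fun v hv => R.trans hy2 (hyS v hv)
        refine (hA₂ (if R.anc c₂ r then r else c₂) ?_ ?_ S' hS'S hS2 c' W' hS' hW').congr hS'
          fun u hu v hv => h.child_iff r hr u (hS'S hu) v (hS'S hv) (hy.not_light (hyS u hu))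
            (hy.not_light (hyS v hv)) (hout u hu v hv) (hS2 u hu) (hS2 v hv)
        · split_ifs <;> assumption
        · split_ifs with h1
          · exact h1
          · exact R.refl _
      · have hS2 : ∀ v ∈ S', ¬ R.anc c₂ v := fun v hv =>
          not_anc_child hpar hy.1 hy.2.1 hy2 (hyS v hv)
        refine (hA₁ (if R.anc c₂ r then c else r) ?_ ?_ S' hS'S hS2 c' W' hS' hW').congr hS'
          fun u hu v hv => h.rest_iff r hr u (hS'S hu) v (hS'S hv) (hy.not_light (hyS u hu))
            (hy.not_light (hyS v hv)) (hout u hu v hv) (hS2 u hu) (hS2 v hv)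
        · split_ifs
          · exact hS.1
          · exact hr
        · split_ifs with h1
          · exact hc₂n
          · exact h1

end StepOrder

end AncTree

/-! ### Subtree-Decomposition in terms of the ancestor relation -/

namespace PowTwoTree

open SimpleGraph

variable {V : Type*} (T : PowTwoTree V) (ρ : V)

/-- The algorithm uses parents relative to the top of the current subtree; below that top the choice
of the root is immaterial. -/
theorem parent_eq_parent {c x : V} (h : T.IsAncestor ρ c x) (hx : x ≠ c) :
    T.parent c x = T.parent ρ x := by
  obtain ⟨hadj, h1⟩ := T.path_eq_concat c hx
  have h2 : T.parent c x ∈ (T.path c x).support := by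
    rw [h1, Walk.support_concat]
    simp
  rcases T.parent_eq_of_adj ρ hadj with ⟨-, h3⟩ | ⟨h3, h4⟩
  · exact h3.symm
  · have h5 := ((T.mem_path_iff ρ h).1 h2).2
    have h6 := (T.ancTree ρ).par_anc h3
    change T.IsAncestor ρ (T.parent ρ (T.parent c x)) _ at h6
    rw [h4] at h6
    exact absurd (T.anc_antisymm ρ h5 h6) hadj.ne

theorem mem_edges_path {c x v : V} (h : T.IsAncestor ρ c x) (hx : x ≠ c)
    (hv : T.IsAncestor ρ x v) : s(T.parent ρ x, x) ∈ (T.path c v).edges := by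
  have h1 : x ∈ (T.path c v).support :=
    (T.mem_path_iff ρ ((T.ancTree ρ).trans h hv)).2 ⟨h, hv⟩
  obtain ⟨hadj, h2⟩ := T.path_eq_concat c hx
  refine T.edges_sub h1 ?_
  rw [h2, Walk.edges_concat, ← T.parent_eq_parent ρ h hx]
  simp

theorem _root_.IsChoice.mono {S S' : Finset V} {f : Finset V → V} (h : IsChoice S f)
    (hs : S' ⊆ S) : IsChoice S' f := fun F hF => h F (hF.trans hs)

variable {T ρ}

section

variable {S : Finset V} {c : V} (hS : (T.ancTree ρ).Sub S c)

include hS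

theorem mem_below_iff {x v : V} (hx : x ∈ S) :
    v ∈ T.below S c x ↔ v ∈ S ∧ (T.ancTree ρ).anc x v := by
  classical
  rw [mem_below]
  refine and_congr_right fun hv => ?_
  rw [T.mem_path_iff ρ (hS.anc hv)]
  exact and_iff_right (hS.anc hx)

open Classical in
theorem mem_rest_iff {c₂ : V} (hc₂ : c₂ ∈ S) {v : V} :
    v ∈ S \ T.below S c c₂ ↔ v ∈ S ∧ ¬ (T.ancTree ρ).anc c₂ v := by
  rw [Finset.mem_sdiff, mem_below_iff hS hc₂]
  tauto

theorem sub_below {x : V} (hx : x ∈ S) : (T.ancTree ρ).Sub (T.below S c x) x  := by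
  classical
  convert hS.below hx using 1
  ext v
  rw [mem_below_iff hS hx, Finset.mem_filter]

theorem child_spec {c₂ : V} (hc₂ : c₂ ∈ S) (hadj : T.graph.Adj c c₂) :
    c₂ ∈ S ∧ c₂ ≠ c ∧ (T.ancTree ρ).par c₂ = c := by
  refine ⟨hc₂, hadj.ne', ?_⟩
  rcases T.parent_eq_of_adj ρ hadj with ⟨-, h⟩ | ⟨h1, h⟩
  · exact h
  · have h2 := (T.ancTree ρ).par_anc h1
    change T.IsAncestor ρ (T.parent ρ c) c at h2
    rw [h] at h2
    exact absurd (T.anc_antisymm ρ h2 (hS.anc hc₂)) hadj.ne'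

variable [Fintype V]

theorem mem_lightPart_iff {v : V} :
    v ∈ T.lightPart S c ↔ v ∈ S ∧ (T.ancTree ρ).light c (T.wmax S) v := by
  classical
  rw [mem_light]
  refine and_congr_right fun hv => ⟨fun h x h1 h2 h3 => ?_, fun h e he hh => ?_⟩
  · have hxS := hS.mem_of_anc hv h1 h3
    have h4 := h _ (T.mem_edges_path ρ h1 h2 h3)
    by_contra hw
    rw [not_lt] at hw
    refine h4 (Finset.mem_filter.2 ⟨T.mem_edgesIn ρ hS hxS h2, fun e' he' => ?_⟩)
    exact (Finset.le_sup (f := T.w) he').trans (NNReal.coe_le_coe.1 hw)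
  · obtain ⟨he', hmax⟩ := Finset.mem_filter.1 hh
    obtain ⟨x, hx, hxc, -, rfl⟩ := T.exists_of_mem_edgesIn ρ hS he'
    have h1 : x ∈ (T.path c v).support := Walk.snd_mem_support_of_mem_edges _ he
    have h2 := (T.mem_path_iff ρ (hS.anc hv)).1 h1
    have h3 := h x h2.1 hxc h2.2
    refine absurd h3 (not_lt.2 (NNReal.coe_le_coe.2 (Finset.sup_le fun e he => hmax e he)))

theorem mem_heavyRoots_iff {x : V} :
    x ∈ T.heavyRoots S c ↔ x ∈ S ∧ (T.ancTree ρ).heavy c (T.wmax S) x := by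
  classical
  rw [heavyRoots, Finset.mem_filter, mem_lightPart_iff hS, mem_lightPart_iff hS]
  refine and_congr_right fun hx => ?_
  simp only [hx, true_and]
  constructor
  · rintro ⟨h1, h2, h3⟩
    have hxc : x ≠ c := fun h => h1 (h ▸ AncTree.light_self _ _)
    rw [T.parent_eq_parent ρ (hS.anc hx) hxc] at h2 h3
    obtain ⟨y, hy, hyx⟩ := AncTree.exists_heavy h1
    by_cases hyx' : y = x
    · exact hyx' ▸ hy
    · exact absurd h3 (hy.not_light ((T.ancTree ρ).anc_par hyx hyx'))
  · intro h
    rw [T.parent_eq_parent ρ h.1 h.2.1]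
    exact ⟨h.not_light ((T.ancTree ρ).refl x), hS.mem_of_anc hx
      (AncTree.anc_par_of_anc (R := T.ancTree ρ) h.1 h.2.1) h.par_anc, h.2.2.2⟩

omit hS in
theorem part_root : T.part S c c = T.lightPart S c := by simp [part]

omit hS in
theorem part_of_heavy {y : V} (hy : (T.ancTree ρ).heavy c (T.wmax S) y) :
    T.part S c y = T.below S c y := by simp [part, hy.2.1]

theorem partRoot_of_heavy {r y : V} (hr : r ∈ S) (hy : (T.ancTree ρ).heavy c (T.wmax S) y)
    (hyr : (T.ancTree ρ).anc y r) : T.partRoot S c r = y := by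
  have hyS := hS.mem_of_anc hr hy.1 hyr
  have h : ∃ x ∈ T.heavyRoots S c, r ∈ T.below S c x :=
    ⟨y, (mem_heavyRoots_iff hS).2 ⟨hyS, hy⟩, (mem_below_iff hS hyS).2 ⟨hr, hyr⟩⟩
  rw [partRoot, dif_pos h]
  obtain ⟨h1, h2⟩ := h.choose_spec
  rw [mem_heavyRoots_iff hS] at h1
  rw [mem_below_iff hS h1.1] at h2
  exact h1.2.unique hy h2.2 hyr

theorem partRoot_of_light {r : V} (hl : (T.ancTree ρ).light c (T.wmax S) r) :
    T.partRoot S c r = c := by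
  rw [partRoot, dif_neg]
  rintro ⟨x, h1, h2⟩
  rw [mem_heavyRoots_iff hS] at h1
  rw [mem_below_iff hS h1.1] at h2
  exact h1.2.not_light h2.2 hl

end

variable [Fintype V]

open Classical in
/-- The second phase of Subtree-Decomposition. -/
noncomputable def phaseTwo (S₁ S₂ : Finset V) (c c₂ : V) (A₁ A₂ : AssignRule V) (r : V) :
    Finset V → V :=
  if r ∈ S₁ then seqChoice S₁ (A₁ r) (fun F => A₂ c₂ (F ∩ S₂))
  else seqChoice S₂ (A₂ r) (fun F => A₁ c (F ∩ S₁))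

open Classical in
-- Both phases try the part of the request first, and phase two starts only when the light part is
-- exhausted. So the algorithm is a sequential choice, and the initial test on `T₀` needs no
-- separate treatment.
theorem sdAssign_eq (S : Finset V) (c c₂ : V) (B : V → AssignRule V) (A₁ A₂ : AssignRule V)
    (r : V) : T.sdAssign S c c₂ B A₁ A₂ r =
    seqChoice (T.part S c (T.partRoot S c r)) (B (T.partRoot S c r) r)
      (seqChoice (T.lightPart S c) (B c (T.parent c (T.partRoot S c r)))
        (phaseTwo (S \ T.below S c c₂) (T.below S c c₂) c c₂ A₁ A₂ r)) := by
  funext F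
  unfold sdAssign seqChoice phaseTwo seqChoice
  simp only
  split_ifs <;> first | rfl | (dsimp only; split_ifs; rfl)

section Step

open scoped Classical

variable {S : Finset V} {c c₂ : V} (hS : (T.ancTree ρ).Sub S c) (hc₂ : c₂ ∈ S)
  (hadj : T.graph.Adj c c₂) {B : V → AssignRule V} {A₁ A₂ : AssignRule V}

omit [Fintype V] in
include hS hc₂ hadj in
theorem sub_rest : (T.ancTree ρ).Sub (S \ T.below S c c₂) c := by
  obtain ⟨-, h1, -⟩ := child_spec hS hc₂ hadj
  refine ⟨(mem_rest_iff hS hc₂).2 ⟨hS.1, fun h => h1 ((T.ancTree ρ).antisymm h (hS.anc hc₂))⟩,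
    fun v hv => ?_⟩
  rw [mem_rest_iff hS hc₂] at hv
  refine ⟨hS.anc hv.1, fun y h2 h3 => (mem_rest_iff hS hc₂).2 ⟨hS.mem_of_anc hv.1 h2 h3, fun h4 =>
    hv.2 ((T.ancTree ρ).trans h4 h3)⟩⟩

include hS in
theorem sub_lightPart : (T.ancTree ρ).Sub (T.lightPart S c) c := by
  convert hS.light (T.wmax S) using 1
  ext v
  rw [mem_lightPart_iff hS, Finset.mem_filter]

include hS in
theorem sub_part {x : V} (hx : x ∈ insert c (T.heavyRoots S c)) :
    (T.ancTree ρ).Sub (T.part S c x) x := by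
  rcases Finset.mem_insert.1 hx with rfl | hx
  · rw [part_root]
    exact sub_lightPart hS
  · rw [mem_heavyRoots_iff hS] at hx
    rw [part_of_heavy hx.2]
    exact sub_below hS hx.1

variable (hB : ∀ x ∈ insert c (T.heavyRoots S c), ∀ r ∈ T.part S c x,
    IsChoice (T.part S c x) (B x r))

include hS hB in
theorem choice_light {r : V} (hr : r ∈ S) (hl : (T.ancTree ρ).light c (T.wmax S) r) :
    IsChoice (T.lightPart S c) (B c r) := by
  have := hB c (Finset.mem_insert_self _ _) r
  rw [part_root] at this
  exact this ((mem_lightPart_iff hS).2 ⟨hr, hl⟩)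

include hS hB in
theorem choice_heavy {r y : V} (hr : r ∈ S) (hy : (T.ancTree ρ).heavy c (T.wmax S) y)
    (hyr : (T.ancTree ρ).anc y r) : IsChoice (T.below S c y) (B y r) := by
  have hyS := hS.mem_of_anc hr hy.1 hyr
  have := hB y (Finset.mem_insert_of_mem ((mem_heavyRoots_iff hS).2 ⟨hyS, hy⟩)) r
  rw [part_of_heavy hy] at this
  exact this ((mem_below_iff hS hyS).2 ⟨hr, hyr⟩)

include hS in
/-- The first phase serves the part of the request, and then the light part. -/
theorem sdAssign_cases {r : V} (hr : r ∈ S) :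
    ((T.ancTree ρ).light c (T.wmax S) r ∧ T.sdAssign S c c₂ B A₁ A₂ r =
      seqChoice (T.lightPart S c) (B c r)
        (seqChoice (T.lightPart S c) (B c (T.parent c c))
          (phaseTwo (S \ T.below S c c₂) (T.below S c c₂) c c₂ A₁ A₂ r))) ∨
    ∃ y, (T.ancTree ρ).heavy c (T.wmax S) y ∧ (T.ancTree ρ).anc y r ∧ y ∈ S ∧
      (T.ancTree ρ).gate c (T.wmax S) r = T.parent ρ y ∧ T.sdAssign S c c₂ B A₁ A₂ r =
      seqChoice (T.below S c y) (B y r)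
        (seqChoice (T.lightPart S c) (B c (T.parent ρ y))
          (phaseTwo (S \ T.below S c c₂) (T.below S c c₂) c c₂ A₁ A₂ r)) := by
  rw [sdAssign_eq]
  by_cases hl : (T.ancTree ρ).light c (T.wmax S) r
  · left
    rw [partRoot_of_light hS hl, part_root]
    exact ⟨hl, rfl⟩
  · right
    obtain ⟨y, hy, hyr⟩ := AncTree.exists_heavy hl
    refine ⟨y, hy, hyr, hS.mem_of_anc hr hy.1 hyr, AncTree.gate_of_heavy hy hyr, ?_⟩
    rw [partRoot_of_heavy hS hr hy hyr, part_of_heavy hy, T.parent_eq_parent ρ hy.1 hy.2.1]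

variable (hA₁ : ∀ r ∈ S \ T.below S c c₂, IsChoice (S \ T.below S c c₂) (A₁ r))
  (hA₂ : ∀ r ∈ T.below S c c₂, IsChoice (T.below S c c₂) (A₂ r))

include hS hc₂ hadj hA₁ hA₂ in
theorem phaseTwo_isChoice {r : V} (hr : r ∈ S) : IsChoice S
    (phaseTwo (S \ T.below S c c₂) (T.below S c c₂) c c₂ A₁ A₂ r) := by
  have hsub : T.below S c c₂ ⊆ S := fun v hv => ((mem_below_iff hS hc₂).1 hv).1
  have key : ∀ (X : Finset V) (g : Finset V → V), IsChoice X g → ∀ Y ⊆ X,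
      IsChoice Y (fun F => g (F ∩ X)) := by
    intro X g hg Y hY F hF hne
    have h1 : ∀ G ⊆ F, G ∩ X = G := fun G hG =>
      Finset.inter_eq_left.2 ((hG.trans hF).trans hY)
    obtain ⟨h2, h3⟩ := hg F (hF.trans hY) hne
    simp only [h1 F subset_rfl]
    refine ⟨h2, fun G hG hGm => ?_⟩
    rw [h1 G hG]
    exact h3 G hG hGm
  unfold phaseTwo
  by_cases h : r ∈ S \ T.below S c c₂
  · rw [if_pos h]
    refine (hA₁ r h).seqChoice (key _ _ (hA₂ c₂ (sub_below hS hc₂).1) _ fun v hv => ?_)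
    simp only [Finset.mem_sdiff, not_and, not_not] at hv
    exact hv.2 hv.1
  · rw [if_neg h]
    refine (hA₂ r ?_).seqChoice (key _ _ (hA₁ c (sub_rest hS hc₂ hadj).1) _ subset_rfl)
    simp only [Finset.mem_sdiff, not_and, not_not] at h
    exact h hr

include hS hc₂ hadj hB hA₁ hA₂ in
theorem sdAssign_isChoice {r : V} (hr : r ∈ S) :
    IsChoice S (T.sdAssign S c c₂ B A₁ A₂ r) := by
  have h2 := phaseTwo_isChoice hS hc₂ hadj hA₁ hA₂ hr
  rcases sdAssign_cases (A₁ := A₁) (A₂ := A₂) (B := B) (c₂ := c₂) hS hr with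
    ⟨hl, h⟩ | ⟨y, hy, hyr, hyS, -, h⟩
  · rw [h]
    refine (choice_light hS hB hr hl).seqChoice fun F hF hne => ?_
    -- For a light request its own part is the light part, so the second choice from it, with the
    -- default request `T.parent c c`, never acts.
    have h3 : ∀ G ⊆ F, seqChoice (T.lightPart S c) (B c (T.parent c c))
        (phaseTwo (S \ T.below S c c₂) (T.below S c c₂) c c₂ A₁ A₂ r) G =
        phaseTwo (S \ T.below S c c₂) (T.below S c c₂) c c₂ A₁ A₂ r G := by
      intro G hG
      rw [seqChoice, if_neg]
      rintro ⟨v, hv⟩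
      rw [Finset.mem_inter] at hv
      exact (Finset.mem_sdiff.1 (hF (hG hv.1))).2 hv.2
    rw [h3 F subset_rfl]
    obtain ⟨h4, h5⟩ := h2 F (hF.trans Finset.sdiff_subset) hne
    refine ⟨h4, fun G hG => ?_⟩
    rw [h3 G hG]
    exact h5 G hG
  · rw [h]
    have hp : T.parent ρ y ∈ S :=
      hS.mem_of_anc hyS (AncTree.anc_par_of_anc (R := T.ancTree ρ) hy.1 hy.2.1) hy.par_anc
    exact (choice_heavy hS hB hr hy hyr).seqChoice
      (IsChoice.seqChoice (choice_light hS hB hp hy.2.2.2)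
        (IsChoice.mono h2 (Finset.sdiff_subset.trans Finset.sdiff_subset)))

omit [Fintype V] in
include hS hc₂ hA₁ hA₂ in
theorem phaseTwo_spec {r : V} (hr : r ∈ S) : ∀ u ∈ S, ∀ v ∈ S,
    (((T.ancTree ρ).anc c₂ r ↔ (T.ancTree ρ).anc c₂ u) →
      ¬ ((T.ancTree ρ).anc c₂ r ↔ (T.ancTree ρ).anc c₂ v) →
      Before (phaseTwo (S \ T.below S c c₂) (T.below S c c₂) c c₂ A₁ A₂ r) u v) ∧
    ((T.ancTree ρ).anc c₂ u → (T.ancTree ρ).anc c₂ v →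
      (Before (phaseTwo (S \ T.below S c c₂) (T.below S c c₂) c c₂ A₁ A₂ r) u v ↔
        Before (A₂ (if (T.ancTree ρ).anc c₂ r then r else c₂)) u v)) ∧
    (¬ (T.ancTree ρ).anc c₂ u → ¬ (T.ancTree ρ).anc c₂ v →
      (Before (phaseTwo (S \ T.below S c c₂) (T.below S c c₂) c c₂ A₁ A₂ r) u v ↔
        Before (A₁ (if (T.ancTree ρ).anc c₂ r then c else r)) u v)) := by
  intro u hu v hv
  have m1 : ∀ w ∈ S, (w ∈ S \ T.below S c c₂ ↔ ¬ (T.ancTree ρ).anc c₂ w) := fun w hw => by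
    rw [mem_rest_iff hS hc₂]
    simp [hw]
  have m2 : ∀ w ∈ S, (w ∈ T.below S c c₂ ↔ (T.ancTree ρ).anc c₂ w) := fun w hw => by
    rw [mem_below_iff hS hc₂]
    simp [hw]
  have key : ∀ (X : Finset V) (g : Finset V → V), u ∈ X → v ∈ X →
      (Before (fun F => g (F ∩ X)) u v ↔ Before g u v) := by
    intro X g h1 h2
    have h3 : ({u, v} : Finset V) ∩ X = {u, v} := by ext x; simp; grind
    simp only [Before, h3]
  by_cases h : (T.ancTree ρ).anc c₂ r
  · have h' : r ∉ S \ T.below S c c₂ := by rw [m1 r hr]; simpa using h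
    simp only [phaseTwo, if_neg h', h, true_iff, if_true]
    refine ⟨fun h1 h2 => ?_, fun h1 h2 => ?_, fun h1 h2 => ?_⟩
    · exact before_seqChoice_first (hA₂ r ((m2 r hr).2 h)) ((m2 u hu).2 h1)
        (fun h3 => h2 ((m2 v hv).1 h3))
    · exact before_seqChoice_in ((m2 u hu).2 h1) ((m2 v hv).2 h2)
    · rw [before_seqChoice_out (fun h3 => h1 ((m2 u hu).1 h3)) (fun h3 => h2 ((m2 v hv).1 h3))]
      exact key _ _ ((m1 u hu).2 h1) ((m1 v hv).2 h2)
  · have h' : r ∈ S \ T.below S c c₂ := (m1 r hr).2 h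
    simp only [phaseTwo, if_pos h', h, false_iff, if_false, not_not]
    refine ⟨fun h1 h2 => ?_, fun h1 h2 => ?_, fun h1 h2 => ?_⟩
    · exact before_seqChoice_first (hA₁ r h') ((m1 u hu).2 h1)
        (fun h3 => (m1 v hv).1 h3 h2)
    · rw [before_seqChoice_out (fun h3 => (m1 u hu).1 h3 h1) (fun h3 => (m1 v hv).1 h3 h2)]
      exact key _ _ ((m2 u hu).2 h1) ((m2 v hv).2 h2)
    · exact before_seqChoice_in ((m1 u hu).2 h1) ((m1 v hv).2 h2)

include hS hc₂ hadj hB hA₁ hA₂ in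
theorem stepOrder : (T.ancTree ρ).StepOrder S c c₂ (T.wmax S) B A₁ A₂
    (T.sdAssign S c c₂ B A₁ A₂) := by
  have hcases := fun r hr => sdAssign_cases (A₁ := A₁) (A₂ := A₂) (B := B) (c₂ := c₂) hS (r := r) hr
  have hspec := fun r hr => phaseTwo_spec hS hc₂ hA₁ hA₂ (r := r) hr
  have mL : ∀ v ∈ S, (T.ancTree ρ).light c (T.wmax S) v → v ∈ T.lightPart S c := fun v hv h =>
    (mem_lightPart_iff hS).2 ⟨hv, h⟩
  have mL' : ∀ v, ¬ (T.ancTree ρ).light c (T.wmax S) v → v ∉ T.lightPart S c := fun v h h' =>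
    h ((mem_lightPart_iff hS).1 h').2
  have mB : ∀ y ∈ S, ∀ v ∈ S, (T.ancTree ρ).anc y v → v ∈ T.below S c y := fun y hy v hv h =>
    (mem_below_iff hS hy).2 ⟨hv, h⟩
  have mB' : ∀ y ∈ S, ∀ v, ¬ (T.ancTree ρ).anc y v → v ∉ T.below S c y := fun y hy v h h' =>
    h ((mem_below_iff hS hy).1 h').2
  have hp : ∀ y ∈ S, (T.ancTree ρ).heavy c (T.wmax S) y → T.parent ρ y ∈ S := fun y hyS hy =>
    hS.mem_of_anc hyS (AncTree.anc_par_of_anc (R := T.ancTree ρ) hy.1 hy.2.1) hy.par_anc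
  have hout : ∀ r ∈ S, ∀ u ∈ S, ∀ v ∈ S, ¬ (T.ancTree ρ).light c (T.wmax S) u →
      ¬ (T.ancTree ρ).light c (T.wmax S) v → (∀ y, (T.ancTree ρ).heavy c (T.wmax S) y →
        (T.ancTree ρ).anc y r → ¬ (T.ancTree ρ).anc y u ∧ ¬ (T.ancTree ρ).anc y v) →
      (Before (T.sdAssign S c c₂ B A₁ A₂ r) u v ↔
        Before (phaseTwo (S \ T.below S c c₂) (T.below S c c₂) c c₂ A₁ A₂ r) u v) := by
    intro r hr u hu v hv h1 h2 h3
    rcases hcases r hr with ⟨hl, h⟩ | ⟨y, hy, hyr, hyS, -, h⟩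
    · rw [h, before_seqChoice_out (mL' u h1) (mL' v h2),
        before_seqChoice_out (mL' u h1) (mL' v h2)]
    · obtain ⟨h4, h5⟩ := h3 y hy hyr
      rw [h, before_seqChoice_out (mB' y hyS u h4) (mB' y hyS v h5),
        before_seqChoice_out (mL' u h1) (mL' v h2)]
  refine ⟨child_spec hS hc₂ hadj, ?_, ?_, ?_, ?_, ?_, ?_, ?_⟩
  · intro r hr y hy hyr u hu v hv h1 h2
    rcases hcases r hr with ⟨hl, h⟩ | ⟨z, hz, hzr, hzS, -, h⟩
    · exact absurd hl (hy.not_light hyr)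
    · obtain rfl := hz.unique hy hzr hyr
      rw [h]
      exact before_seqChoice_first (choice_heavy hS hB hr hz hzr) (mB z hzS u hu h1)
        (mB' z hzS v h2)
  · intro r hr y hy hyr u hu v hv h1 h2
    rcases hcases r hr with ⟨hl, h⟩ | ⟨z, hz, hzr, hzS, -, h⟩
    · exact absurd hl (hy.not_light hyr)
    · obtain rfl := hz.unique hy hzr hyr
      rw [h]
      exact before_seqChoice_in (mB z hzS u hu h1) (mB z hzS v hv h2)
  · intro r hr y hy hyr u hu v hv h1 h2
    rcases hcases r hr with ⟨hl, h⟩ | ⟨z, hz, hzr, hzS, -, h⟩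
    · rw [h]
      exact before_seqChoice_first (choice_light hS hB hr hl) (mL u hu h1)
        (mL' v (hy.not_light h2))
    · rw [h, before_seqChoice_out (mB' z hzS u fun h3 => hz.not_light h3 h1)
        (mB' z hzS v fun h3 => hyr (hy.unique hz h2 h3 ▸ hzr))]
      exact before_seqChoice_first (choice_light hS hB (hp z hzS hz) hz.2.2.2) (mL u hu h1)
        (mL' v (hy.not_light h2))
  · intro r hr u hu v hv h1 h2
    rcases hcases r hr with ⟨hl, h⟩ | ⟨z, hz, hzr, hzS, hg, h⟩
    · rw [h, AncTree.gate_of_light hl]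
      exact before_seqChoice_in (mL u hu h1) (mL v hv h2)
    · rw [h, hg, before_seqChoice_out (mB' z hzS u fun h3 => hz.not_light h3 h1)
        (mB' z hzS v fun h3 => hz.not_light h3 h2)]
      exact before_seqChoice_in (mL u hu h1) (mL v hv h2)
  · intro r hr u hu v hv h1 h2 h3 h4 h5
    rw [hout r hr u hu v hv h1 h2 h3]
    exact (hspec r hr u hu v hv).1 h4 h5
  · intro r hr u hu v hv h1 h2 h3 h4 h5
    rw [hout r hr u hu v hv h1 h2 h3]
    exact (hspec r hr u hu v hv).2.1 h4 h5
  · intro r hr u hu v hv h1 h2 h3 h4 h5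
    rw [hout r hr u hu v hv h1 h2 h3]
    exact (hspec r hr u hu v hv).2.2 h4 h5

end Step

/-! ### The orders of a Subtree-Decomposition algorithm -/

section

open scoped Classical

theorem IsSD.isChoice {S : Finset V} {c : V} {A : AssignRule V} (h : T.IsSD S c A)
    (hS : (T.ancTree ρ).Sub S c) : ∀ r ∈ S, IsChoice S (A r) := by
  induction h with
  | single v =>
    intro r _ F hF hne
    have : F = {v} := by
      rcases Finset.subset_singleton_iff.1 hF with h | h
      · exact absurd h hne.ne_empty
      · exact h
    exact ⟨by simp [this], fun G _ _ => rfl⟩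
  | step S c c₂ B A₁ A₂ hc hc₂ hadj hB hA₁ hA₂ ihB ih₁ ih₂ =>
    exact fun r hr => sdAssign_isChoice hS hc₂ hadj
      (fun x hx => ihB x hx (sub_part hS hx))
      (ih₁ (sub_rest hS hc₂ hadj)) (ih₂ (sub_below hS hc₂)) hr

theorem IsSD.stepOrder {S : Finset V} {c c₂ : V} {B : V → AssignRule V} {A₁ A₂ : AssignRule V}
    (hS : (T.ancTree ρ).Sub S c) (hc₂ : c₂ ∈ S) (hadj : T.graph.Adj c c₂)
    (hB : ∀ x ∈ insert c (T.heavyRoots S c), T.IsSD (T.part S c x) x (B x))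
    (hA₁ : T.IsSD (S \ T.below S c c₂) c A₁) (hA₂ : T.IsSD (T.below S c c₂) c₂ A₂) :
    (T.ancTree ρ).StepOrder S c c₂ (T.wmax S) B A₁ A₂ (T.sdAssign S c c₂ B A₁ A₂) :=
  PowTwoTree.stepOrder hS hc₂ hadj (fun x hx => (hB x hx).isChoice (sub_part hS hx))
    (hA₁.isChoice (sub_rest hS hc₂ hadj)) (hA₂.isChoice (sub_below hS hc₂))

/-- What holds on all parts holds on the light part and below all heavy edges. -/
theorem forall_part {S : Finset V} {c : V} (hS : (T.ancTree ρ).Sub S c)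
    {P : Finset V → V → Prop} (h : ∀ x ∈ insert c (T.heavyRoots S c), P (T.part S c x) x) :
    P (T.lightPart S c) c ∧ ∀ y ∈ S, (T.ancTree ρ).heavy c (T.wmax S) y → P (T.below S c y) y := by
  constructor
  · have := h c (Finset.mem_insert_self _ _)
    rwa [part_root] at this
  · intro y hy hyh
    have := h y (Finset.mem_insert_of_mem ((mem_heavyRoots_iff hS).2 ⟨hy, hyh⟩))
    rwa [part_of_heavy hyh] at this

theorem IsSD.first {S : Finset V} {c : V} {A : AssignRule V} (h : T.IsSD S c A)
    (hS : (T.ancTree ρ).Sub S c) : ∀ r ∈ S, ∀ s ∈ S, r ≠ s → Before (A r) r s := by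
  induction h with
  | single v =>
    intro r hr s hs hne
    rw [Finset.mem_singleton] at hr hs
    exact absurd (hr.trans hs.symm) hne
  | step S c c₂ B A₁ A₂ hc hc₂ hadj hB hA₁ hA₂ ihB ih₁ ih₂ =>
    have h0 := forall_part hS (P := fun S' x => ∀ r ∈ S', ∀ s ∈ S', r ≠ s → Before (B x r) r s)
      fun x hx => ihB x hx (sub_part hS hx)
    refine (IsSD.stepOrder hS hc₂ hadj hB hA₁ hA₂).first (fun r hr hl s hs hls hne => ?_)
      (fun y hy r hr s hs hyr hys hne => ?_)
    · exact h0.1 r ((mem_lightPart_iff hS).2 ⟨hr, hl⟩) s ((mem_lightPart_iff hS).2 ⟨hs, hls⟩) hne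
    · have hyS := hS.mem_of_anc hr hy.1 hyr
      exact h0.2 y hyS hy r ((mem_below_iff hS hyS).2 ⟨hr, hyr⟩) s
        ((mem_below_iff hS hyS).2 ⟨hs, hys⟩) hne

theorem exists_wt_eq_wmax {S : Finset V} {c c₂ : V} (hS : (T.ancTree ρ).Sub S c) (hc₂ : c₂ ∈ S)
    (hne : c₂ ≠ c) : ∃ x ∈ S, x ≠ c ∧ (T.ancTree ρ).wt x = T.wmax S := by
  obtain ⟨e, he, hw⟩ := Finset.exists_mem_eq_sup (T.edgesIn S) ⟨_, T.mem_edgesIn ρ hS hc₂ hne⟩ T.w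
  obtain ⟨x, hx, hxc, -, rfl⟩ := T.exists_of_mem_edgesIn ρ hS he
  refine ⟨x, hx, hxc, ?_⟩
  rw [wmax, hw]
  rfl

/-- `W` is arbitrary because the recursion along child edges keeps `W` fixed, while the maximum
weight may drop below it; then everything is light. -/
theorem IsSD.served {S : Finset V} {c : V} {A : AssignRule V} (h : T.IsSD S c A)
    (hS : (T.ancTree ρ).Sub S c) : ∀ W : ℝ, (∀ x ∈ S, x ≠ c → (T.ancTree ρ).wt x ≤ W) →
    ∀ r ∈ S, (T.ancTree ρ).Served (Before (A r)) S c r W := by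
  induction h with
  | single v =>
    intro W _ r _
    refine AncTree.served_of_forall_light fun x hx => ?_
    rw [Finset.mem_singleton.1 hx]
    exact AncTree.light_self _ _
  | step S c c₂ B A₁ A₂ hc hc₂ hadj hB hA₁ hA₂ ihB ih₁ ih₂ =>
    intro W hW r hr
    obtain ⟨z, hz, hzc, hzW⟩ := exists_wt_eq_wmax hS hc₂ hadj.ne'
    have hle := hW z hz hzc
    rw [hzW] at hle
    rcases hle.lt_or_eq with hlt | rfl
    · refine AncTree.served_of_forall_light fun x hx => AncTree.light_of_forall_lt hS
        (fun x hx hxc => (T.wt_le_wmax ρ hS hx hxc).trans_lt hlt) hx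
    · have e₁ : (S.filter fun v => ¬ (T.ancTree ρ).anc c₂ v) = S \ T.below S c c₂ := by
        ext v
        rw [mem_rest_iff hS hc₂, Finset.mem_filter]
      have e₂ : (S.filter fun v => (T.ancTree ρ).anc c₂ v) = T.below S c c₂ := by
        ext v
        rw [mem_below_iff hS hc₂, Finset.mem_filter]
      refine (IsSD.stepOrder hS hc₂ hadj hB hA₁ hA₂).served hS (fun r hr h1 => ?_)
        (fun r hr h1 => ?_) hr
      · rw [e₁]
        exact ih₁ (sub_rest hS hc₂ hadj) _
          (fun x hx hxc => hW x ((mem_rest_iff hS hc₂).1 hx).1 hxc) r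
          ((mem_rest_iff hS hc₂).2 ⟨hr, h1⟩)
      · rw [e₂]
        refine ih₂ (sub_below hS hc₂) _ (fun x hx hxc => ?_) r
          ((mem_below_iff hS hc₂).2 ⟨hr, h1⟩)
        rw [mem_below_iff hS hc₂] at hx
        refine hW x hx.1 fun h2 => hadj.ne' ((T.ancTree ρ).antisymm (h2 ▸ hx.2) (hS.anc hc₂))

theorem IsSD.modular {S : Finset V} {c : V} {A : AssignRule V} (h : T.IsSD S c A)
    (hS : (T.ancTree ρ).Sub S c) : ∀ r ∈ S, ∀ S' ⊆ S, ∀ c' (W' : ℝ), (T.ancTree ρ).Sub S' c' →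
    (∀ x ∈ S', x ≠ c' → (T.ancTree ρ).wt x ≤ W') →
    (T.ancTree ρ).Modular (Before (A r)) S' c' W' := by
  induction h with
  | single v =>
    intro r _ S' hS'S c' W' hS' _
    refine AncTree.modular_of_forall_light fun x hx => ?_
    rw [Finset.mem_singleton.1 (hS'S hx), ← Finset.mem_singleton.1 (hS'S hS'.1)]
    exact AncTree.light_self _ _
  | step S c c₂ B A₁ A₂ hc hc₂ hadj hB hA₁ hA₂ ihB ih₁ ih₂ =>
    intro r hr S' hS'S c' W' hS' hW'
    have hpart := forall_part hS (P := fun S₀ x => (∀ r ∈ S₀, ∀ s ∈ S₀, r ≠ s → Before (B x r) r s) ∧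
      ∀ r ∈ S₀, ∀ S' ⊆ S₀, ∀ c' (W' : ℝ), (T.ancTree ρ).Sub S' c' →
        (∀ x ∈ S', x ≠ c' → (T.ancTree ρ).wt x ≤ W') →
        (T.ancTree ρ).Modular (Before (B x r)) S' c' W')
      fun x hx => ⟨(hB x hx).first (sub_part hS hx), ihB x hx (sub_part hS hx)⟩
    have hmax : ∀ x ∈ S, x ≠ c → (T.ancTree ρ).wt x ≤ T.wmax S := fun x hx hxc =>
      T.wt_le_wmax ρ hS hx hxc
    refine (IsSD.stepOrder hS hc₂ hadj hB hA₁ hA₂).modular hS hmax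
      (fun r hr => (IsSD.step S c c₂ B A₁ A₂ hc hc₂ hadj hB hA₁ hA₂).served hS _ hmax r hr)
      (fun r hr hl s hs hls hne => ?_) (fun r hr hl S' hs hall => ?_)
      (fun y hy r hr hyr S' hs hall => ?_) (fun r hr h1 S' hs hall => ?_)
      (fun r hr h1 S' hs hall => ?_) hr hS'S hS' hW'
    · exact hpart.1.1 r ((mem_lightPart_iff hS).2 ⟨hr, hl⟩) s
        ((mem_lightPart_iff hS).2 ⟨hs, hls⟩) hne
    · exact hpart.1.2 r ((mem_lightPart_iff hS).2 ⟨hr, hl⟩) S' fun v hv =>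
        (mem_lightPart_iff hS).2 ⟨hs hv, hall v hv⟩
    · have hyS := hS.mem_of_anc hr hy.1 hyr
      exact (hpart.2 y hyS hy).2 r ((mem_below_iff hS hyS).2 ⟨hr, hyr⟩) S' fun v hv =>
        (mem_below_iff hS hyS).2 ⟨hs hv, hall v hv⟩
    · exact ih₁ (sub_rest hS hc₂ hadj) r ((mem_rest_iff hS hc₂).2 ⟨hr, h1⟩) S' fun v hv =>
        (mem_rest_iff hS hc₂).2 ⟨hs hv, hall v hv⟩
    · exact ih₂ (sub_below hS hc₂) r ((mem_below_iff hS hc₂).2 ⟨hr, h1⟩) S' fun v hv =>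
        (mem_below_iff hS hc₂).2 ⟨hs hv, hall v hv⟩

theorem sub_univ : (T.ancTree ρ).Sub Finset.univ ρ :=
  ⟨Finset.mem_univ _, fun v _ => ⟨(T.ancTree ρ).root_anc v, fun _ _ _ => Finset.mem_univ _⟩⟩

theorem IsSD.goodOrder {A : AssignRule V} (h : T.IsSD Finset.univ ρ A) (r : V) :
    (T.ancTree ρ).GoodOrder (Before (A r)) :=
  ⟨fun _ _ h1 => h1.asymm, fun S c W hS hW =>
    h.modular sub_univ r (Finset.mem_univ _) S (Finset.subset_univ _) c W hS hW⟩

end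

end PowTwoTree

/-! ### The cavities of a hybrid instance -/

section Cavities

open scoped Classical

variable {V : Type*}

/-- If two sets of free servers differ in one server each, then after a request they coincide, or
they differ in one server each, and at most one of these two servers has changed. -/
theorem cavity_step [Fintype V] {f : Finset V → V} (hf : IsChoice Finset.univ f) {X Y : Finset V}
    {a h : V} (hX : X \ Y = {a}) (hY : Y \ X = {h}) :
    X.erase (f X) = Y.erase (f Y) ∨ ∃ a' h', X.erase (f X) \ Y.erase (f Y) = {a'} ∧
      Y.erase (f Y) \ X.erase (f X) = {h'} ∧ (h' = h ∨ a' = a) ∧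
      (h' ≠ h → h' ∈ X ∩ Y ∧ Before f h h' ∧ (∀ g ∈ X ∩ Y, g ≠ h' → Before f h' g) ∧
        Before f h' a) ∧
      (a' ≠ a → a' ∈ X ∩ Y ∧ Before f a a' ∧ (∀ g ∈ X ∩ Y, g ≠ a' → Before f a' g) ∧
        Before f a' h) := by
  have ha : a ∈ X ∧ a ∉ Y := by
    rw [← Finset.mem_sdiff, hX]
    simp
  have hh : h ∈ Y ∧ h ∉ X := by
    rw [← Finset.mem_sdiff, hY]
    simp
  have hXe : ∀ v, v ∈ X → v = a ∨ v ∈ Y := fun v hv => by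
    by_contra hc
    push Not at hc
    have : v ∈ X \ Y := Finset.mem_sdiff.2 ⟨hv, hc.2⟩
    rw [hX, Finset.mem_singleton] at this
    exact hc.1 this
  have hYe : ∀ v, v ∈ Y → v = h ∨ v ∈ X := fun v hv => by
    by_contra hc
    push Not at hc
    have : v ∈ Y \ X := Finset.mem_sdiff.2 ⟨hv, hc.2⟩
    rw [hY, Finset.mem_singleton] at this
    exact hc.1 this
  obtain ⟨hfX, hfX'⟩ := hf X (Finset.subset_univ _) ⟨a, ha.1⟩
  obtain ⟨hfY, hfY'⟩ := hf Y (Finset.subset_univ _) ⟨h, hh.1⟩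
  have bX : ∀ v ∈ X, v ≠ f X → Before f (f X) v := fun v hv => hf.before (Finset.subset_univ _) hv
  have bY : ∀ v ∈ Y, v ≠ f Y → Before f (f Y) v := fun v hv => hf.before (Finset.subset_univ _) hv
  -- Each run uses either its private free server or a common one. Both private: the runs couple.
  -- One private: that cavity moves to the server used by the other run. Both common: consistency
  -- makes the servers equal.
  rcases hXe _ hfX with hX1 | hX1 <;> rcases hYe _ hfY with hY1 | hY1
  · left
    rw [hX1, hY1]
    ext v
    simp only [Finset.mem_erase]
    grind
  · right
    refine ⟨f Y, h, ?_, ?_, Or.inl rfl, fun hc => absurd rfl hc, fun _ => ?_⟩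
    · ext v
      simp only [Finset.mem_sdiff, Finset.mem_erase, Finset.mem_singleton]
      grind
    · ext v
      simp only [Finset.mem_sdiff, Finset.mem_erase, Finset.mem_singleton]
      grind
    · refine ⟨Finset.mem_inter.2 ⟨hY1, hfY⟩, ?_, fun g hg hne => bY g (Finset.mem_inter.1 hg).2 hne,
        bY h hh.1 fun hc => hh.2 (hc ▸ hY1)⟩
      have := bX (f Y) hY1 fun hc => ha.2 (hX1 ▸ hc ▸ hfY)
      rwa [hX1] at this
  · right
    refine ⟨a, f X, ?_, ?_, Or.inr rfl, fun _ => ?_, fun hc => absurd rfl hc⟩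
    · ext v
      simp only [Finset.mem_sdiff, Finset.mem_erase, Finset.mem_singleton]
      grind
    · ext v
      simp only [Finset.mem_sdiff, Finset.mem_erase, Finset.mem_singleton]
      grind
    · refine ⟨Finset.mem_inter.2 ⟨hfX, hX1⟩, ?_, fun g hg hne => bX g (Finset.mem_inter.1 hg).1 hne,
        bX a ha.1 fun hc => ha.2 (hc ▸ hX1)⟩
      have := bY (f X) hX1 fun hc => hh.2 (hY1 ▸ hc ▸ hfX)
      rwa [hY1] at this
  · right
    have h1 := hfX' (X ∩ Y) Finset.inter_subset_left (Finset.mem_inter.2 ⟨hfX, hX1⟩)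
    have h2 := hfY' (X ∩ Y) Finset.inter_subset_right (Finset.mem_inter.2 ⟨hY1, hfY⟩)
    have h3 : f X = f Y := h1.symm.trans h2
    refine ⟨a, h, ?_, ?_, Or.inl rfl, fun hc => absurd rfl hc, fun hc => absurd rfl hc⟩
    · ext v
      simp only [Finset.mem_sdiff, Finset.mem_erase, Finset.mem_singleton]
      grind
    · ext v
      simp only [Finset.mem_sdiff, Finset.mem_erase, Finset.mem_singleton]
      grind

end Cavities

/-! ### Existence and course of the cavities -/

section Hybrid

open scoped Classical

variable {V : Type*} [Fintype V]

theorem card_freeSet_le (alg : ℕ → AssignRule V) (σ : ℕ → V)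
    (h : ∀ t r F, F.Nonempty → alg t r F ∈ F) (t : ℕ) :
    (freeSet alg σ t).card ≤ Fintype.card V - t := by
  induction t with
  | zero => simp [freeSet, Finset.card_univ]
  | succ t ih =>
    rw [freeSet]
    rcases (freeSet alg σ t).eq_empty_or_nonempty with h1 | h1
    · simp [h1]
    · rw [Finset.card_erase_of_mem (h _ _ _ h1)]
      omega

namespace HybridInstance

variable {A : AssignRule V} (H : HybridInstance A)

theorem freeA_succ (t : ℕ) :
    H.freeA (t + 1) = (H.freeA t).erase (A (H.σ (t + 1)) (H.freeA t)) := rfl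

theorem freeH_succ {t : ℕ} (ht : t + 1 ≠ H.td) :
    H.freeH (t + 1) = (H.freeH t).erase (A (H.σ (t + 1)) (H.freeH t)) := by
  have : H.freeH (t + 1) = (H.freeH t).erase
    (hybridAlg A H.td H.ad (t + 1) (H.σ (t + 1)) (H.freeH t)) := rfl
  rw [this, hybridAlg, if_neg fun h => ht h.1]

theorem freeH_eq_of_lt {t : ℕ} (ht : t < H.td) : H.freeH t = H.freeA t := by
  induction t with
  | zero => rfl
  | succ t ih => rw [H.freeH_succ ht.ne, H.freeA_succ, ih (by omega)]

theorem freeA_eq_mono {s t : ℕ} (hs : H.td ≤ s) (hst : s ≤ t) (h : H.freeA s = H.freeH s) :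
    H.freeA t = H.freeH t := by
  induction t, hst using Nat.le_induction with
  | base => exact h
  | succ n hn ih => rw [H.freeH_succ (by omega), H.freeA_succ, ih]

variable (hA : ∀ r, IsChoice Finset.univ (A r))

include hA in
theorem cavities_td : ∃ h, H.freeA H.td \ H.freeH H.td = {H.ad} ∧
    H.freeH H.td \ H.freeA H.td = {h} := by
  obtain ⟨n, hn⟩ : ∃ n, H.td = n + 1 := ⟨H.td - 1, by have := H.one_le_td; omega⟩
  have hv : H.ad ∈ H.freeA (n + 1) := hn ▸ H.valid
  have h1 := H.freeH_eq_of_lt (t := n) (by omega)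
  rw [freeA_succ, Finset.mem_erase] at hv
  have h2 : H.freeH (n + 1) = (H.freeA n).erase H.ad := by
    have : H.freeH (n + 1) = (H.freeH n).erase
      (hybridAlg A H.td H.ad (n + 1) (H.σ (n + 1)) (H.freeH n)) := rfl
    rw [this, h1, hybridAlg, if_pos ⟨hn.symm, hv.2⟩]
  have h3 := (hA (H.σ (n + 1)) (H.freeA n) (Finset.subset_univ _) ⟨_, hv.2⟩).1
  refine ⟨A (H.σ (n + 1)) (H.freeA n), ?_, ?_⟩
  · rw [hn, h2, freeA_succ]
    ext v
    simp only [Finset.mem_sdiff, Finset.mem_erase, Finset.mem_singleton]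
    grind
  · rw [hn, h2, freeA_succ]
    ext v
    simp only [Finset.mem_sdiff, Finset.mem_erase, Finset.mem_singleton]
    grind

include hA in
theorem eq_or_cavities {t : ℕ} (ht : H.td ≤ t) : H.freeA t = H.freeH t ∨
    ∃ a h, H.freeA t \ H.freeH t = {a} ∧ H.freeH t \ H.freeA t = {h} := by
  induction t, ht using Nat.le_induction with
  | base =>
    obtain ⟨h, h1, h2⟩ := H.cavities_td hA
    exact Or.inr ⟨_, h, h1, h2⟩
  | succ n hn ih =>
    rw [H.freeH_succ (by omega), H.freeA_succ]
    rcases ih with ih | ⟨a, h, h1, h2⟩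
    · left
      rw [ih]
    · rcases cavity_step (hA (H.σ (n + 1))) h1 h2 with h3 | ⟨a', h', h3, h4, -⟩
      · exact Or.inl h3
      · exact Or.inr ⟨a', h', h3, h4⟩

include hA in
theorem exists_isCavities : ∃ (tc : ℕ) (h a : ℕ → V), H.IsCavities tc h a := by
  have hmem : ∀ (r : V) (F : Finset V), F.Nonempty → A r F ∈ F := fun r F hF =>
    (hA r F (Finset.subset_univ _) hF).1
  have cA : ∀ t, (H.freeA t).card ≤ Fintype.card V - t :=
    card_freeSet_le _ _ fun _ r F hF => hmem r F hF
  have cH : ∀ t, (H.freeH t).card ≤ Fintype.card V - t := by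
    refine card_freeSet_le _ _ fun t r F hF => ?_
    unfold hybridAlg
    split_ifs with h
    · exact h.2
    · exact hmem r F hF
  have htd : H.td ≤ Fintype.card V := by
    have h1 : 0 < (H.freeA H.td).card := Finset.card_pos.2 ⟨_, H.valid⟩
    have := cA H.td
    omega
  have hne : H.freeA H.td ≠ H.freeH H.td := by
    obtain ⟨h, h1, -⟩ := H.cavities_td hA
    intro h2
    rw [h2, Finset.sdiff_self] at h1
    exact (Finset.singleton_ne_empty _ h1.symm)
  -- Once equal, the free sets stay equal, and after time `|V|` both are empty; so the coupling time
  -- is the last disagreement up to `|V|`.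
  set tc := Nat.findGreatest (fun t => H.freeA t ≠ H.freeH t) (Fintype.card V) with htc
  have htcn : H.freeA tc ≠ H.freeH tc :=
    Nat.findGreatest_spec (P := fun t => H.freeA t ≠ H.freeH t) htd hne
  have hcav : ∀ t, ∃ p : V × V, H.td ≤ t → t ≤ tc →
      H.freeA t \ H.freeH t = {p.1} ∧ H.freeH t \ H.freeA t = {p.2} := by
    intro t
    by_cases ht : H.td ≤ t ∧ t ≤ tc
    · rcases H.eq_or_cavities hA ht.1 with h | ⟨a, h, h1, h2⟩
      · exact absurd (H.freeA_eq_mono ht.1 ht.2 h) htcn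
      · exact ⟨(a, h), fun _ _ => ⟨h1, h2⟩⟩
    · exact ⟨(H.ad, H.ad), fun h1 h2 => absurd ⟨h1, h2⟩ ht⟩
  choose p hp using hcav
  refine ⟨tc, fun t => (p t).2, fun t => (p t).1, Nat.le_findGreatest htd hne,
    fun t h1 h2 => (hp t h1 h2).2, fun t h1 h2 => (hp t h1 h2).1, fun t ht => ?_⟩
  by_cases htV : t ≤ Fintype.card V
  · by_contra h
    exact Nat.findGreatest_is_greatest ht htV h
  · have h1 := cA t
    have h2 := cH t
    rw [Nat.sub_eq_zero_of_le (by omega), Nat.le_zero, Finset.card_eq_zero] at h1 h2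
    rw [h1, h2]

variable {H}

theorem mem_cavSet_h {tc t : ℕ} {h a : ℕ → V} (h1 : H.td ≤ t) (h2 : t ≤ tc) :
    h t ∈ H.cavSet tc h a :=
  Finset.mem_union_left _ (Finset.mem_image_of_mem _ (Finset.mem_Icc.2 ⟨h1, h2⟩))

theorem mem_cavSet_a {tc t : ℕ} {h a : ℕ → V} (h1 : H.td ≤ t) (h2 : t ≤ tc) :
    a t ∈ H.cavSet tc h a :=
  Finset.mem_union_right _ (Finset.mem_image_of_mem _ (Finset.mem_Icc.2 ⟨h1, h2⟩))

include hA in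
/-- The cavities of a hybrid instance move as described by `AncTree.Trace`. -/
theorem IsCavities.trace {R : AncTree V} {tc : ℕ} {h a : ℕ → V} (hc : H.IsCavities tc h a)
    (hg : ∀ r, R.GoodOrder (Before (A r))) {S : Finset V} (hS : H.cavSet tc h a ⊆ S) :
    R.Trace S (fun t => H.freeA t ∩ H.freeH t) (fun t => some (h t)) (fun t => some (a t))
      H.td tc := by
  have key : ∀ t, H.td ≤ t → t < tc → H.freeA (t + 1) = (H.freeA t).erase
      (A (H.σ (t + 1)) (H.freeA t)) ∧ H.freeH (t + 1) = (H.freeH t).erase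
      (A (H.σ (t + 1)) (H.freeH t)) ∧ (h (t + 1) = h t ∨ a (t + 1) = a t) ∧
      (h (t + 1) ≠ h t → h (t + 1) ∈ H.freeA t ∩ H.freeH t ∧
        Before (A (H.σ (t + 1))) (h t) (h (t + 1)) ∧
        (∀ g ∈ H.freeA t ∩ H.freeH t, g ≠ h (t + 1) →
          Before (A (H.σ (t + 1))) (h (t + 1)) g) ∧
        Before (A (H.σ (t + 1))) (h (t + 1)) (a t)) ∧
      (a (t + 1) ≠ a t → a (t + 1) ∈ H.freeA t ∩ H.freeH t ∧
        Before (A (H.σ (t + 1))) (a t) (a (t + 1)) ∧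
        (∀ g ∈ H.freeA t ∩ H.freeH t, g ≠ a (t + 1) →
          Before (A (H.σ (t + 1))) (a (t + 1)) g) ∧
        Before (A (H.σ (t + 1))) (a (t + 1)) (h t)) := by
    intro t h1 h2
    have eA := H.freeA_succ t
    have eH := H.freeH_succ (t := t) (by omega)
    refine ⟨eA, eH, ?_⟩
    have ha' := hc.aCavity (t + 1) (by omega) (by omega)
    have hh' := hc.hCavity (t + 1) (by omega) (by omega)
    rw [eA, eH] at ha' hh'
    rcases cavity_step (hA (H.σ (t + 1))) (hc.aCavity t h1 h2.le) (hc.hCavity t h1 h2.le) with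
      h3 | ⟨a', h', h3, h4, h5⟩
    · rw [h3, Finset.sdiff_self] at ha'
      exact absurd ha'.symm (Finset.singleton_ne_empty _)
    · rw [ha'] at h3
      rw [hh'] at h4
      rw [Finset.singleton_inj] at h3 h4
      rw [h3, h4]
      exact h5
  refine ⟨fun t h1 h2 => ?_, fun t h1 h2 => ?_, fun t h1 h2 => ?_, fun t h1 h2 => ?_, ?_, ?_⟩
  · obtain ⟨eA, eH, -⟩ := key t h1 h2
    simp only [eA, eH]
    exact Finset.inter_subset_inter (Finset.erase_subset _ _) (Finset.erase_subset _ _)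
  · obtain ⟨-, -, -, h3, -⟩ := key t h1 h2
    by_cases he : h (t + 1) = h t
    · exact Or.inl (by rw [he])
    · obtain ⟨h4, h5, h6, h7⟩ := h3 he
      refine Or.inr (Or.inl ⟨_, h4, rfl, fun x hx => ⟨_, hg (H.σ (t + 1)), ?_, h6, fun y hy => ?_⟩⟩)
      · rwa [← Option.some.inj hx]
      · rwa [← Option.some.inj hy]
  · obtain ⟨-, -, -, -, h3⟩ := key t h1 h2
    by_cases he : a (t + 1) = a t
    · exact Or.inl (by rw [he])
    · obtain ⟨h4, h5, h6, h7⟩ := h3 he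
      refine Or.inr (Or.inl ⟨_, h4, rfl, fun x hx => ⟨_, hg (H.σ (t + 1)), ?_, h6, fun y hy => ?_⟩⟩)
      · rwa [← Option.some.inj hx]
      · rwa [← Option.some.inj hy]
  · obtain ⟨-, -, h3, -⟩ := key t h1 h2
    exact h3.imp (fun h => by rw [h]) (fun h => by rw [h])
  · intro t h1 h2 v hv
    rw [← Option.some.inj hv]
    exact hS (mem_cavSet_h h1 h2)
  · intro t h1 h2 v hv
    rw [← Option.some.inj hv]
    exact hS (mem_cavSet_a h1 h2)

end HybridInstance

end Hybrid

/-! ### From the hybrid cycle to the closed walk -/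

namespace PowTwoTree

open scoped Classical

variable {V : Type*} [Fintype V] (T : PowTwoTree V) (ρ : V)

/-- Common ancestors form a chain, so the one farthest from the root is below all others. -/
theorem lca_spec (u v : V) : T.IsAncestor ρ (T.lca ρ u v) u ∧ T.IsAncestor ρ (T.lca ρ u v) v ∧
    ∀ x, T.IsAncestor ρ x u → T.IsAncestor ρ x v → T.IsAncestor ρ x (T.lca ρ u v) := by
  obtain ⟨h1, h2⟩ := (Finset.exists_max_image _ (T.dist ρ)
    (T.commonAncestors_nonempty ρ u v)).choose_spec
  change T.lca ρ u v ∈ _ at h1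
  rw [Finset.mem_filter] at h1
  refine ⟨h1.2.1, h1.2.2, fun x hu hv => ?_⟩
  rcases (T.ancTree ρ).chain hu h1.2.1 with h3 | h3
  · exact h3
  · have h4 : T.dist ρ x ≤ T.dist ρ (T.lca ρ u v) := h2 x (by simp [hu, hv])
    rw [T.dist_split h3] at h4
    by_cases hne : T.lca ρ u v = x
    · rw [hne]
      exact (T.ancTree ρ).refl x
    · linarith [T.dist_pos hne]

/-- The right-hand side is the length of the way from `u` up to `c` and down to `v`, which covers
the stretch between `c` and the least common ancestor twice in addition. -/
theorem dist_add_lca_le {S : Finset V} {c u v : V} (hS : (T.ancTree ρ).Sub S c) (hu : u ∈ S)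
    (hv : v ∈ S) : T.dist u v + 2 * T.dist (T.lca ρ u v) c ≤
    ∑ x ∈ S.erase c, (T.ancTree ρ).wt x *
      (xr (T.IsAncestor ρ x u) False + xr (T.IsAncestor ρ x v) False) := by
  obtain ⟨h1, h2, h3⟩ := T.lca_spec ρ u v
  have h4 := h3 c (hS.anc hu) (hS.anc hv)
  have h5 := T.dist_le_of_sub ρ hS hu hv
  have h6 := T.dist_le_of_sub ρ hS (hS.mem_of_anc hu h4 h1) hS.1
  calc _ ≤ _ := add_le_add h5 (mul_le_mul_of_nonneg_left h6 zero_le_two)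
    _ = ∑ x ∈ S.erase c, (T.ancTree ρ).wt x * (xr (T.IsAncestor ρ x u) (T.IsAncestor ρ x v) +
      2 * xr (T.IsAncestor ρ x (T.lca ρ u v)) (T.IsAncestor ρ x c)) := by
        rw [Finset.mul_sum, ← Finset.sum_add_distrib]
        exact Finset.sum_congr rfl fun x _ => by ring
    _ ≤ _ := by
        refine Finset.sum_le_sum fun x hx => mul_le_mul_of_nonneg_left ?_
          ((T.ancTree ρ).wt_nonneg x)
        rw [Finset.mem_erase] at hx
        have h7 : ¬ T.IsAncestor ρ x c := fun h => hx.1 ((T.ancTree ρ).antisymm h (hS.anc hx.2))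
        have h8 : T.IsAncestor ρ x (T.lca ρ u v) → T.IsAncestor ρ x u ∧ T.IsAncestor ρ x v :=
          fun h => ⟨(T.ancTree ρ).trans h h1, (T.ancTree ρ).trans h h2⟩
        unfold xr
        by_cases p : T.IsAncestor ρ x u <;> by_cases q : T.IsAncestor ρ x v <;>
          by_cases l : T.IsAncestor ρ x (T.lca ρ u v) <;> simp [p, q, l, h7] at h8 ⊢ <;> norm_num

theorem cycleLength_add_le {A : AssignRule V} {H : HybridInstance A} {tc : ℕ} {h a : ℕ → V}
    (htc : H.td ≤ tc) {S : Finset V} {c : V} (hS : (T.ancTree ρ).Sub S c)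
    (hCS : H.cavSet tc h a ⊆ S) :
    H.cycleLength T.dist tc h a + 2 * T.dist (T.lca ρ (h H.td) (a H.td)) c ≤
      (T.ancTree ρ).walkLength S c (fun t => some (h t)) (fun t => some (a t)) H.td tc := by
  have mh : ∀ t, H.td ≤ t → t ≤ tc → h t ∈ S := fun t h1 h2 =>
    hCS (HybridInstance.mem_cavSet_h h1 h2)
  have ma : ∀ t, H.td ≤ t → t ≤ tc → a t ∈ S := fun t h1 h2 =>
    hCS (HybridInstance.mem_cavSet_a h1 h2)
  have h1 := T.dist_add_lca_le ρ hS (mh _ le_rfl htc) (ma _ le_rfl htc)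
  have h2 := T.dist_le_of_sub ρ hS (mh tc htc le_rfl) (ma tc htc le_rfl)
  have h3 : ∑ t ∈ Finset.Icc (H.td + 1) tc, (T.dist (h (t - 1)) (h t) + T.dist (a (t - 1)) (a t)) ≤
      ∑ t ∈ Finset.Ico H.td tc, ∑ x ∈ S.erase c, (T.ancTree ρ).wt x *
        (xr (T.IsAncestor ρ x (h t)) (T.IsAncestor ρ x (h (t + 1))) +
          xr (T.IsAncestor ρ x (a t)) (T.IsAncestor ρ x (a (t + 1)))) := by
    have e : Finset.Icc (H.td + 1) tc = Finset.Ico (H.td + 1) (tc + 1) := by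
      ext t
      simp only [Finset.mem_Icc, Finset.mem_Ico]
      omega
    rw [e, ← Finset.sum_Ico_add' (fun t => T.dist (h (t - 1)) (h t) + T.dist (a (t - 1)) (a t))]
    refine Finset.sum_le_sum fun t ht => ?_
    rw [Finset.mem_Ico] at ht
    simp only [Nat.add_sub_cancel, mul_add, Finset.sum_add_distrib]
    exact add_le_add
      (T.dist_le_of_sub ρ hS (mh t ht.1 ht.2.le) (mh (t + 1) (by omega) (by omega)))
      (T.dist_le_of_sub ρ hS (ma t ht.1 ht.2.le) (ma (t + 1) (by omega) (by omega)))
  rw [Finset.sum_comm] at h3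
  have h4 : (T.ancTree ρ).walkLength S c (fun t => some (h t)) (fun t => some (a t)) H.td tc =
      ∑ x ∈ S.erase c, (T.ancTree ρ).wt x *
        (xr (T.IsAncestor ρ x (h H.td)) False + xr (T.IsAncestor ρ x (a H.td)) False) +
      ∑ x ∈ S.erase c, (T.ancTree ρ).wt x *
        xr (T.IsAncestor ρ x (h tc)) (T.IsAncestor ρ x (a tc)) +
      ∑ x ∈ S.erase c, ∑ t ∈ Finset.Ico H.td tc, (T.ancTree ρ).wt x *
        (xr (T.IsAncestor ρ x (h t)) (T.IsAncestor ρ x (h (t + 1))) +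
          xr (T.IsAncestor ρ x (a t)) (T.IsAncestor ρ x (a (t + 1)))) := by
    unfold AncTree.walkLength
    rw [← Finset.sum_add_distrib, ← Finset.sum_add_distrib]
    refine Finset.sum_congr rfl fun x _ => ?_
    rw [← Finset.mul_sum, Finset.sum_add_distrib]
    simp only [crossings, changes, AncTree.at_some, T.ancTree_anc ρ]
    ring
  rw [h4]
  unfold HybridInstance.cycleLength
  linarith

end PowTwoTree

theorem mainTheorem7 {V : Type*} [Fintype V] (T : PowTwoTree V) (ρ : V) (A : AssignRule V)
    (hA : T.IsSD Finset.univ ρ A) (H : HybridInstance A) :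
    (∃ (tc : ℕ) (h a : ℕ → V), H.IsCavities tc h a) ∧
    ∀ (tc : ℕ) (h a : ℕ → V), H.IsCavities tc h a →
      H.cycleLength T.dist tc h a ≤
        2 * (((T.edgesIn (T.minSubtree (H.cavSet tc h a))).card : ℝ) *
          T.wmax (T.minSubtree (H.cavSet tc h a))) -
        2 * T.dist (T.lca ρ (h H.td) H.ad)
          (T.rootOf ρ (T.minSubtree (H.cavSet tc h a))) := by
  have hch : ∀ r, IsChoice Finset.univ (A r) := fun r =>
    hA.isChoice (ρ := ρ) PowTwoTree.sub_univ r (Finset.mem_univ _)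
  refine ⟨H.exists_isCavities hch, fun tc h a hc => ?_⟩
  have hne : (H.cavSet tc h a).Nonempty :=
    ⟨_, HybridInstance.mem_cavSet_h le_rfl hc.td_le⟩
  have hS := T.minSubtree_sub ρ hne
  have hCS := T.subset_minSubtree (H.cavSet tc h a)
  have had : a H.td = H.ad := by
    obtain ⟨_, h1, -⟩ := H.cavities_td hch
    exact Finset.singleton_inj.1 ((hc.aCavity H.td le_rfl hc.td_le).symm.trans h1)
  have h1 := T.cycleLength_add_le ρ hc.td_le hS hCS
  have h2 := AncTree.walkLength_le _ _ _ _ _ _ _ _ _ rfl hS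
    (fun x hx hxc => T.wt_le_wmax ρ hS hx hxc) hc.td_le
    (hc.trace (R := T.ancTree ρ) hch (fun r => hA.goodOrder r) hCS)
  have hw : 0 ≤ T.wmax (T.minSubtree (H.cavSet tc h a)) := NNReal.coe_nonneg _
  have h3 := mul_le_mul_of_nonneg_right (T.card_le_card_edgesIn ρ hS) hw
  rw [had] at h1
  linarith
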